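/- **Setting.** Let $K_i\subset\mathbb{CP}^1$ ($i\in I$) be closed disks and $\varepsilon>0$, let $\widetilde K_i$ be the concentric disk of radius $e^{2\varepsilon}\operatorname{radius}(K_i)$, and suppose that the $\widetilde K_i$ are pairwise disjoint and *well-separated*: if $l_{ij}$ ($i\ne j$) is the conformal distance between $\widetilde K_i$ and $\widetilde K_j$ (the tube between them is conformally $S^1\times[0,l_{ij}]$, $S^1$ of length $2\pi$) and $l_{ii}=0$, then $\inf_{i\neq j}l_{ij}>0$, $\overline{\bigcup_i\widetilde K_i}\ne\mathbb{CP}^1$, and the matrix $(e^{-l_{ij}/2})$ is bounded in $l_2$. (The affine coordinate is chosen with $\infty\notin\bigcup_i\widetilde K_i$; radii and centers are taken in it.) Let $i\mapsto i'$ be an involution of $I$ which interchanges the parts of a decomposition $I=I_+\sqcup I_+'$, and let $\varphi_i\in SL(2,\mathbb C)$, $\varphi_{i'}=\varphi_i^{-1}$, map the exterior of $K_i$ onto $K_{i'}$, and $\partial K_i$ onto $\partial K_{i'}$. Let $R_i$ be the open annulus between $\partial\widetilde K_i$ and $\varphi_i^{-1}(\partial\widetilde K_{i'})$. These data define the curve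 $\bar M$. A bundle $\mathcal L$ on $\bar M$ is given by nowhere vanishing holomorphic *gluing functions* $\psi_i$ on $R_i$ with $\psi_{i'}\circ\varphi_i=\psi_i^{-1}$; tensor products, inverses and integer powers of bundles are given by products, inverses and powers of the gluing functions. The bundle has *finite degree* if the index (winding number) $\operatorname{ind}\psi_i$ along $\partial K_i$ is $0$ for all but finitely many $i$. Let $L_2(\partial K_i)$ be the Hilbert space of half-forms $f\,dz^{1/2}$ on $\partial K_i$ with $\|f\,dz^{1/2}\|^2=\int_{\partial K_i}|f|^2|dz|$, let $L_2^{+}(\partial K_i)$ and $L_2^-(\partial K_i)$ be the subspaces of those which extend holomorphically inside, respectively outside, the circle, and let $\mathcal H^\pm=\bigoplus_{l_2}L_2^\pm(\partial K_i)$. Let $\mathbf K\colon\mathcal H^-\to\mathcal H^+$ be the bounded operator with zero diagonal blocks whose block from $\partial K_j$ to $\partial K_i$, $i\ne j$, is the Cauchy integral $f\mapsto\frac1{2\pi \mathrm i}\oint_{\partial K_j}\frac{f(\zeta)\,d\zeta}{z-\zeta}$. For a bundle of finite degree let $\Pi_{\{\psi\}}\colon\mathcal H^+\to\mathcal H^-$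 be the (closed, possibly unbounded) direct sum over $i\in I_+$ of bounded operators $$\Pi_i\colon L_2^+(\partial K_i)\oplus L_2^+(\partial K_{i'})\to L_2^-(\partial K_i)\oplus L_2^-(\partial K_{i'}),$$ where, if $\operatorname{ind}\psi_i=0$, the graph of $\Pi_i$ is the space of pairs $(f,g)\in L_2(\partial K_i)\oplus L_2(\partial K_{i'})$ with $\varphi_i^*g=\psi_if$, and otherwise $\Pi_i$ is any bounded operator whose graph is comparable with that space (i.e. their intersection has finite codimension in both). The bundle $\mathcal L$ (of finite degree) is *Hilbert–Schmidt* if both $\Pi_{\{\psi\}}\mathbf K$ and $\Pi_{\{\psi^{-1}\}}\mathbf K$ are Hilbert–Schmidt operators, and *strongly Hilbert–Schmidt* if $\mathcal L^{n}$ is Hilbert–Schmidt for every $n\in\mathbb Z$. **Proposition (log-convexity of Hilbert–Schmidt bundles).** 1. Let $\mathcal L$ and $\mathcal M$ be bundles on $\bar M$ given by gluing functions $\psi_i$ and $\gamma_i$, all but finitely many of which are constant. If both $\mathcal M\otimes\mathcal L$ and $\mathcal M\otimes\mathcal L^{-1}$ are Hilbert–Schmidt, then $\mathcal M$ is Hilbert–Schmidt.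 2. If $\mathcal L$ and $\mathcal M$ are strongly Hilbert–Schmidt bundles on $\bar M$, then $\mathcal L\otimes\mathcal M$ is strongly Hilbert–Schmidt. -/

import Mathlib

open MeasureTheory Set Filter Metric
open scoped ENNReal MatrixGroups

noncomputable section

namespace SchottkyModel

/-! ### Fractional-linear maps, half-forms, conformal distance -/

/-- The numerator `a z + b` of the fractional-linear map given by a matrix of `SL(2, ℂ)`. -/
def num (g : SL(2, ℂ)) (z : ℂ) : ℂ := g 0 0 * z + g 0 1

/-- The denominator `c z + d` of the fractional-linear map given by a matrix of `SL(2, ℂ)`. -/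
def den (g : SL(2, ℂ)) (z : ℂ) : ℂ := g 1 0 * z + g 1 1

/-- The fractional-linear map `z ↦ (a z + b) / (c z + d)`, at points other than its pole. -/
def mobius (g : SL(2, ℂ)) (z : ℂ) : ℂ := num g z / den g z

/-- The pull-back of half-forms: since `dφ(z) = dz / (c z + d) ^ 2`, the canonical square root gives
`φ^*(f dz^{1/2}) = f(φ(z)) (c z + d)⁻¹ dz^{1/2}`. -/
def halfFormPullback (g : SL(2, ℂ)) (f : ℂ → ℂ) (z : ℂ) : ℂ := (den g z)⁻¹ * f (mobius g z)

/-- `l` is the conformal distance between the boundaries of the disjoint closed disks `K₁`, `K₂`: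
some fractional-linear map `w = (a z + b) / (c z + d)` of the sphere sends `K₁` onto `{|w| ≤ 1}` and
`K₂` onto `{|w| ≥ e ^ l} ∪ {∞}`. Hence it sends the tube between the two circles onto
`{1 ≤ |w| ≤ e ^ l}`, which `w ↦ (arg w, log |w|)` identifies conformally with `S¹ × [0, l]`, where
`S¹` has length `2 π`. -/
def IsConformalDistance (K₁ K₂ : Set ℂ) (l : ℝ) : Prop :=
  0 < l ∧ ∃ g : SL(2, ℂ),
    (∀ z, z ∈ K₁ ↔ ‖num g z‖ ≤ ‖den g z‖) ∧
    (∀ z, z ∈ K₂ ↔ Real.exp l * ‖den g z‖ ≤ ‖num g z‖)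

/-! ### Square-integrable half-forms on a circle -/

/-- The arc length measure of the circle with center `c` and radius `r`. -/
def arcLength (c : ℂ) (r : ℝ) : Measure ℂ :=
  Measure.map (circleMap c r) (ENNReal.ofReal r • volume.restrict (Ioc 0 (2 * Real.pi)))

instance isFiniteMeasure_arcLength (c : ℂ) (r : ℝ) : IsFiniteMeasure (arcLength c r) := by
  unfold arcLength
  have : IsFiniteMeasure
      (ENNReal.ofReal r • (volume : Measure ℝ).restrict (Ioc 0 (2 * Real.pi))) :=
    Measure.smul_finite _ ENNReal.ofReal_ne_top
  infer_instance

/-- The Hilbert space `L₂(γ, Ω^{1/2} ⊗ μ) = L₂(γ, ω^{1/2}|_γ)` of half-forms `f dz^{1/2}` on the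
circle `γ` with center `c` and radius `r`, with norm `‖f dz^{1/2}‖² = ∫_γ |f|² |dz|`. -/
abbrev CircleL2 (c : ℂ) (r : ℝ) : Type := Lp ℂ 2 (arcLength c r)

theorem memLp_zpow (c : ℂ) (r : ℝ) (n : ℤ) :
    MemLp (fun z : ℂ => (z - c) ^ n) 2 (arcLength c r) := by
  refine MemLp.of_bound (C := |r| ^ n) ?_ ?_
  · exact ((measurable_id.sub_const c).pow_const n).aestronglyMeasurable
  · unfold arcLength
    refine (ae_map_iff (continuous_circleMap c r).aemeasurable ?_).2 (Eventually.of_forall ?_)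
    · exact measurableSet_le ((measurable_id.sub_const c).pow_const n).norm measurable_const
    · intro θ
      simp [circleMap_sub_center, norm_circleMap_zero]

/-- The half-form `(z - c) ^ n dz^{1/2}` on a circle with center `c`. In the angle `t` it is a
constant multiple of `e^{i (n + 1/2) t} dt^{1/2}`. -/
def monomial (c : ℂ) (r : ℝ) (n : ℤ) : CircleL2 c r := (memLp_zpow c r n).toLp _

/-- `L₂⁺(γ)`: the half-forms that extend holomorphically inside the circle, i.e. the closed span of
`(z - c) ^ n dz^{1/2}`, `n ≥ 0`. -/
def hardyPlus (c : ℂ) (r : ℝ) : Submodule ℂ (CircleL2 c r) :=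
  (Submodule.span ℂ (range fun n : ℕ => monomial c r (n : ℤ))).topologicalClosure

/-- `L₂⁻(γ)`: the half-forms that extend holomorphically outside the circle (including `∞`), i.e. the
closed span of `(z - c) ^ (-n - 1) dz^{1/2}`, `n ≥ 0`. -/
def hardyMinus (c : ℂ) (r : ℝ) : Submodule ℂ (CircleL2 c r) :=
  (Submodule.span ℂ (range fun n : ℕ => monomial c r (-(n : ℤ) - 1))).topologicalClosure

/-! ### Operators -/

/-- A bounded operator is Hilbert–Schmidt if the squared norms of the images of the vectors of an
orthonormal basis are summable. -/
def IsHilbertSchmidtOperator {E F : Type*} [NormedAddCommGroup E] [InnerProductSpace ℂ E]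
    [NormedAddCommGroup F] [InnerProductSpace ℂ F] (T : E →L[ℂ] F) : Prop :=
  ∃ (w : Set E) (b : HilbertBasis w ℂ E), Summable fun i => ‖T (b i)‖ ^ 2

/-- Two subspaces are comparable if their intersection has finite codimension in both of them. -/
def Comparable {E : Type*} [AddCommGroup E] [Module ℂ E] (V W : Submodule ℂ E) : Prop :=
  FiniteDimensional ℂ (V ⧸ W.submoduleOf V) ∧ FiniteDimensional ℂ (W ⧸ V.submoduleOf W)

open scoped Classical in
/-- The matrix `m` gives a bounded operator `l₂ → l₂`. -/
def IsBoundedMatrix {I : Type*} (m : I → I → ℝ) : Prop :=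
  ∃ A : lp (fun _ : I => ℝ) 2 →L[ℝ] lp (fun _ : I => ℝ) 2,
    ∀ i j, A (lp.single 2 j (1 : ℝ)) i = m i j

end SchottkyModel

open SchottkyModel

/-! ### The curve -/

/-- The data describing a curve `M̄`: a well-separated family of disjoint disks `K i` on the sphere
`ℂ ∪ {∞}`, divided into pairs by an involution of the set of indices, and fractional-linear
identifications of the boundaries of paired disks which reverse the orientation. The coordinate is
chosen so that `∞` is in none of the enlarged disks. -/
structure SchottkyCurve (I : Type*) where
  /-- the center of the disk `K i` -/
  center : I → ℂ
  /-- the radius of the disk `K i` -/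
  radius : I → ℝ
  radius_pos : ∀ i, 0 < radius i
  /-- the disk `K̃ i` is concentric with `K i` and has radius `e ^ (2 ε)` times that of `K i` -/
  ε : ℝ
  ε_pos : 0 < ε
  disjoint : ∀ i j, i ≠ j → Disjoint (closedBall (center i) (Real.exp (2 * ε) * radius i))
    (closedBall (center j) (Real.exp (2 * ε) * radius j))
  closure_ne : closure (⋃ i, closedBall (center i) (Real.exp (2 * ε) * radius i)) ≠ univ
  /-- the conformal distances `l i j` between `K̃ i` and `K̃ j` are bounded from below, and the matrix
  `e ^ (- l i j / 2)`, with `l i i = 0`, is bounded in `l₂` -/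
  wellSeparated : ∃ l : I → I → ℝ, (∀ i, l i i = 0) ∧
    (∀ i j, i ≠ j → IsConformalDistance (closedBall (center i) (Real.exp (2 * ε) * radius i))
      (closedBall (center j) (Real.exp (2 * ε) * radius j)) (l i j)) ∧
    (∃ δ > 0, ∀ i j, i ≠ j → δ ≤ l i j) ∧
    IsBoundedMatrix fun i j => Real.exp (-(l i j) / 2)
  /-- the involution `i ↦ i'` -/
  inv : I → I
  inv_inv : ∀ i, inv (inv i) = i
  /-- one of the two subsets of indices which the involution interchanges -/
  Iplus : Set I
  mem_Iplus : ∀ i, inv i ∈ Iplus ↔ i ∉ Iplus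
  /-- the identification of `∂ K i` with `∂ K i'` (with the sign of its action on half-forms) -/
  φ : I → SL(2, ℂ)
  φ_inv : ∀ i, φ (inv i) = (φ i)⁻¹
  /-- `φ i` sends the exterior of `K i` (with its boundary) onto `K i'` -/
  φ_maps : ∀ i z, ‖num (φ i) z - center (inv i) * den (φ i) z‖ ≤ radius (inv i) * ‖den (φ i) z‖ ↔
    radius i ≤ ‖z - center i‖

namespace SchottkyCurve

variable {I : Type*} (X : SchottkyCurve I)

/-- The open annulus `R i` between the boundary of `K̃ i` and the circle that `φ i` sends to the
boundary of `K̃ i'`. -/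
def annulus (i : I) : Set ℂ :=
  {z | ‖z - X.center i‖ < Real.exp (2 * X.ε) * X.radius i ∧
    ‖num (X.φ i) z - X.center (X.inv i) * den (X.φ i) z‖ <
      Real.exp (2 * X.ε) * X.radius (X.inv i) * ‖den (X.φ i) z‖}

/-- The arc length measure of the circle `∂ K i`. -/
abbrev arc (i : I) : Measure ℂ := arcLength (X.center i) (X.radius i)

/-- `L₂(∂ K i, Ω^{1/2} ⊗ μ)` -/
abbrev L2 (i : I) : Type := CircleL2 (X.center i) (X.radius i)

/-- `L₂⁺(∂ K i, Ω^{1/2} ⊗ μ)` -/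
abbrev Plus (i : I) : Submodule ℂ (X.L2 i) := hardyPlus (X.center i) (X.radius i)

/-- `L₂⁻(∂ K i, Ω^{1/2} ⊗ μ)` -/
abbrev Minus (i : I) : Submodule ℂ (X.L2 i) := hardyMinus (X.center i) (X.radius i)

/-- The Hilbert sum `ℋ⁺` of the spaces `L₂⁺(∂ K i, Ω^{1/2} ⊗ μ)`. -/
abbrev HPlus := lp (fun i => X.Plus i) 2

/-- The Hilbert sum `ℋ⁻` of the spaces `L₂⁻(∂ K i, Ω^{1/2} ⊗ μ)`. -/
abbrev HMinus := lp (fun i => X.Minus i) 2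

open scoped Classical in
/-- `K : ℋ⁻ → ℋ⁺` is the Hilbert operator of the curve: its block from `∂ K j` to `∂ K i` has the
Cauchy kernel `(2 π i)⁻¹ dζ / (z - ζ)` if `i ≠ j`, and the diagonal blocks are zero. -/
def IsHilbertOperator (K : X.HMinus →L[ℂ] X.HPlus) : Prop :=
  ∀ (j : I) (f : X.Minus j),
    K (lp.single 2 j f) j = 0 ∧
    ∀ i, i ≠ j → ((K (lp.single 2 j f) i : X.L2 i) : ℂ → ℂ) =ᵐ[X.arc i] fun z =>
      (2 * Real.pi * Complex.I)⁻¹ *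
        ∮ ζ in C(X.center j, X.radius j), ((f : X.L2 j) : ℂ → ℂ) ζ / (z - ζ)

/-! ### Bundles given by gluing functions -/

/-- A bundle `ℒ` on the curve given by gluing functions: nowhere vanishing holomorphic functions
`ψ i` on the annuli `R i` such that `ψ i' ∘ φ i = (ψ i)⁻¹`. -/
structure Bundle where
  /-- the gluing functions; only the values of `ψ i` on `R i` matter -/
  ψ : I → ℂ → ℂ
  holomorphic : ∀ i, DifferentiableOn ℂ (ψ i) (X.annulus i)
  ne_zero : ∀ i, ∀ z ∈ X.annulus i, ψ i z ≠ 0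
  compatible : ∀ i, ∀ z ∈ X.annulus i, ψ (X.inv i) (mobius (X.φ i) z) = (ψ i z)⁻¹

namespace Bundle

variable {X}

/-- The tensor product of two bundles, given by the products of the gluing functions. -/
def tensor (L M : X.Bundle) : X.Bundle where
  ψ i z := L.ψ i z * M.ψ i z
  holomorphic i := (L.holomorphic i).mul (M.holomorphic i)
  ne_zero i z hz := mul_ne_zero (L.ne_zero i z hz) (M.ne_zero i z hz)
  compatible i z hz := by rw [L.compatible i z hz, M.compatible i z hz, mul_inv]

/-- The integer powers of a bundle, given by the powers of the gluing functions. -/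
def pow (L : X.Bundle) (n : ℤ) : X.Bundle where
  ψ i z := L.ψ i z ^ n
  holomorphic i z hz := (L.holomorphic i z hz).zpow (Or.inl (L.ne_zero i z hz))
  ne_zero i z hz := zpow_ne_zero n (L.ne_zero i z hz)
  compatible i z hz := by rw [L.compatible i z hz, inv_zpow]

/-- The dual bundle, given by the inverse gluing functions. -/
def dual (L : X.Bundle) : X.Bundle where
  ψ i z := (L.ψ i z)⁻¹
  holomorphic i := (L.holomorphic i).inv (L.ne_zero i)
  ne_zero i z hz := inv_ne_zero (L.ne_zero i z hz)
  compatible i z hz := by rw [L.compatible i z hz]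

/-- All but finitely many gluing functions are constant. -/
def IsAlmostConstant (L : X.Bundle) : Prop :=
  {i | ¬ ∃ a : ℂ, ∀ z ∈ X.annulus i, L.ψ i z = a}.Finite

/-- The index of `ψ i`, i.e. its winding number along `∂ K i`. -/
def index (L : X.Bundle) (i : I) : ℂ :=
  (2 * Real.pi * Complex.I)⁻¹ * ∮ z in C(X.center i, X.radius i), logDeriv (L.ψ i) z

/-- The bundle is of finite degree: all but finitely many indices are zero. -/
def IsFiniteDegree (L : X.Bundle) : Prop := {i | L.index i ≠ 0}.Finite

/-- The space of pairs of half-forms `f` on `∂ K i` and `g` on `∂ K i'` which satisfy the gluing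
condition `φ i ^* g = ψ i f` on `∂ K i`. -/
def gluingSpace (L : X.Bundle) (i : I) : Submodule ℂ (X.L2 i × X.L2 (X.inv i)) where
  carrier := {p | ∃ G : ℂ → ℂ, (p.2 : ℂ → ℂ) =ᵐ[X.arc (X.inv i)] G ∧
    (fun z => L.ψ i z * (p.1 : ℂ → ℂ) z) =ᵐ[X.arc i] halfFormPullback (X.φ i) G}
  zero_mem' := by
    refine ⟨0, Lp.coeFn_zero _ _ _, ?_⟩
    filter_upwards [Lp.coeFn_zero ℂ 2 (X.arc i)] with z hz
    simpa [halfFormPullback] using Or.inr hz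
  add_mem' := by
    rintro p q ⟨G, hG, hG'⟩ ⟨H, hH, hH'⟩
    refine ⟨G + H, (Lp.coeFn_add _ _).trans (hG.add hH), ?_⟩
    filter_upwards [Lp.coeFn_add p.1 q.1, hG', hH'] with z h1 h2 h3
    simp only [Prod.fst_add, h1, Pi.add_apply, mul_add, h2, h3, halfFormPullback]
  smul_mem' := by
    rintro a p ⟨G, hG, hG'⟩
    refine ⟨a • G, (Lp.coeFn_smul _ _).trans (hG.const_smul a), ?_⟩
    filter_upwards [Lp.coeFn_smul a p.1, hG'] with z h1 h2
    simp only [Prod.smul_fst, h1, Pi.smul_apply, smul_eq_mul, halfFormPullback] at h2 ⊢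
    rw [mul_left_comm, h2, mul_left_comm]

end Bundle

/-- The graph of an operator
`P : L₂⁺(∂ K i) ⊕ L₂⁺(∂ K i') → L₂⁻(∂ K i) ⊕ L₂⁻(∂ K i')`, as a subspace of
`L₂(∂ K i) ⊕ L₂(∂ K i')`: the pairs `(f₊ + f₋, g₊ + g₋)` with `P (f₊, g₊) = (f₋, g₋)`. -/
def blockGraph (i : I)
    (P : (X.Plus i × X.Plus (X.inv i)) →L[ℂ] (X.Minus i × X.Minus (X.inv i))) :
    Submodule ℂ (X.L2 i × X.L2 (X.inv i)) :=
  LinearMap.range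
    ((X.Plus i).subtype.prodMap (X.Plus (X.inv i)).subtype +
      (X.Minus i).subtype.prodMap (X.Minus (X.inv i)).subtype ∘ₗ P.toLinearMap)

namespace Bundle

variable {X}

/-- `P` is the block `Π_{φ i, ψ i}` of the gluing operator: if `ψ i` has index zero, it is the
operator whose graph is the space of pairs of half-forms satisfying the gluing condition; otherwise
it is any bounded operator whose graph is comparable with that space. -/
def IsGluingBlock (L : X.Bundle) (i : I)
    (P : (X.Plus i × X.Plus (X.inv i)) →L[ℂ] (X.Minus i × X.Minus (X.inv i))) : Prop :=
  (L.index i = 0 → X.blockGraph i P = L.gluingSpace i) ∧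
    (L.index i ≠ 0 → Comparable (X.blockGraph i P) (L.gluingSpace i))

/-- The composition `Π ∘ K : ℋ⁻ → ℋ⁻` is a Hilbert–Schmidt operator, where `Π` is the direct sum over
`i ∈ Iplus` of gluing blocks (a closed operator `ℋ⁺ → ℋ⁻` which may be unbounded). That is, `K` takes
values in the domain of `Π`, and `Π ∘ K` is a Hilbert–Schmidt operator `T`. -/
def GluingCompIsHilbertSchmidt (L : X.Bundle) (K : X.HMinus →L[ℂ] X.HPlus) : Prop :=
  ∃ P : ∀ i, (X.Plus i × X.Plus (X.inv i)) →L[ℂ] (X.Minus i × X.Minus (X.inv i)),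
    (∀ i ∈ X.Iplus, L.IsGluingBlock i (P i)) ∧
    ∃ T : X.HMinus →L[ℂ] X.HMinus, IsHilbertSchmidtOperator T ∧
      ∀ (x : X.HMinus), ∀ i ∈ X.Iplus, P i (K x i, K x (X.inv i)) = (T x i, T x (X.inv i))

/-- The curve with the bundle `ℒ` (of finite degree) is Hilbert–Schmidt: both `Π_{ψ} K` and
`Π_{ψ⁻¹} K` are Hilbert–Schmidt operators, where `K` is the Hilbert operator of the curve. -/
def IsHilbertSchmidt (L : X.Bundle) : Prop :=
  L.IsFiniteDegree ∧ ∃ K : X.HMinus →L[ℂ] X.HPlus, X.IsHilbertOperator K ∧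
    L.GluingCompIsHilbertSchmidt K ∧ L.dual.GluingCompIsHilbertSchmidt K

/-- The bundle is strongly Hilbert–Schmidt: all its integer powers are Hilbert–Schmidt. -/
def IsStronglyHilbertSchmidt (L : X.Bundle) : Prop := ∀ n : ℤ, (L.pow n).IsHilbertSchmidt

end Bundle

end SchottkyCurve

end

/-! Fix a pair of circles ∂K_i, ∂K_i' with centre c and radius r of the first, put s = (z − c)/r,
and write V(z) for V(r/(z − c)) and U(z) for U((z − c)/r). For z on ∂K_i and ζ on ∂K_j let X be the
Cauchy kernel 1/(z − ζ) (zero if j = i), and let Y be the pull-back by φ_i of the Cauchy kernel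
between ∂K_i' and ∂K_j (zero if j = i').

If ψ_i has index 0, it factors on the circle as U(z) V(z) with U, V holomorphic and invertible in
the unit disk of their arguments s and 1/s (`exists_factorization`). The pull-back is unitary and
exchanges L₂⁺ and L₂⁻, so the gluing problem is solved by f = b/V, φ_i^*g = U b, where b is the plus
part of V x plus the minus part of φ_i^*y/U. Applied to Cauchy kernels, these projections only
evaluate the multiplier at the pole: b has the kernel A = V(ζ) X + U(ξ)⁻¹ Y with ξ = φ_i⁻¹(ζ). By
Parseval, the squared Hilbert–Schmidt norm of Π_i K is (4π²)⁻¹ times the sum over j of the double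
integrals of |A/V(z) − X|² + |U(z) A − Y|² (`tsum_enorm_block_hilbert_basis_sq`). Finitely many rows
never matter: every row of K is Hilbert–Schmidt by well-separation
(`tsum_kernelEnergy_kernelX_ne_top`), and bounded blocks exist for every index
(`exists_isGluingBlock`).

For a constant ψ_i = a the energy is |a|⁻² E(Y) + |a|² E(X). The first claim is then the convexity
|b|² = |ba| |b/a| ≤ |ba|² + |b/a|², used for b and for 1/b.

For the second claim, the n-th power of a bundle has the energies of the sums (W V(ζ))ⁿ X + (W
U(ξ)⁻¹)ⁿ Y, minus X or Y, where W is 1/V(z) or U(z). The two terms of such a sum could cancel, and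
the main point is that they can be bounded separately. With P = (W V(ζ))ⁿ, Q = (W U(ξ)⁻¹)ⁿ and p =
|1 + (Q/P)⁵ Y/X|, the elementary inequality v ≤ v⁵p² + p^(−1/2) at v = |P|² gives |P X|² ≤ |P⁵X +
Q⁵Y|² + |X|² p^(−1/2). The factor W drops out of Q/P, so for fixed ζ the function inside p is
fractional-linear in z; it has at most a simple zero, and p^(−1/2) is integrable over the circle
with a bound that does not depend on Q/P (`exists_lintegral_one_add_mul_rpow_le`). Thus the separate
terms of the power n are controlled by the energies of the powers 5n and 0
(`exists_weightEnergy_le`). For separate terms, |xy|² ≤ |x²|² + |y²|² bounds the power n of a tensor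
product by the powers 2n of the factors (`blockEnergy_mul_le`). -/

noncomputable section

open SchottkyModel

/-! ### Fourier coefficients and the Hardy spaces of a circle. -/

namespace SchottkyModel

section Fourier

open Complex

variable {c : ℂ} {r : ℝ}

theorem aestronglyMeasurable_arcLength_of_continuousOn {f : ℂ → ℂ} (hr : 0 ≤ r)
    (hf : ContinuousOn f (sphere c r)) : AEStronglyMeasurable f (arcLength c r) := by
  have h : ∀ᵐ z ∂arcLength c r, z ∈ sphere c r := by
    unfold arcLength
    refine (ae_map_iff (continuous_circleMap c r).aemeasurable isClosed_sphere.measurableSet).2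
      (Eventually.of_forall fun θ => circleMap_mem_sphere c hr θ)
  have := hf.aestronglyMeasurable (μ := arcLength c r) isClosed_sphere.measurableSet
  rwa [Measure.restrict_eq_self_of_ae_mem h] at this

theorem ae_arcLength_of_forall_mem_sphere {p : ℂ → Prop} (hr : 0 ≤ r)
    (h : ∀ z ∈ sphere c r, p z) : ∀ᵐ z ∂arcLength c r, p z := by
  have h' : ∀ᵐ z ∂arcLength c r, z ∈ sphere c r := by
    unfold arcLength
    refine (ae_map_iff (continuous_circleMap c r).aemeasurable isClosed_sphere.measurableSet).2
      (Eventually.of_forall fun θ => circleMap_mem_sphere c hr θ)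
  exact h'.mono h

theorem memLp_arcLength_of_continuousOn {f : ℂ → ℂ} (hr : 0 ≤ r) {p : ℝ≥0∞}
    (hf : ContinuousOn f (sphere c r)) : MemLp f p (arcLength c r) := by
  obtain ⟨C, hC⟩ := (isCompact_sphere c r).exists_bound_of_continuousOn hf
  exact MemLp.of_bound (aestronglyMeasurable_arcLength_of_continuousOn hr hf) C
    (ae_arcLength_of_forall_mem_sphere hr hC)

theorem lintegral_arcLength {f : ℂ → ℝ≥0∞} (hf : AEMeasurable f (arcLength c r)) :
    ∫⁻ z, f z ∂arcLength c r =
      ENNReal.ofReal r * ∫⁻ θ in Ioc 0 (2 * Real.pi), f (circleMap c r θ) := by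
  rw [arcLength, lintegral_map' hf (continuous_circleMap c r).aemeasurable, lintegral_smul_measure,
    smul_eq_mul]

theorem integral_arcLength {f : ℂ → ℂ} (hr : 0 ≤ r) (hf : AEStronglyMeasurable f (arcLength c r)) :
    ∫ z, f z ∂arcLength c r = r * ∫ θ in 0..2 * Real.pi, f (circleMap c r θ) := by
  rw [arcLength, integral_map (continuous_circleMap c r).aemeasurable hf, integral_smul_measure,
    intervalIntegral.integral_of_le (by positivity), ENNReal.toReal_ofReal hr]
  simp

theorem ae_ofReal_smul_iff (hr : 0 < r) {μ : Measure ℝ} {p : ℝ → Prop} :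
    (∀ᵐ x ∂ENNReal.ofReal r • μ, p x) ↔ ∀ᵐ x ∂μ, p x := by
  simp only [ae_iff, Measure.smul_apply, smul_eq_mul, mul_eq_zero, ENNReal.ofReal_eq_zero,
    not_le.2 hr, false_or]

theorem ae_circleMap_of_ae_arcLength (hr : 0 < r) {p : ℂ → Prop} (h : ∀ᵐ z ∂arcLength c r, p z) :
    ∀ᵐ θ ∂volume.restrict (Ioc 0 (2 * Real.pi)), p (circleMap c r θ) := by
  rw [arcLength] at h
  have := ae_of_ae_map (continuous_circleMap c r).aemeasurable h
  rwa [ae_ofReal_smul_iff hr] at this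

theorem memLp_comp_circleMap (hr : 0 < r) {f : ℂ → ℂ} (hf : MemLp f 2 (arcLength c r)) :
    MemLp (fun θ => f (circleMap c r θ)) 2 (volume.restrict (Ioc 0 (2 * Real.pi))) := by
  have h := (memLp_map_measure_iff (by exact hf.1) (continuous_circleMap c r).aemeasurable).1 hf
  have h2 := h.smul_measure (c := (ENNReal.ofReal r)⁻¹) (by simpa using hr)
  rwa [smul_smul, ENNReal.inv_mul_cancel (by simpa using hr) ENNReal.ofReal_ne_top, one_smul] at h2

/-- The Fourier coefficients (without normalization) in the angle of a function on a circle. -/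
def circleCoeff (c : ℂ) (r : ℝ) (f : ℂ → ℂ) (n : ℤ) : ℂ :=
  ∫ θ in 0..2 * Real.pi, exp (-(n * θ * I)) * f (circleMap c r θ)

theorem fourierCoeffOn_eq_circleCoeff (f : ℂ → ℂ) (n : ℤ) :
    fourierCoeffOn Real.two_pi_pos (fun θ => f (circleMap c r θ)) n =
      (2 * Real.pi : ℂ)⁻¹ * circleCoeff c r f n := by
  rw [fourierCoeffOn_eq_integral, circleCoeff]
  simp only [sub_zero, one_div, fourier_coe_apply, smul_eq_mul, Complex.real_smul]
  push_cast
  congr 2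
  ext θ
  congr 2
  have : (Real.pi : ℂ) ≠ 0 := by exact_mod_cast Real.pi_ne_zero
  field_simp

theorem circleCoeff_congr_ae (hr : 0 < r) {f g : ℂ → ℂ} (h : f =ᵐ[arcLength c r] g) (n : ℤ) :
    circleCoeff c r f n = circleCoeff c r g n := by
  unfold circleCoeff
  rw [intervalIntegral.integral_of_le (by positivity),
    intervalIntegral.integral_of_le (by positivity)]
  refine integral_congr_ae ?_
  filter_upwards [ae_circleMap_of_ae_arcLength hr h] with θ hθ
  simp only [hθ]

theorem ofReal_norm_sq (z : ℂ) : ENNReal.ofReal (‖z‖ ^ 2) = ‖z‖ₑ ^ 2 := by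
  rw [ENNReal.ofReal_pow (norm_nonneg _), ofReal_norm]

/-- Parseval in extended nonnegative reals: later sums and integrals can then be exchanged and
compared without summability side conditions. -/
theorem tsum_sq_circleCoeff (hr : 0 < r) {f : ℂ → ℂ} (hf : MemLp f 2 (arcLength c r)) :
    ∑' n, ‖circleCoeff c r f n‖ₑ ^ 2 =
      ENNReal.ofReal (2 * Real.pi / r) * ∫⁻ z, ‖f z‖ₑ ^ 2 ∂arcLength c r := by
  have h := hasSum_sq_fourierCoeffOn Real.two_pi_pos (memLp_comp_circleMap hr hf)
  have hi : Integrable (fun θ => ‖f (circleMap c r θ)‖ ^ 2)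
      (volume.restrict (Ioc 0 (2 * Real.pi))) := (memLp_comp_circleMap hr hf).integrable_norm_pow
        (by norm_num)
  have h2 := congrArg ENNReal.ofReal h.tsum_eq
  rw [ENNReal.ofReal_tsum_of_nonneg (fun _ => by positivity) h.summable,
    intervalIntegral.integral_of_le (by positivity), smul_eq_mul,
    ENNReal.ofReal_mul (by simp [Real.pi_pos.le]),
    ofReal_integral_eq_lintegral_ofReal hi (Eventually.of_forall fun _ => by positivity)] at h2
  simp only [fourierCoeffOn_eq_circleCoeff, ofReal_norm_sq, enorm_mul, mul_pow, sub_zero,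
    ENNReal.tsum_mul_left] at h2
  rw [lintegral_arcLength (hf.1.enorm.pow_const 2)]
  have e1 : ‖(2 * Real.pi : ℂ)⁻¹‖ₑ = ENNReal.ofReal (2 * Real.pi)⁻¹ := by
    rw [← ofReal_norm]
    congr 1
    rw [norm_inv]
    simp [abs_of_pos Real.pi_pos]
  rw [e1] at h2
  have e3 : ENNReal.ofReal (2 * Real.pi) * ENNReal.ofReal (2 * Real.pi)⁻¹ = 1 := by
    rw [← ENNReal.ofReal_mul (by positivity), mul_inv_cancel₀ (by positivity), ENNReal.ofReal_one]
  calc _ = (ENNReal.ofReal (2 * Real.pi) * ENNReal.ofReal (2 * Real.pi)⁻¹) ^ 2 *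
        ∑' n, ‖circleCoeff c r f n‖ₑ ^ 2 := by rw [e3]; simp
    _ = ENNReal.ofReal (2 * Real.pi) ^ 2 * (ENNReal.ofReal (2 * Real.pi)⁻¹ ^ 2 *
        ∑' n, ‖circleCoeff c r f n‖ₑ ^ 2) := by ring
    _ = ENNReal.ofReal (2 * Real.pi) * (ENNReal.ofReal (2 * Real.pi) *
      ENNReal.ofReal (2 * Real.pi)⁻¹) * ∫⁻ θ in Ioc 0 (2 * Real.pi), ‖f (circleMap c r θ)‖ₑ ^ 2 := by
        rw [h2]; ring
    _ = _ := by
      rw [e3, mul_one, ← mul_assoc, ← ENNReal.ofReal_mul (by positivity),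
        div_mul_cancel₀ _ hr.ne']

theorem coeFn_monomial (n : ℤ) :
    (monomial c r n : ℂ → ℂ) =ᵐ[arcLength c r] fun z => (z - c) ^ n :=
  (memLp_zpow c r n).coeFn_toLp

theorem inner_monomial (hr : 0 < r) (n : ℤ) (f : CircleL2 c r) :
    inner ℂ (monomial c r n) f = r ^ (n + 1) * circleCoeff c r f n := by
  have h1 : (fun z => inner ℂ ((monomial c r n : ℂ → ℂ) z) ((f : ℂ → ℂ) z)) =ᵐ[arcLength c r]
      fun z => (starRingEnd ℂ) ((z - c) ^ n) * (f : ℂ → ℂ) z := by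
    filter_upwards [(memLp_zpow c r n).coeFn_toLp] with z hz
    simp only [monomial, hz, RCLike.inner_apply, mul_comm]
  have h0 : AEStronglyMeasurable (fun z => (starRingEnd ℂ) ((z - c) ^ n) * (f : ℂ → ℂ) z)
      (arcLength c r) := (Complex.continuous_conj.measurable.comp
      ((measurable_id.sub_const c).pow_const n)).aestronglyMeasurable.mul
      (Lp.aestronglyMeasurable f)
  rw [L2.inner_def, integral_congr_ae h1, integral_arcLength hr.le h0, circleCoeff, zpow_add₀ (by exact_mod_cast hr.ne'), zpow_one,
    mul_comm _ (r : ℂ), mul_assoc]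
  congr 1
  rw [← intervalIntegral.integral_const_mul]
  congr 1
  ext θ
  rw [circleMap_sub_center, circleMap, zero_add, mul_zpow, ← mul_assoc, map_mul, ← exp_int_mul]
  congr 2
  · rw [map_zpow₀, conj_ofReal]
  · rw [← exp_conj]
    simp [mul_assoc]

theorem norm_monomial_sq (hr : 0 < r) (n : ℤ) :
    inner ℂ (monomial c r n) (monomial c r n) = 2 * Real.pi * r ^ (2 * n + 1) := by
  rw [inner_monomial hr, circleCoeff_congr_ae hr (coeFn_monomial n)]
  have : circleCoeff c r (fun z => (z - c) ^ n) n = ∫ θ in 0..2 * Real.pi, (r : ℂ) ^ n := by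
    unfold circleCoeff
    congr 1
    ext θ
    beta_reduce
    rw [circleMap_sub_center, circleMap, zero_add, mul_zpow, mul_left_comm, ← exp_int_mul,
      ← exp_add]
    simp [mul_assoc]
  rw [this]
  have hr' : (r : ℂ) ≠ 0 := by exact_mod_cast hr.ne'
  have e : 2 * n + 1 = n + 1 + n := by ring
  simp only [intervalIntegral.integral_const, sub_zero, e, zpow_add₀ hr' (n + 1) n]
  simp
  ring

theorem circleCoeff_zpow (n k : ℤ) (h : k ≠ n) :
    circleCoeff c r (fun z => (z - c) ^ k) n = 0 := by
  have h1 : ∀ θ : ℝ, exp (-(n * θ * I)) * (circleMap c r θ - c) ^ k =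
      (r : ℂ) ^ k * exp (((k - n : ℤ) * I) * θ) := fun θ => by
    rw [circleMap_sub_center, circleMap, zero_add, mul_zpow, mul_left_comm, ← exp_int_mul,
      ← exp_add]
    congr 2
    push_cast
    ring
  have h0 : (((k - n : ℤ) : ℂ) * I) ≠ 0 := mul_ne_zero (by exact_mod_cast sub_ne_zero.2 h) I_ne_zero
  unfold circleCoeff
  simp only [h1]
  rw [intervalIntegral.integral_const_mul, integral_exp_mul_complex h0]
  have : exp (((k - n : ℤ) * I) * ((2 * Real.pi : ℝ) : ℂ)) = 1 := by
    rw [exp_eq_one_iff]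
    exact ⟨k - n, by push_cast; ring⟩
  rw [this]
  simp

theorem inner_monomial_monomial (hr : 0 < r) {n k : ℤ} (h : n ≠ k) :
    inner ℂ (monomial c r n) (monomial c r k) = 0 := by
  rw [inner_monomial hr, circleCoeff_congr_ae hr (coeFn_monomial k),
    circleCoeff_zpow n k h.symm, mul_zero]

theorem eq_zero_of_inner_monomial (hr : 0 < r) {f : CircleL2 c r}
    (h : ∀ n, inner ℂ (monomial c r n) f = 0) : f = 0 := by
  have h0 : ∀ n, circleCoeff c r f n = 0 := fun n => by
    have := h n
    rw [inner_monomial hr] at this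
    exact (mul_eq_zero.1 this).resolve_left (zpow_ne_zero _ (by exact_mod_cast hr.ne'))
  have h1 := tsum_sq_circleCoeff hr (Lp.memLp f)
  simp only [h0, enorm_zero, ne_eq, OfNat.ofNat_ne_zero, not_false_eq_true, zero_pow, tsum_zero]
    at h1
  have h2 : ∫⁻ z, ‖(f : ℂ → ℂ) z‖ₑ ^ 2 ∂arcLength c r = 0 :=
    (mul_eq_zero.1 h1.symm).resolve_left (by simp; positivity)
  rw [lintegral_eq_zero_iff' ((Lp.aestronglyMeasurable f).enorm.pow_const 2)] at h2
  rw [Lp.eq_zero_iff_ae_eq_zero]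
  filter_upwards [h2] with z hz
  simpa using hz

instance (c : ℂ) (r : ℝ) : CompleteSpace (hardyPlus c r) :=
  (Submodule.isClosed_topologicalClosure _).completeSpace_coe

instance (c : ℂ) (r : ℝ) : CompleteSpace (hardyMinus c r) :=
  (Submodule.isClosed_topologicalClosure _).completeSpace_coe

theorem monomial_mem_hardyPlus (n : ℕ) : monomial c r n ∈ hardyPlus c r :=
  Submodule.le_topologicalClosure _ (Submodule.subset_span ⟨n, rfl⟩)

theorem monomial_mem_hardyMinus (n : ℕ) : monomial c r (-(n : ℤ) - 1) ∈ hardyMinus c r :=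
  Submodule.le_topologicalClosure _ (Submodule.subset_span ⟨n, rfl⟩)

theorem hardyPlus_le {W : Submodule ℂ (CircleL2 c r)} (hW : IsClosed (W : Set (CircleL2 c r)))
    (h : ∀ n : ℕ, monomial c r n ∈ W) : hardyPlus c r ≤ W :=
  Submodule.topologicalClosure_minimal _ (Submodule.span_le.2 (by rintro _ ⟨n, rfl⟩; exact h n)) hW

theorem hardyMinus_le {W : Submodule ℂ (CircleL2 c r)} (hW : IsClosed (W : Set (CircleL2 c r)))
    (h : ∀ n : ℕ, monomial c r (-(n : ℤ) - 1) ∈ W) : hardyMinus c r ≤ W :=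
  Submodule.topologicalClosure_minimal _ (Submodule.span_le.2 (by rintro _ ⟨n, rfl⟩; exact h n)) hW

theorem inner_eq_zero_of_mem_hardyPlus (hr : 0 < r) {f : CircleL2 c r} (hf : f ∈ hardyPlus c r)
    (n : ℕ) : inner ℂ (monomial c r (-(n : ℤ) - 1)) f = 0 := by
  have : hardyPlus c r ≤ (ℂ ∙ monomial c r (-(n : ℤ) - 1))ᗮ := by
    refine hardyPlus_le (Submodule.isClosed_orthogonal _) fun k => ?_
    rw [Submodule.mem_orthogonal_singleton_iff_inner_right]
    exact inner_monomial_monomial hr (by lia)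
  exact Submodule.mem_orthogonal_singleton_iff_inner_right.1 (this hf)

theorem inner_eq_zero_of_mem_hardyMinus (hr : 0 < r) {f : CircleL2 c r} (hf : f ∈ hardyMinus c r)
    (n : ℕ) : inner ℂ (monomial c r n) f = 0 := by
  have : hardyMinus c r ≤ (ℂ ∙ monomial c r n)ᗮ := by
    refine hardyMinus_le (Submodule.isClosed_orthogonal _) fun k => ?_
    rw [Submodule.mem_orthogonal_singleton_iff_inner_right]
    exact inner_monomial_monomial hr (by lia)
  exact Submodule.mem_orthogonal_singleton_iff_inner_right.1 (this hf)

/-- The monomials are orthogonal and complete. If f is orthogonal to L₂⁺, then f minus its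
projection to L₂⁻ is orthogonal to every monomial, hence zero. -/
theorem hardyMinus_eq_orthogonal (hr : 0 < r) : hardyMinus c r = (hardyPlus c r)ᗮ := by
  apply le_antisymm
  · intro f hf
    have : hardyPlus c r ≤ (ℂ ∙ f)ᗮ := by
      refine hardyPlus_le (Submodule.isClosed_orthogonal _) fun k => ?_
      rw [Submodule.mem_orthogonal_singleton_iff_inner_left]
      exact inner_eq_zero_of_mem_hardyMinus hr hf k
    rw [Submodule.mem_orthogonal]
    exact fun g hg => Submodule.mem_orthogonal_singleton_iff_inner_left.1 (this hg)
  · intro f hf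
    have h1 : (hardyMinus c r).starProjection f ∈ hardyMinus c r :=
      Submodule.starProjection_apply_mem _ _
    have h2 : f - (hardyMinus c r).starProjection f ∈ (hardyMinus c r)ᗮ :=
      Submodule.sub_starProjection_mem_orthogonal _
    have h3 : f - (hardyMinus c r).starProjection f = 0 := by
      refine eq_zero_of_inner_monomial hr fun n => ?_
      obtain ⟨k, rfl⟩ | ⟨k, rfl⟩ : (∃ k : ℕ, n = k) ∨ ∃ k : ℕ, n = -(k : ℤ) - 1 := by
        rcases le_or_gt 0 n with h | h
        · exact Or.inl ⟨n.toNat, by lia⟩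
        · exact Or.inr ⟨(-n - 1).toNat, by lia⟩
      · rw [inner_sub_right, inner_eq_zero_of_mem_hardyMinus hr h1, sub_zero]
        exact (Submodule.mem_orthogonal _ _).1 hf _ (monomial_mem_hardyPlus k)
      · exact (Submodule.mem_orthogonal _ _).1 h2 _ (monomial_mem_hardyMinus k)
    rw [sub_eq_zero.1 h3]
    exact h1

theorem hardyPlus_eq_orthogonal (hr : 0 < r) : hardyPlus c r = (hardyMinus c r)ᗮ := by
  rw [hardyMinus_eq_orthogonal hr, Submodule.orthogonal_orthogonal]

theorem mem_hardyPlus_iff (hr : 0 < r) {f : CircleL2 c r} :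
    f ∈ hardyPlus c r ↔ ∀ n : ℕ, circleCoeff c r f (-(n : ℤ) - 1) = 0 := by
  refine ⟨fun hf n => ?_, fun h => ?_⟩
  · have := inner_eq_zero_of_mem_hardyPlus hr hf n
    rw [inner_monomial hr] at this
    exact (mul_eq_zero.1 this).resolve_left (zpow_ne_zero _ (by exact_mod_cast hr.ne'))
  · rw [hardyPlus_eq_orthogonal hr, Submodule.mem_orthogonal]
    have : hardyMinus c r ≤ (ℂ ∙ f)ᗮ := by
      refine hardyMinus_le (Submodule.isClosed_orthogonal _) fun k => ?_
      rw [Submodule.mem_orthogonal_singleton_iff_inner_left, inner_monomial hr, h, mul_zero]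
    exact fun g hg => Submodule.mem_orthogonal_singleton_iff_inner_left.1 (this hg)

theorem mem_hardyMinus_iff (hr : 0 < r) {f : CircleL2 c r} :
    f ∈ hardyMinus c r ↔ ∀ n : ℕ, circleCoeff c r f n = 0 := by
  refine ⟨fun hf n => ?_, fun h => ?_⟩
  · have := inner_eq_zero_of_mem_hardyMinus hr hf n
    rw [inner_monomial hr] at this
    exact (mul_eq_zero.1 this).resolve_left (zpow_ne_zero _ (by exact_mod_cast hr.ne'))
  · rw [hardyMinus_eq_orthogonal hr, Submodule.mem_orthogonal]
    have : hardyPlus c r ≤ (ℂ ∙ f)ᗮ := by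
      refine hardyPlus_le (Submodule.isClosed_orthogonal _) fun k => ?_
      rw [Submodule.mem_orthogonal_singleton_iff_inner_left, inner_monomial hr, h, mul_zero]
    exact fun g hg => Submodule.mem_orthogonal_singleton_iff_inner_left.1 (this hg)

end Fourier

end SchottkyModel

/-! ### Boundary values of holomorphic functions and multiplication operators. -/

namespace SchottkyModel

section Analytic

open Complex

variable {c : ℂ} {r : ℝ}

/-- Cauchy's theorem for wⁿ G(w) on the unit circle; dw contributes one more factor e^{iθ}, whence n
+ 1. -/
theorem integral_exp_mul_eq_zero_of_diffContOnCl {G : ℂ → ℂ} (hG : DiffContOnCl ℂ G (ball 0 1))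
    (n : ℕ) : ∫ θ in 0..2 * Real.pi, exp ((n + 1 : ℕ) * θ * I) * G (exp (θ * I)) = 0 := by
  have h := (((differentiable_id.pow n).diffContOnCl (s := ball (0 : ℂ) 1)).smul
    hG).circleIntegral_eq_zero zero_le_one
  rw [circleIntegral] at h
  have h2 : ∀ θ : ℝ, deriv (circleMap 0 1) θ • ((circleMap 0 1 θ) ^ n • G (circleMap 0 1 θ)) =
      I * (exp ((n + 1 : ℕ) * θ * I) * G (exp (θ * I))) := fun θ => by
    rw [deriv_circleMap]
    simp only [circleMap, ofReal_one, one_mul, zero_add, smul_eq_mul]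
    rw [mul_assoc ((n + 1 : ℕ) : ℂ), exp_nat_mul]
    ring
  have h3 : (∫ θ in 0..2 * Real.pi, I * (exp ((n + 1 : ℕ) * θ * I) * G (exp (θ * I)))) = 0 := by
    rw [← h]
    congr 1
    ext θ
    rw [← h2]
    rfl
  rw [intervalIntegral.integral_const_mul] at h3
  exact (mul_eq_zero.1 h3).resolve_left I_ne_zero

theorem circleMap_sub_div (hr : 0 < r) (θ : ℝ) : (circleMap c r θ - c) / r = exp (θ * I) := by
  have : (r : ℂ) ≠ 0 := by exact_mod_cast hr.ne'
  rw [circleMap_sub_center, circleMap, zero_add, mul_div_cancel_left₀ _ this]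

theorem div_circleMap_sub (hr : 0 < r) (θ : ℝ) : r / (circleMap c r θ - c) = exp (-θ * I) := by
  rw [← inv_div, circleMap_sub_div hr, ← exp_neg, neg_mul]

/-- A function on a circle has vanishing negative Fourier coefficients if it is the boundary value
of a function holomorphic inside. -/
theorem circleCoeff_eq_zero_of_inside (hr : 0 < r) {G : ℂ → ℂ} (hG : DiffContOnCl ℂ G (ball 0 1))
    (n : ℕ) : circleCoeff c r (fun z => G ((z - c) / r)) (-(n : ℤ) - 1) = 0 := by
  rw [← integral_exp_mul_eq_zero_of_diffContOnCl hG n, circleCoeff]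
  congr 1
  ext θ
  rw [circleMap_sub_div hr]
  congr 2
  push_cast
  ring

/-- A function on a circle has vanishing nonnegative Fourier coefficients if it is the boundary value
of a function holomorphic outside and vanishing at infinity. -/
theorem circleCoeff_eq_zero_of_outside (hr : 0 < r) {G : ℂ → ℂ} (hG : DiffContOnCl ℂ G (ball 0 1))
    (n : ℕ) : circleCoeff c r (fun z => r / (z - c) * G (r / (z - c))) n = 0 := by
  have h1 := integral_exp_mul_eq_zero_of_diffContOnCl hG n
  set F : ℝ → ℂ := fun θ => exp ((n + 1 : ℕ) * θ * I) * G (exp (θ * I)) with hF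
  -- The substitution θ ↦ −θ moves the interval to [−2π, 0]; periodicity moves it back.
  have hper : Function.Periodic F (2 * Real.pi) := by
    intro θ
    have e1 : exp (((θ + 2 * Real.pi : ℝ) : ℂ) * I) = exp (θ * I) := by
      rw [ofReal_add, add_mul, exp_add]
      simp [exp_two_pi_mul_I]
    have e2 : ∀ t : ℝ, exp ((n + 1 : ℕ) * t * I) = exp (t * I) ^ (n + 1) := fun t => by
      rw [mul_assoc, exp_nat_mul]
    simp only [hF, e2, e1]
  have h2 : circleCoeff c r (fun z => r / (z - c) * G (r / (z - c))) n =
      ∫ θ in 0..2 * Real.pi, F (-θ) := by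
    unfold circleCoeff
    congr 1
    ext θ
    beta_reduce
    rw [div_circleMap_sub hr, ← mul_assoc, ← exp_add]
    simp only [hF]
    congr 2
    · push_cast; ring
    · simp
  have h3 := hper.intervalIntegral_add_eq (-(2 * Real.pi)) 0
  rw [h2, intervalIntegral.integral_comp_neg]
  simp only [neg_zero, neg_add_cancel, zero_add] at h3 ⊢
  rw [h3, h1]

theorem mem_hardyPlus_of_inside (hr : 0 < r) {f : CircleL2 c r} {G : ℂ → ℂ}
    (hG : DiffContOnCl ℂ G (ball 0 1)) (h : f =ᵐ[arcLength c r] fun z => G ((z - c) / r)) :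
    f ∈ hardyPlus c r :=
  (mem_hardyPlus_iff hr).2 fun n => by
    rw [circleCoeff_congr_ae hr h, circleCoeff_eq_zero_of_inside hr hG]

theorem mem_hardyMinus_of_outside (hr : 0 < r) {f : CircleL2 c r} {G : ℂ → ℂ}
    (hG : DiffContOnCl ℂ G (ball 0 1))
    (h : f =ᵐ[arcLength c r] fun z => r / (z - c) * G (r / (z - c))) : f ∈ hardyMinus c r :=
  (mem_hardyMinus_iff hr).2 fun n => by
    rw [circleCoeff_congr_ae hr h, circleCoeff_eq_zero_of_outside hr hG]

theorem memLp_mul_Lp {u : ℂ → ℂ} (hu : MemLp u ∞ (arcLength c r)) (f : CircleL2 c r) :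
    MemLp (fun z => u z * (f : ℂ → ℂ) z) 2 (arcLength c r) :=
  MemLp.mul (r := 2) (q := 2) (p := ∞) (Lp.memLp f) hu

open scoped Classical in
/-- Multiplication by a bounded function on a circle. -/
def mulOp (c : ℂ) (r : ℝ) (u : ℂ → ℂ) : CircleL2 c r →L[ℂ] CircleL2 c r :=
  if hu : MemLp u ∞ (arcLength c r) then
    LinearMap.mkContinuous
      { toFun := fun f => MemLp.toLp (fun z => u z * (f : ℂ → ℂ) z) (memLp_mul_Lp hu f)
        map_add' := fun f g => by
          refine Lp.ext ?_
          filter_upwards [MemLp.coeFn_toLp (memLp_mul_Lp hu (f + g)),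
            MemLp.coeFn_toLp (memLp_mul_Lp hu f), MemLp.coeFn_toLp (memLp_mul_Lp hu g),
            Lp.coeFn_add f g, Lp.coeFn_add (MemLp.toLp _ (memLp_mul_Lp hu f))
              (MemLp.toLp _ (memLp_mul_Lp hu g))] with z h1 h2 h3 h4 h5
          refine h1.trans (Eq.trans ?_ h5.symm)
          rw [h4, Pi.add_apply, Pi.add_apply, mul_add]
          exact (congrArg₂ (· + ·) h2 h3).symm
        map_smul' := fun a f => by
          refine Lp.ext ?_
          filter_upwards [MemLp.coeFn_toLp (memLp_mul_Lp hu (a • f)),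
            MemLp.coeFn_toLp (memLp_mul_Lp hu f), Lp.coeFn_smul a f,
            Lp.coeFn_smul a (MemLp.toLp _ (memLp_mul_Lp hu f))] with z h1 h2 h3 h4
          refine h1.trans (Eq.trans ?_ h4.symm)
          rw [h3, Pi.smul_apply, Pi.smul_apply, mul_smul_comm]
          exact (congrArg (a • ·) h2).symm }
      (eLpNorm u ∞ (arcLength c r)).toReal fun f => by
        simp only [LinearMap.coe_mk, AddHom.coe_mk]
        rw [Lp.norm_toLp, Lp.norm_def, ← ENNReal.toReal_mul]
        refine ENNReal.toReal_mono (ENNReal.mul_ne_top hu.2.ne (Lp.memLp f).2.ne) ?_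
        exact eLpNorm_smul_le_eLpNorm_top_mul_eLpNorm 2 (Lp.memLp f).1 u
  else 0

theorem coeFn_mulOp (hr : 0 < r) {u : ℂ → ℂ} (hu : ContinuousOn u (sphere c r))
    (f : CircleL2 c r) : (mulOp c r u f : ℂ → ℂ) =ᵐ[arcLength c r] fun z => u z * (f : ℂ → ℂ) z := by
  have h : MemLp u ∞ (arcLength c r) := memLp_arcLength_of_continuousOn hr.le hu
  rw [mulOp, dif_pos h]
  exact MemLp.coeFn_toLp (memLp_mul_Lp h f)

theorem mulOp_mulOp (hr : 0 < r) {u v w : ℂ → ℂ} (hu : ContinuousOn u (sphere c r))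
    (hv : ContinuousOn v (sphere c r)) (hw : ∀ z ∈ sphere c r, w z = u z * v z)
    (f : CircleL2 c r) : mulOp c r u (mulOp c r v f) = mulOp c r w f := by
  have hw' : ContinuousOn w (sphere c r) := (hu.mul hv).congr hw
  refine Lp.ext ?_
  filter_upwards [coeFn_mulOp hr hu (mulOp c r v f), coeFn_mulOp hr hv f, coeFn_mulOp hr hw' f,
    ae_arcLength_of_forall_mem_sphere hr.le hw] with z h1 h2 h3 h4
  rw [h1, h2, h3, h4, mul_assoc]

theorem mulOp_mulOp_cancel (hr : 0 < r) {u v : ℂ → ℂ} (hu : ContinuousOn u (sphere c r))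
    (hv : ContinuousOn v (sphere c r)) (h : ∀ z ∈ sphere c r, u z * v z = 1)
    (f : CircleL2 c r) : mulOp c r u (mulOp c r v f) = f := by
  refine Lp.ext ?_
  filter_upwards [coeFn_mulOp hr hu (mulOp c r v f), coeFn_mulOp hr hv f,
    ae_arcLength_of_forall_mem_sphere hr.le h] with z h1 h2 h4
  rw [h1, h2, ← mul_assoc, h4, one_mul]

theorem sub_div_mem_sphere (hr : 0 < r) {z : ℂ} (hz : z ∈ sphere c r) :
    (z - c) / r ∈ sphere (0 : ℂ) 1 := by
  rw [mem_sphere_iff_norm] at hz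
  rw [mem_sphere_zero_iff_norm, norm_div, hz, norm_real, Real.norm_eq_abs, abs_of_pos hr,
    div_self hr.ne']

theorem div_sub_mem_sphere (hr : 0 < r) {z : ℂ} (hz : z ∈ sphere c r) :
    r / (z - c) ∈ sphere (0 : ℂ) 1 := by
  have := sub_div_mem_sphere hr hz
  rw [mem_sphere_zero_iff_norm] at this ⊢
  rw [← inv_div, norm_inv, this, inv_one]

theorem sub_ne_zero_of_mem_sphere (hr : 0 < r) {z : ℂ} (hz : z ∈ sphere c r) : z - c ≠ 0 := by
  rw [mem_sphere_iff_norm] at hz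
  exact norm_pos_iff.1 (hz ▸ hr)

theorem continuousOn_of_diffContOnCl {G : ℂ → ℂ} (hG : DiffContOnCl ℂ G (ball 0 1)) :
    ContinuousOn G (closedBall 0 1) := by
  have := hG.continuousOn
  rwa [closure_ball _ one_ne_zero] at this

theorem continuousOn_inside (hr : 0 < r) {G : ℂ → ℂ} (hG : DiffContOnCl ℂ G (ball 0 1)) :
    ContinuousOn (fun z => G ((z - c) / r)) (sphere c r) :=
  (continuousOn_of_diffContOnCl hG).comp (by fun_prop)
    fun _ hz => sphere_subset_closedBall (sub_div_mem_sphere hr hz)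

theorem continuousOn_div_sub (hr : 0 < r) : ContinuousOn (fun z => r / (z - c)) (sphere c r) :=
  continuousOn_const.div (by fun_prop) fun _ hz => sub_ne_zero_of_mem_sphere hr hz

theorem continuousOn_outside (hr : 0 < r) {G : ℂ → ℂ} (hG : DiffContOnCl ℂ G (ball 0 1)) :
    ContinuousOn (fun z => G (r / (z - c))) (sphere c r) :=
  (continuousOn_of_diffContOnCl hG).comp (continuousOn_div_sub hr)
    fun _ hz => sphere_subset_closedBall (div_sub_mem_sphere hr hz)

theorem continuousOn_zpow_sub (hr : 0 < r) (k : ℤ) :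
    ContinuousOn (fun z : ℂ => ((z - c) / r) ^ k) (sphere c r) := by
  refine ContinuousOn.zpow₀ (by fun_prop) k fun z hz => Or.inl ?_
  exact div_ne_zero (sub_ne_zero_of_mem_sphere hr hz) (by exact_mod_cast hr.ne')

/-- The preimage of the closed space L₂⁺ under a bounded operator is closed, so monomials suffice,
and a monomial times G is again a boundary value from inside. -/
theorem mulOp_mem_hardyPlus (hr : 0 < r) {G : ℂ → ℂ} (hG : DiffContOnCl ℂ G (ball 0 1))
    {f : CircleL2 c r} (hf : f ∈ hardyPlus c r) :
    mulOp c r (fun z => G ((z - c) / r)) f ∈ hardyPlus c r := by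
  have h := hardyPlus_le (c := c) (r := r)
    (W := (hardyPlus c r).comap (mulOp c r (fun z => G ((z - c) / r))).toLinearMap)
    ((Submodule.isClosed_topologicalClosure _).preimage (ContinuousLinearMap.continuous _))
    fun n => ?_
  · exact h hf
  · rw [Submodule.mem_comap]
    have hd : DiffContOnCl ℂ (fun s : ℂ => ((r : ℂ) ^ n * s ^ n) * G s) (ball 0 1) :=
      (show Differentiable ℂ fun s : ℂ => (r : ℂ) ^ n * s ^ n by fun_prop).diffContOnCl.smul hG
    refine mem_hardyPlus_of_inside hr hd ?_
    filter_upwards [coeFn_mulOp hr (continuousOn_inside hr hG) (monomial c r n),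
      coeFn_monomial (c := c) (r := r) n] with z h1 h2
    refine h1.trans ?_
    have : (r : ℂ) ≠ 0 := by exact_mod_cast hr.ne'
    rw [h2, ← mul_pow, mul_div_cancel₀ _ this, zpow_natCast, mul_comm]

theorem mulOp_mem_hardyMinus (hr : 0 < r) {G : ℂ → ℂ} (hG : DiffContOnCl ℂ G (ball 0 1))
    {f : CircleL2 c r} (hf : f ∈ hardyMinus c r) :
    mulOp c r (fun z => G (r / (z - c))) f ∈ hardyMinus c r := by
  have h := hardyMinus_le (c := c) (r := r)
    (W := (hardyMinus c r).comap (mulOp c r (fun z => G (r / (z - c)))).toLinearMap)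
    ((Submodule.isClosed_topologicalClosure _).preimage (ContinuousLinearMap.continuous _))
    fun n => ?_
  · exact h hf
  · rw [Submodule.mem_comap]
    have hd : DiffContOnCl ℂ (fun s : ℂ => (((r : ℂ) ^ (n + 1))⁻¹ * s ^ n) * G s) (ball 0 1) :=
      (show Differentiable ℂ fun s : ℂ => ((r : ℂ) ^ (n + 1))⁻¹ * s ^ n by
        fun_prop).diffContOnCl.smul hG
    refine mem_hardyMinus_of_outside hr hd ?_
    filter_upwards [coeFn_mulOp hr (continuousOn_outside hr hG) (monomial c r (-(n : ℤ) - 1)),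
      coeFn_monomial (c := c) (r := r) (-(n : ℤ) - 1)] with z h1 h2
    refine h1.trans ?_
    have : (r : ℂ) ≠ 0 := by exact_mod_cast hr.ne'
    have e : (-(n : ℤ) - 1) = -((n + 1 : ℕ) : ℤ) := by push_cast; ring
    rw [h2, e, zpow_neg, zpow_natCast, mul_comm, ← mul_assoc]
    congr 1
    rw [pow_succ (z - c), pow_succ (r : ℂ), mul_inv, mul_inv, div_eq_mul_inv, mul_pow]
    field_simp
    rw [div_pow, one_pow, div_div, mul_comm (z - c)]

/-- The projection to `L₂⁺` along `L₂⁻`. -/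
def plusProj (c : ℂ) (r : ℝ) : CircleL2 c r →L[ℂ] CircleL2 c r := (hardyPlus c r).starProjection

theorem plusProj_mem (f : CircleL2 c r) : plusProj c r f ∈ hardyPlus c r :=
  Submodule.starProjection_apply_mem _ _

theorem sub_plusProj_mem (hr : 0 < r) (f : CircleL2 c r) : f - plusProj c r f ∈ hardyMinus c r := by
  rw [hardyMinus_eq_orthogonal hr]
  exact Submodule.sub_starProjection_mem_orthogonal _

theorem plusProj_eq_self {f : CircleL2 c r} (hf : f ∈ hardyPlus c r) : plusProj c r f = f :=
  Submodule.starProjection_eq_self_iff.2 hf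

theorem plusProj_eq_zero (hr : 0 < r) {f : CircleL2 c r} (hf : f ∈ hardyMinus c r) :
    plusProj c r f = 0 := by
  rw [hardyMinus_eq_orthogonal hr] at hf
  exact (Submodule.starProjection_apply_eq_zero_iff _).2 hf

theorem eq_zero_of_mem_hardy (hr : 0 < r) {f : CircleL2 c r} (h1 : f ∈ hardyPlus c r)
    (h2 : f ∈ hardyMinus c r) : f = 0 := by
  rw [← plusProj_eq_self h1, plusProj_eq_zero hr h2]

end Analytic

end SchottkyModel

/-! ### Gluing blocks from a parametrix of the compression to L₂⁻. -/

namespace SchottkyModel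

section Block

variable {c c' : ℂ} {r r' : ℝ}

/-- The graph of an operator `L₂⁺ ⊕ L₂⁺ → L₂⁻ ⊕ L₂⁻` for two circles. -/
def operatorGraph
    (P : (hardyPlus c r × hardyPlus c' r') →L[ℂ] (hardyMinus c r × hardyMinus c' r')) :
    Submodule ℂ (CircleL2 c r × CircleL2 c' r') :=
  LinearMap.range
    ((hardyPlus c r).subtype.prodMap (hardyPlus c' r').subtype +
      (hardyMinus c r).subtype.prodMap (hardyMinus c' r').subtype ∘ₗ P.toLinearMap)

theorem mem_operatorGraph
    {P : (hardyPlus c r × hardyPlus c' r') →L[ℂ] (hardyMinus c r × hardyMinus c' r')}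
    {p : CircleL2 c r × CircleL2 c' r'} : p ∈ operatorGraph P ↔
      ∃ (x : hardyPlus c r) (y : hardyPlus c' r'), p = ((x : CircleL2 c r) + (P (x, y)).1, (y : CircleL2 c' r') + (P (x, y)).2) := by
  constructor
  · rintro ⟨⟨x, y⟩, rfl⟩
    exact ⟨x, y, rfl⟩
  · rintro ⟨x, y, rfl⟩
    exact ⟨(x, y), rfl⟩

/-- The values of an operator are determined by its graph. -/
theorem apply_eq_of_mem_operatorGraph (hr : 0 < r) (hr' : 0 < r')
    {P : (hardyPlus c r × hardyPlus c' r') →L[ℂ] (hardyMinus c r × hardyMinus c' r')}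
    {f : CircleL2 c r} {g : CircleL2 c' r'} (h : (f, g) ∈ operatorGraph P)
    {x : hardyPlus c r} {y : hardyPlus c' r'} (hx : f - x ∈ hardyMinus c r)
    (hy : g - y ∈ hardyMinus c' r') :
    ((P (x, y)).1 : CircleL2 c r) = f - x ∧ ((P (x, y)).2 : CircleL2 c' r') = g - y := by
  obtain ⟨x', y', h⟩ := mem_operatorGraph.1 h
  obtain ⟨rfl, rfl⟩ := Prod.mk.inj h
  have e1 : x' = x := by
    refine Subtype.ext (sub_eq_zero.1 (eq_zero_of_mem_hardy hr (sub_mem x'.2 x.2) ?_))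
    have := sub_mem hx (P (x', y')).1.2
    rwa [add_sub_right_comm, add_sub_cancel_right] at this
  have e2 : y' = y := by
    refine Subtype.ext (sub_eq_zero.1 (eq_zero_of_mem_hardy hr' (sub_mem y'.2 y.2) ?_))
    have := sub_mem hy (P (x', y')).2.2
    rwa [add_sub_right_comm, add_sub_cancel_right] at this
  subst e1 e2
  simp

/-- V/(V ∩ W) is a quotient of V/ker R, which is isomorphic to the range of R. Comparability is
proved by exhibiting a finite-rank defect R that vanishes only on vectors of the other space. -/
theorem finiteDimensional_quotient_submoduleOf {E F : Type*} [AddCommGroup E] [Module ℂ E]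
    [AddCommGroup F] [Module ℂ F] {V W : Submodule ℂ E} (R : V →ₗ[ℂ] F)
    [FiniteDimensional ℂ (LinearMap.range R)] (h : ∀ v : V, R v = 0 → (v : E) ∈ W) :
    FiniteDimensional ℂ (V ⧸ W.submoduleOf V) := by
  have h1 : FiniteDimensional ℂ (V ⧸ LinearMap.ker R) :=
    LinearEquiv.finiteDimensional R.quotKerEquivRange.symm
  have h2 : LinearMap.ker R ≤ W.submoduleOf V := fun v hv => h v hv
  exact Module.Finite.of_surjective (Submodule.factor h2) (Submodule.factor_surjective h2)

/-- The conditions on a unitary operator `S` between the spaces of half-forms on two circles which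
hold for the pull-back by a map of the exterior of a circle onto the interior of another. -/
structure SwapsHardy (S : CircleL2 c' r' ≃ₗᵢ[ℂ] CircleL2 c r) : Prop where
  plus : ∀ f ∈ hardyPlus c' r', S f ∈ hardyMinus c r
  minus : ∀ f ∈ hardyMinus c' r', S f ∈ hardyPlus c r
  symm_plus : ∀ f ∈ hardyPlus c r, S.symm f ∈ hardyMinus c' r'

/-- The pairs `(f, g)` with `S g = M f`. -/
def intertwiner (S : CircleL2 c' r' ≃ₗᵢ[ℂ] CircleL2 c r) (M : CircleL2 c r →L[ℂ] CircleL2 c r) :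
    Submodule ℂ (CircleL2 c r × CircleL2 c' r') where
  carrier := {p | S p.2 = M p.1}
  zero_mem' := by simp
  add_mem' := by
    intro p q hp hq
    simp only [mem_ofPred_eq, Prod.snd_add, map_add, Prod.fst_add] at *
    rw [hp, hq]
  smul_mem' := by
    intro a p hp
    simp only [mem_ofPred_eq, Prod.smul_snd, map_smul, Prod.smul_fst] at *
    rw [hp]

theorem mem_intertwiner {S : CircleL2 c' r' ≃ₗᵢ[ℂ] CircleL2 c r}
    {M : CircleL2 c r →L[ℂ] CircleL2 c r} {p : CircleL2 c r × CircleL2 c' r'} :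
    p ∈ intertwiner S M ↔ S p.2 = M p.1 := Iff.rfl

/-- If the compression of `M` to `L₂⁻` has a parametrix `Q`, then the space of pairs `(f, g)` with
`S g = M f` is comparable with the graph of a bounded operator; and it is equal to the graph of a
bounded operator if `Q` is an inverse. -/
theorem exists_operatorGraph (hr : 0 < r) (hr' : 0 < r') {S : CircleL2 c' r' ≃ₗᵢ[ℂ] CircleL2 c r}
    (hS : SwapsHardy S) (M Q : CircleL2 c r →L[ℂ] CircleL2 c r)
    (hQ : ∀ f ∈ hardyMinus c r, Q f ∈ hardyMinus c r) (W₁ W₂ : Submodule ℂ (CircleL2 c r))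
    [FiniteDimensional ℂ W₁] [FiniteDimensional ℂ W₂]
    (h₁ : ∀ f ∈ hardyMinus c r, (M (Q f) - plusProj c r (M (Q f))) - f ∈ W₁)
    (h₂ : ∀ f ∈ hardyMinus c r, Q (M f - plusProj c r (M f)) - f ∈ W₂) :
    ∃ P : (hardyPlus c r × hardyPlus c' r') →L[ℂ] (hardyMinus c r × hardyMinus c' r'),
      Comparable (operatorGraph P) (intertwiner S M) ∧
        (W₁ = ⊥ → W₂ = ⊥ → operatorGraph P = intertwiner S M) := by
  set A : CircleL2 c r →L[ℂ] CircleL2 c r := plusProj c r with hA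
  -- With f = x + q and g = y + h, where q and h are in L₂⁻, the equation S g = M f splits: its
  -- minus part says that the minus part of M q equals v = S y − (M x)₋, and its plus part
  -- determines h by S h = (M f)₊. So q is taken to be Q v.
  let v : (hardyPlus c r × hardyPlus c' r') →L[ℂ] CircleL2 c r :=
    S.toContinuousLinearEquiv.toContinuousLinearMap ∘L (hardyPlus c' r').subtypeL ∘L
      ContinuousLinearMap.snd ℂ _ _ -
    (M - A ∘L M) ∘L (hardyPlus c r).subtypeL ∘L ContinuousLinearMap.fst ℂ _ _
  have v_apply : ∀ (x : hardyPlus c r) (y : hardyPlus c' r'), v (x, y) = S y - (M x - A (M x)) := fun x y => rfl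
  have v_mem : ∀ p, v p ∈ hardyMinus c r := fun p =>
    sub_mem (hS.plus _ p.2.2) (sub_plusProj_mem hr _)
  let q : (hardyPlus c r × hardyPlus c' r') →L[ℂ] CircleL2 c r := Q ∘L v
  have q_mem : ∀ p, q p ∈ hardyMinus c r := fun p => hQ _ (v_mem p)
  let h : (hardyPlus c r × hardyPlus c' r') →L[ℂ] CircleL2 c' r' :=
    S.symm.toContinuousLinearEquiv.toContinuousLinearMap ∘L A ∘L M ∘L
      ((hardyPlus c r).subtypeL ∘L ContinuousLinearMap.fst ℂ _ _ + q)
  have h_apply : ∀ p, h p = S.symm (A (M (p.1 + q p))) := fun p => rfl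
  have h_mem : ∀ p, h p ∈ hardyMinus c' r' := fun p => hS.symm_plus _ (plusProj_mem _)
  let P : (hardyPlus c r × hardyPlus c' r') →L[ℂ] (hardyMinus c r × hardyMinus c' r') :=
    (q.codRestrict _ q_mem).prod (h.codRestrict _ h_mem)
  have P1 : ∀ p, ((P p).1 : CircleL2 c r) = q p := fun p => rfl
  have P2 : ∀ p, ((P p).2 : CircleL2 c' r') = h p := fun p => rfl
  -- an element of the graph lies in the intertwiner if `Q` is a right inverse at `v`
  have key1 : ∀ (x : hardyPlus c r) (y : hardyPlus c' r'), (M (Q (v (x, y))) - A (M (Q (v (x, y))))) - v (x, y) = 0 →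
      ((x : CircleL2 c r) + q (x, y), (y : CircleL2 c' r') + h (x, y)) ∈ intertwiner S M := by
    intro x y e
    rw [mem_intertwiner]
    change S ((y : CircleL2 c' r') + h (x, y)) = M (x + q (x, y))
    rw [map_add, h_apply, LinearIsometryEquiv.apply_symm_apply, map_add M, map_add A]
    have e' := e
    rw [v_apply] at e'
    change M (q (x, y)) - A (M (q (x, y))) - (S y - (M x - A (M x))) = 0 at e'
    have : S y = M (q (x, y)) - A (M (q (x, y))) + (M x - A (M x)) := by
      rw [sub_eq_zero] at e'
      rw [e']; abel
    rw [this]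
    change _ + (A (M x) + A (M (q (x, y)))) = _
    abel
  have key2 : ∀ f g, (f, g) ∈ intertwiner S M →
      Q (M (f - A f) - A (M (f - A f))) - (f - A f) = 0 → (f, g) ∈ operatorGraph P := by
    intro f g hfg e
    rw [mem_intertwiner] at hfg
    change S g = M f at hfg
    refine mem_operatorGraph.2 ⟨⟨A f, plusProj_mem f⟩, ⟨plusProj c' r' g, plusProj_mem g⟩, ?_⟩
    rw [P1, P2]
    -- S exchanges the Hardy spaces, so it carries the plus part of g to the minus part of S g = M
    -- f.
    have hSA : S (plusProj c' r' g) = M f - A (M f) := by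
      have e1 := sub_plusProj_mem hr' g
      have e2 := plusProj_eq_zero hr (hS.plus _ (plusProj_mem g))
      have e3 := plusProj_eq_self (hS.minus _ e1)
      rw [← hfg]
      conv_rhs => rw [hA, ← sub_add_cancel g (plusProj c' r' g), map_add S, map_add, e2, e3]
      abel
    have hv : v ((⟨A f, plusProj_mem f⟩ : hardyPlus c r), (⟨plusProj c' r' g, plusProj_mem g⟩ : hardyPlus c' r')) =
        M (f - A f) - A (M (f - A f)) := by
      rw [v_apply]
      change S (plusProj c' r' g) - (M (A f) - A (M (A f))) = _
      rw [hSA, map_sub M, map_sub A]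
      abel
    have hq : q ((⟨A f, plusProj_mem f⟩ : hardyPlus c r), (⟨plusProj c' r' g, plusProj_mem g⟩ : hardyPlus c' r')) = f - A f := by
      change Q (v _) = _
      rw [hv]
      exact sub_eq_zero.1 e
    refine Prod.ext ?_ ?_
    · change f = A f + _
      rw [hq]; abel
    · change g = plusProj c' r' g + _
      rw [h_apply, hq]
      change g = plusProj c' r' g + S.symm (A (M (A f + (f - A f))))
      rw [add_sub_cancel, ← sub_eq_iff_eq_add', LinearIsometryEquiv.eq_symm_apply, map_sub, hSA,
        hfg]
      abel
  refine ⟨P, ⟨?_, ?_⟩, fun hW₁ hW₂ => le_antisymm ?_ ?_⟩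
  · -- the graph
    let w : (operatorGraph P) →ₗ[ℂ] CircleL2 c r :=
      (S.toLinearEquiv.toLinearMap ∘ₗ (plusProj c' r').toLinearMap ∘ₗ LinearMap.snd ℂ _ _ -
        (M - A ∘L M).toLinearMap ∘ₗ A.toLinearMap ∘ₗ LinearMap.fst ℂ _ _) ∘ₗ
          (operatorGraph P).subtype
    have hw : ∀ p : operatorGraph P, ∃ (x : hardyPlus c r) (y : hardyPlus c' r'), (p : CircleL2 c r × CircleL2 c' r') =
        ((x : CircleL2 c r) + q (x, y), (y : CircleL2 c' r') + h (x, y)) ∧ w p = v (x, y) := by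
      rintro ⟨p, hp⟩
      obtain ⟨x, y, rfl⟩ := mem_operatorGraph.1 hp
      refine ⟨x, y, rfl, ?_⟩
      rw [v_apply]
      change S (plusProj c' r' (y + h (x, y))) - (M (A (x + q (x, y))) - A (M (A (x + q (x, y))))) =
        _
      rw [map_add, plusProj_eq_self y.2, plusProj_eq_zero hr' (h_mem _), map_add A, hA,
        plusProj_eq_self x.2, plusProj_eq_zero hr (q_mem _), add_zero, add_zero]
    -- The failure of Q to be a right inverse at v; its range lies in W₁.
    let R : (operatorGraph P) →ₗ[ℂ] CircleL2 c r :=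
      ((M - A ∘L M) ∘L Q - ContinuousLinearMap.id ℂ _).toLinearMap ∘ₗ w
    have hR : ∀ p, R p = (M (Q (w p)) - A (M (Q (w p)))) - w p := fun p => rfl
    have hRW : LinearMap.range R ≤ W₁ := by
      rintro _ ⟨p, rfl⟩
      obtain ⟨x, y, -, hxy⟩ := hw p
      rw [hR, hxy]
      exact h₁ _ (v_mem _)
    have : FiniteDimensional ℂ (LinearMap.range R) := Submodule.finiteDimensional_of_le hRW
    refine finiteDimensional_quotient_submoduleOf R fun p hp => ?_
    obtain ⟨x, y, hp', hxy⟩ := hw p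
    rw [hR, hxy] at hp
    rw [hp']
    exact key1 x y hp
  -- The failure of Q to be a left inverse at the minus part of f; its range lies in W₂.
  · let R : (intertwiner S M) →ₗ[ℂ] CircleL2 c r :=
      (Q ∘L (M - A ∘L M) - ContinuousLinearMap.id ℂ _).toLinearMap ∘ₗ
        (ContinuousLinearMap.id ℂ _ - A).toLinearMap ∘ₗ LinearMap.fst ℂ _ _ ∘ₗ
          (intertwiner S M).subtype
    have hR : ∀ p, R p = Q (M (p.1.1 - A p.1.1) - A (M (p.1.1 - A p.1.1))) - (p.1.1 - A p.1.1) :=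
      fun p => rfl
    have hRW : LinearMap.range R ≤ W₂ := by
      rintro _ ⟨p, rfl⟩
      rw [hR]
      exact h₂ _ (sub_plusProj_mem hr _)
    have : FiniteDimensional ℂ (LinearMap.range R) := Submodule.finiteDimensional_of_le hRW
    refine finiteDimensional_quotient_submoduleOf R fun p hp => ?_
    exact key2 _ _ p.2 (by rw [← hR]; exact hp)
  · rintro p hp
    obtain ⟨x, y, rfl⟩ := mem_operatorGraph.1 hp
    refine key1 x y ?_
    have := h₁ _ (v_mem (x, y))
    rwa [hW₁, Submodule.mem_bot] at this
  · rintro ⟨f, g⟩ hp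
    refine key2 f g hp ?_
    have := h₂ _ (sub_plusProj_mem hr f)
    rwa [hW₂, Submodule.mem_bot] at this

end Block

end SchottkyModel

/-! ### Parametrices for symbols with a Wiener–Hopf factorization. -/

namespace SchottkyModel

section Parametrix

variable {c c' : ℂ} {r r' : ℝ}

theorem mulOp_zpow_monomial (hr : 0 < r) (k n : ℤ) :
    mulOp c r (fun z => ((z - c) / r) ^ k) (monomial c r n) =
      ((r : ℂ) ^ k)⁻¹ • monomial c r (n + k) := by
  refine Lp.ext ?_
  filter_upwards [coeFn_mulOp hr (continuousOn_zpow_sub hr k) (monomial c r n),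
    coeFn_monomial (c := c) (r := r) n, coeFn_monomial (c := c) (r := r) (n + k),
    Lp.coeFn_smul ((r : ℂ) ^ k)⁻¹ (monomial c r (n + k)),
    ae_arcLength_of_forall_mem_sphere hr.le fun z hz => sub_ne_zero_of_mem_sphere hr hz]
    with z h1 h2 h3 h4 h5
  rw [h1, h2, h4, Pi.smul_apply, h3, zpow_add₀ h5, div_zpow, smul_eq_mul]
  ring

/-- The Hankel operators with symbols `s ^ k` have finite rank. -/
theorem exists_finiteDimensional_hankel (hr : 0 < r) (k : ℤ) :
    ∃ W : Submodule ℂ (CircleL2 c r), FiniteDimensional ℂ W ∧ (k ≤ 0 → W = ⊥) ∧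
      ∀ f ∈ hardyMinus c r,
        plusProj c r (mulOp c r (fun z => ((z - c) / r) ^ k) f) ∈ W := by
  -- The exponents 0, …, k − 1 are those that multiplication by s^k can bring from the negative
  -- side; `toNat` makes W zero for k ≤ 0.
  set W : Submodule ℂ (CircleL2 c r) :=
    Submodule.span ℂ (range fun m : Fin k.toNat => monomial c r (m : ℕ)) with hW
  have hfd : FiniteDimensional ℂ W := FiniteDimensional.span_of_finite ℂ (finite_range _)
  refine ⟨W, hfd, fun hk => ?_, fun f hf => ?_⟩
  · have : IsEmpty (Fin k.toNat) := by
      rw [Int.toNat_of_nonpos hk]; infer_instance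
    rw [hW, range_eq_empty, Submodule.span_empty]
  · have h := hardyMinus_le (c := c) (r := r)
      (W := W.comap ((plusProj c r) ∘L (mulOp c r fun z => ((z - c) / r) ^ k)).toLinearMap)
      (W.closed_of_finiteDimensional.preimage (ContinuousLinearMap.continuous _)) fun n => ?_
    · exact h hf
    · rw [Submodule.mem_comap]
      change plusProj c r (mulOp c r (fun z => ((z - c) / r) ^ k) (monomial c r (-(n : ℤ) - 1))) ∈ W
      rw [mulOp_zpow_monomial hr, map_smul]
      refine W.smul_mem _ ?_
      rcases le_or_gt 0 (-(n : ℤ) - 1 + k) with h0 | h0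
      · obtain ⟨m, hm⟩ := Int.eq_ofNat_of_zero_le h0
        rw [hm, plusProj_eq_self (monomial_mem_hardyPlus m)]
        exact Submodule.subset_span ⟨⟨m, by lia⟩, rfl⟩
      · obtain ⟨m, hm⟩ : ∃ m : ℕ, -(n : ℤ) - 1 + k = -(m : ℤ) - 1 :=
          ⟨(-(-(n : ℤ) - 1 + k) - 1).toNat, by lia⟩
        rw [hm, plusProj_eq_zero hr (monomial_mem_hardyMinus m)]
        exact W.zero_mem

/-- A bounded gluing block exists for the multiplication by a function on a circle which is a product
of a power of the coordinate and invertible functions holomorphic inside and outside. -/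
theorem exists_operatorGraph_mulOp (hr : 0 < r) (hr' : 0 < r')
    {S : CircleL2 c' r' ≃ₗᵢ[ℂ] CircleL2 c r} (hS : SwapsHardy S) {ψ U V : ℂ → ℂ} {k : ℤ}
    (hU : DiffContOnCl ℂ U (ball 0 1)) (hU0 : ∀ s ∈ closedBall (0 : ℂ) 1, U s ≠ 0)
    (hV : DiffContOnCl ℂ V (ball 0 1)) (hV0 : ∀ s ∈ closedBall (0 : ℂ) 1, V s ≠ 0)
    (hψ : ∀ z ∈ sphere c r, ψ z = ((z - c) / r) ^ k * U ((z - c) / r) * V (r / (z - c))) :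
    ∃ P : (hardyPlus c r × hardyPlus c' r') →L[ℂ] (hardyMinus c r × hardyMinus c' r'),
      Comparable (operatorGraph P) (intertwiner S (mulOp c r ψ)) ∧
        (k = 0 → operatorGraph P = intertwiner S (mulOp c r ψ)) := by
  have hcl : closure (ball (0 : ℂ) 1) = closedBall 0 1 := closure_ball _ one_ne_zero
  have hUi : DiffContOnCl ℂ U⁻¹ (ball 0 1) := hU.inv (by rwa [hcl])
  have hVi : DiffContOnCl ℂ V⁻¹ (ball 0 1) := hV.inv (by rwa [hcl])
  set A : CircleL2 c r →L[ℂ] CircleL2 c r := plusProj c r with hA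
  set B : CircleL2 c r →L[ℂ] CircleL2 c r := ContinuousLinearMap.id ℂ _ - A with hB
  have B_apply : ∀ f, B f = f - A f := fun f => rfl
  have B_mem : ∀ f, B f ∈ hardyMinus c r := fun f => sub_plusProj_mem hr f
  have B_self : ∀ f ∈ hardyMinus c r, B f = f := fun f hf => by
    rw [B_apply, hA, plusProj_eq_zero hr hf, sub_zero]
  have B_plus : ∀ f ∈ hardyPlus c r, B f = 0 := fun f hf => by
    rw [B_apply, hA, plusProj_eq_self hf, sub_self]
  set M := mulOp c r ψ with hM
  set Mu := mulOp c r fun z => U ((z - c) / r) with hMu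
  set Mui := mulOp c r fun z => U⁻¹ ((z - c) / r) with hMui
  set Mv := mulOp c r fun z => V (r / (z - c)) with hMv
  set Mvi := mulOp c r fun z => V⁻¹ (r / (z - c)) with hMvi
  set Z := mulOp c r fun z => ((z - c) / r) ^ k with hZ
  set Zi := mulOp c r fun z => ((z - c) / r) ^ (-k) with hZi
  have cU := continuousOn_inside (c := c) hr hU
  have cUi := continuousOn_inside (c := c) hr hUi
  have cV := continuousOn_outside (c := c) hr hV
  have cVi := continuousOn_outside (c := c) hr hVi
  have cZ := continuousOn_zpow_sub (c := c) hr k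
  have cZi := continuousOn_zpow_sub (c := c) hr (-k)
  have eU : ∀ z ∈ sphere c r, U ((z - c) / r) ≠ 0 := fun z hz =>
    hU0 _ (sphere_subset_closedBall (sub_div_mem_sphere hr hz))
  have eV : ∀ z ∈ sphere c r, V (r / (z - c)) ≠ 0 := fun z hz =>
    hV0 _ (sphere_subset_closedBall (div_sub_mem_sphere hr hz))
  have eZ : ∀ z ∈ sphere c r, (z - c) / (r : ℂ) ≠ 0 := fun z hz =>
    div_ne_zero (sub_ne_zero_of_mem_sphere hr hz) (by exact_mod_cast hr.ne')
  have uui : ∀ f, Mu (Mui f) = f := mulOp_mulOp_cancel hr cU cUi fun z hz => mul_inv_cancel₀ (eU z hz)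
  have uiu : ∀ f, Mui (Mu f) = f := mulOp_mulOp_cancel hr cUi cU fun z hz => inv_mul_cancel₀ (eU z hz)
  have vvi : ∀ f, Mv (Mvi f) = f := mulOp_mulOp_cancel hr cV cVi fun z hz => mul_inv_cancel₀ (eV z hz)
  have viv : ∀ f, Mvi (Mv f) = f := mulOp_mulOp_cancel hr cVi cV fun z hz => inv_mul_cancel₀ (eV z hz)
  have zzi : ∀ f, Z (Zi f) = f := mulOp_mulOp_cancel hr cZ cZi fun z hz => by
    rw [← zpow_add₀ (eZ z hz), add_neg_cancel, zpow_zero]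
  have ziz : ∀ f, Zi (Z f) = f := mulOp_mulOp_cancel hr cZi cZ fun z hz => by
    rw [← zpow_add₀ (eZ z hz), neg_add_cancel, zpow_zero]
  have hM' : ∀ f, M f = Mu (Z (Mv f)) := fun f => by
    have h1 : Z (Mv f) = mulOp c r (fun z => ((z - c) / r) ^ k * V (r / (z - c))) f :=
      mulOp_mulOp hr cZ cV (fun z hz => rfl) f
    rw [h1]
    exact (mulOp_mulOp hr cU (cZ.mul cV) (w := ψ) (fun z hz => by
      rw [hψ z hz, Pi.mul_apply]; ring) f).symm
  obtain ⟨Wk, hWk, hWk0, hk⟩ := exists_finiteDimensional_hankel (c := c) hr k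
  obtain ⟨Wi, hWi, hWi0, hi⟩ := exists_finiteDimensional_hankel (c := c) hr (-k)
  -- The parametrix of B M on L₂⁻, for M = U s^k V, is V⁻¹ B s^{−k} B U⁻¹. Multiplication by V
  -- preserves L₂⁻, and multiplication by U preserves L₂⁺, so U is inverted exactly after the
  -- projection B. The only defects are the finite-rank terms A s^{−k} here and A s^k below, both
  -- zero if k = 0.
  have h₁ : ∀ f ∈ hardyMinus c r, B (M (Mvi (B (Zi (B (Mui f)))))) - f ∈
      Wi.map (B ∘L Mu ∘L Z).toLinearMap := by
    intro f hf
    set a := B (Mui f) with ha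
    refine ⟨-A (Zi a), Wi.neg_mem (hi a (B_mem _)), ?_⟩
    change B (Mu (Z (-A (Zi a)))) = B (M (Mvi (B (Zi a)))) - f
    have e1 : B (Mu a) = f := by
      rw [ha, B_apply (Mui f), map_sub, uui, map_sub, B_plus _ (mulOp_mem_hardyPlus hr hU
        (plusProj_mem _)), sub_zero, B_self f hf]
    rw [hM', vvi, B_apply (Zi a), map_sub Z, zzi, map_sub Mu, map_sub B, e1, map_neg, map_neg,
      map_neg]
    abel
  have h₂ : ∀ f ∈ hardyMinus c r, Mvi (B (Zi (B (Mui (B (M f)))))) - f ∈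
      Wk.map (Mvi ∘L B ∘L Zi).toLinearMap := by
    intro f hf
    set a := Mv f with ha
    have ha' : a ∈ hardyMinus c r := mulOp_mem_hardyMinus hr hV hf
    refine ⟨-A (Z a), Wk.neg_mem (hk a ha'), ?_⟩
    change Mvi (B (Zi (-A (Z a)))) = Mvi (B (Zi (B (Mui (B (M f)))))) - f
    have e1 : ∀ b, B (Mui (B (Mu b))) = B b := fun b => by
      rw [B_apply (Mu b), map_sub, uiu, map_sub, B_plus _ (mulOp_mem_hardyPlus hr hUi
        (plusProj_mem _)), sub_zero]
    rw [hM', e1, ← ha, B_apply (Z a), map_sub Zi, ziz, map_sub B, B_self a ha', map_sub Mvi, ha, viv,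
      map_neg, map_neg, map_neg]
    abel
  obtain ⟨P, hP1, hP2⟩ := exists_operatorGraph hr hr' hS M (Mvi ∘L B ∘L Zi ∘L B ∘L Mui)
    (fun f _ => mulOp_mem_hardyMinus hr hVi (B_mem _))
    (Wi.map (B ∘L Mu ∘L Z).toLinearMap) (Wk.map (Mvi ∘L B ∘L Zi).toLinearMap) h₁ h₂
  exact ⟨P, hP1, fun h0 => hP2 (by rw [hWi0 (by lia), Submodule.map_bot])
    (by rw [hWk0 (by lia), Submodule.map_bot])⟩

end Parametrix

end SchottkyModel

/-! ### Wiener–Hopf factorization of a nonvanishing function near a circle. -/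

namespace SchottkyModel

section Factorization

open Complex

theorem diffContOnCl_tsum_mul_pow {a : ℕ → ℂ} (ha : Summable fun n => ‖a n‖) (m : ℕ) :
    DiffContOnCl ℂ (fun s => ∑' n, a n * s ^ (n + m)) (ball 0 1) := by
  have hb : ∀ n, ∀ s ∈ closedBall (0 : ℂ) 1, ‖a n * s ^ (n + m)‖ ≤ ‖a n‖ := fun n s hs => by
    rw [norm_mul, norm_pow]
    exact mul_le_of_le_one_right (norm_nonneg _)
      (pow_le_one₀ (norm_nonneg _) (mem_closedBall_zero_iff.1 hs))
  constructor
  · exact differentiableOn_tsum_of_summable_norm ha (fun n => by fun_prop) isOpen_ball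
      fun n s hs => hb n s (ball_subset_closedBall hs)
  · rw [closure_ball _ one_ne_zero]
    exact continuousOn_tsum (fun n => by fun_prop) ha hb

/-- The Fourier coefficients of a continuously differentiable periodic function are summable. -/
theorem summable_fourierCoeffOn {T : ℝ} (hT : (0 : ℝ) < T) {f f' : ℝ → ℂ}
    (hf : ∀ x, HasDerivAt f (f' x) x) (hf' : Continuous f') (h0 : f T = f 0) :
    Summable fun n : ℤ => ‖fourierCoeffOn hT f n‖ := by
  obtain ⟨C, hC⟩ := (isCompact_Icc (a := (0 : ℝ)) (b := T)).exists_bound_of_continuousOn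
    hf'.continuousOn
  have hL2 : MemLp f' 2 (volume.restrict (Ioc 0 T)) := by
    refine MemLp.of_bound hf'.aestronglyMeasurable C ?_
    filter_upwards [ae_restrict_mem measurableSet_Ioc] with x hx
    exact hC x (Ioc_subset_Icc_self hx)
  -- For n ≠ 0 the coefficient of f is, up to a constant, that of f' divided by n: a product of two
  -- square-summable sequences.
  have h1 : Summable fun n : ℤ => ‖fourierCoeffOn hT f' n‖ ^ 2 :=
    (hasSum_sq_fourierCoeffOn hT hL2).summable
  have h2 : Summable fun n : ℤ => 1 / ((n : ℝ)) ^ 2 := Real.summable_one_div_int_pow.2 (by norm_num)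
  refine Summable.of_norm_bounded_eventually (((h1.add h2).mul_left T)) ?_
  have hfin : {n : ℤ | ¬ n ≠ 0}.Finite := by simp
  refine (eventually_cofinite.2 hfin).mono fun n hn => ?_
  rw [fourierCoeffOn_of_hasDerivAt hT hn (fun x _ => hf x) (hf'.intervalIntegrable _ _), h0, sub_self,
    mul_zero, zero_sub]
  have hn' : (0 : ℝ) < |(n : ℝ)| := abs_pos.2 (by exact_mod_cast hn)
  have e : ‖(1 / (-2 * Real.pi * I * n) * -((T - (0 : ℝ)) * fourierCoeffOn hT f' n) : ℂ)‖ =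
      (2 * Real.pi)⁻¹ * |(n : ℝ)|⁻¹ * (T * ‖fourierCoeffOn hT f' n‖) := by
    rw [norm_mul, norm_div, norm_neg]
    simp only [norm_mul, norm_neg, norm_one, norm_ofNat, norm_real, norm_I, norm_intCast,
      Real.norm_eq_abs, abs_of_pos Real.pi_pos, ofReal_zero, sub_zero, abs_of_pos hT]
    rw [mul_one, one_div, mul_inv]
  rw [norm_norm, e]
  have hpi : (2 * Real.pi)⁻¹ ≤ 1 := inv_le_one_of_one_le₀ (by linarith [Real.pi_gt_three])
  have h3 : |(n : ℝ)|⁻¹ * ‖fourierCoeffOn hT f' n‖ ≤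
      ‖fourierCoeffOn hT f' n‖ ^ 2 + 1 / (n : ℝ) ^ 2 := by
    have : 1 / (n : ℝ) ^ 2 = (|(n : ℝ)|⁻¹) ^ 2 := by rw [inv_pow, sq_abs, one_div]
    rw [this]
    nlinarith [sq_nonneg (|(n : ℝ)|⁻¹ - ‖fourierCoeffOn hT f' n‖), sq_nonneg (|(n : ℝ)|⁻¹),
      sq_nonneg ‖fourierCoeffOn hT f' n‖]
  calc (2 * Real.pi)⁻¹ * |(n : ℝ)|⁻¹ * (T * ‖fourierCoeffOn hT f' n‖)
      = (2 * Real.pi)⁻¹ * (T * (|(n : ℝ)|⁻¹ * ‖fourierCoeffOn hT f' n‖)) := by ring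
    _ ≤ 1 * (T * (|(n : ℝ)|⁻¹ * ‖fourierCoeffOn hT f' n‖)) := by gcongr
    _ ≤ _ := by rw [one_mul]; gcongr

/-- A continuously differentiable periodic function is the sum of boundary values of functions
holomorphic inside and outside the unit circle. -/
theorem exists_add_of_periodic {f f' : ℝ → ℂ} (hf : ∀ x, HasDerivAt f (f' x) x)
    (hf' : Continuous f') (h0 : f (2 * Real.pi) = f 0) :
    ∃ u v : ℂ → ℂ, DiffContOnCl ℂ u (ball 0 1) ∧ DiffContOnCl ℂ v (ball 0 1) ∧
      ∀ θ ∈ Ioc 0 (2 * Real.pi), f θ = u (exp (θ * I)) + v (exp (-θ * I)) := by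
  have : Fact (0 < 2 * Real.pi) := ⟨Real.two_pi_pos⟩
  have hc : Continuous f := continuous_iff_continuousAt.2 fun x => (hf x).continuousAt
  let F : C(AddCircle (2 * Real.pi), ℂ) :=
    ⟨AddCircle.liftIoc (2 * Real.pi) 0 f,
      AddCircle.liftIoc_continuous (by rw [zero_add, h0]) hc.continuousOn⟩
  have hT : (0 : ℝ) < 0 + 2 * Real.pi := lt_add_of_pos_right 0 Real.two_pi_pos
  have hco : ∀ n, fourierCoeff F n = fourierCoeffOn hT f n := fun n => fourierCoeff_liftIoc_eq f n
  have hs : Summable fun n : ℤ => ‖fourierCoeff F n‖ := by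
    simp only [hco]
    exact summable_fourierCoeffOn hT hf hf' (by rw [zero_add, h0])
  set a : ℤ → ℂ := fun n => fourierCoeff F n with ha
  have hs1 : Summable fun n : ℕ => ‖a n‖ := hs.comp_injective Nat.cast_injective
  have hs2 : Summable fun n : ℕ => ‖a (-(n + 1))‖ :=
    hs.comp_injective (i := fun n : ℕ => (-(n + 1) : ℤ)) fun n m h => by simpa using h
  -- The frequencies n ≥ 0 go to u and the frequencies −(n + 1) to v; hence the shift by 1 in the
  -- second power series.
  refine ⟨_, _, diffContOnCl_tsum_mul_pow hs1 0, diffContOnCl_tsum_mul_pow hs2 1, fun θ hθ => ?_⟩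
  have h1 := has_pointwise_sum_fourier_series_of_summable hs.of_norm (θ : AddCircle (2 * Real.pi))
  have h2 : F (θ : AddCircle (2 * Real.pi)) = f θ :=
    AddCircle.liftIoc_coe_apply (by rwa [zero_add])
  have h3 : ∀ n : ℤ, fourier n (θ : AddCircle (2 * Real.pi)) = exp (θ * I) ^ n := fun n => by
    rw [fourier_coe_apply, ← exp_int_mul]
    congr 1
    have : (Real.pi : ℂ) ≠ 0 := by exact_mod_cast Real.pi_ne_zero
    push_cast
    field_simp
  have h4 : ∀ n : ℕ, exp (θ * I) ^ (-(n + 1) : ℤ) = exp (-θ * I) ^ (n + 1) := fun n => by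
    rw [neg_mul, exp_neg, inv_pow, zpow_neg]
    norm_cast
  have hne : ‖exp (θ * I)‖ = 1 := norm_exp_ofReal_mul_I θ
  rw [← h2, ← h1.tsum_eq, tsum_of_nat_of_neg_add_one]
  · congr 1
    · refine tsum_congr fun n => ?_
      rw [h3, smul_eq_mul, zpow_natCast, add_zero]
    · refine tsum_congr fun n => ?_
      rw [h3, smul_eq_mul, h4]
  · refine Summable.of_norm ?_
    simpa [h3, norm_smul, norm_zpow, hne] using hs1
  · refine Summable.of_norm ?_
    simpa only [h3, norm_smul, norm_zpow, hne, one_zpow, mul_one] using hs2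

variable {c : ℂ} {r : ℝ}

/-- A nonvanishing holomorphic function near a circle is, on the circle, the product of a power of
the coordinate and of invertible functions holomorphic inside and outside. The exponent is the
winding number. -/
theorem exists_factorization (hr : 0 < r) {ψ : ℂ → ℂ} {O : Set ℂ} (hO : IsOpen O)
    (hsub : sphere c r ⊆ O) (hd : DifferentiableOn ℂ ψ O) (h0 : ∀ z ∈ O, ψ z ≠ 0) :
    ∃ k : ℤ, (2 * Real.pi * I)⁻¹ * (∮ z in C(c, r), logDeriv ψ z) = k ∧
      ∃ U V : ℂ → ℂ, DiffContOnCl ℂ U (ball 0 1) ∧ DiffContOnCl ℂ V (ball 0 1) ∧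
        (∀ s, U s ≠ 0) ∧ (∀ s, V s ≠ 0) ∧
        ∀ z ∈ sphere c r, ψ z = ((z - c) / r) ^ k * U ((z - c) / r) * V (r / (z - c)) := by
  have hmem : ∀ θ, circleMap c r θ ∈ O := fun θ => hsub (circleMap_mem_sphere c hr.le θ)
  set q : ℝ → ℂ := fun θ => deriv (circleMap c r) θ • logDeriv ψ (circleMap c r θ) with hq
  have hqc : Continuous q := by
    have h1 : ContinuousOn (logDeriv ψ) O := (hd.deriv hO).continuousOn.div hd.continuousOn h0
    have h2 : deriv (circleMap c r) = fun θ => circleMap 0 r θ * I :=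
      funext fun θ => deriv_circleMap c r θ
    have h3 : Continuous (deriv (circleMap c r)) := by
      rw [h2]
      exact (continuous_circleMap 0 r).mul continuous_const
    exact h3.smul (h1.comp_continuous (continuous_circleMap c r) hmem)
  -- The integral of the logarithmic derivative is a continuous logarithm of ψ/ψ(starting point)
  -- along the circle; after one turn it grows by 2πi k.
  set h : ℝ → ℂ := fun θ => ∫ t in 0..θ, q t with hh
  have hhd : ∀ θ, HasDerivAt h (q θ) θ := fun θ => (hqc.integral_hasStrictDerivAt 0 θ).hasDerivAt
  have hψd : ∀ θ : ℝ, HasDerivAt (fun θ => ψ (circleMap c r θ)) (q θ * ψ (circleMap c r θ)) θ := by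
    intro θ
    have h1 : HasDerivAt ψ (deriv ψ (circleMap c r θ)) (circleMap c r θ) :=
      (hd.differentiableAt (hO.mem_nhds (hmem θ))).hasDerivAt
    refine (h1.scomp θ (hasDerivAt_circleMap c r θ)).congr_deriv ?_
    simp only [hq, deriv_circleMap, smul_eq_mul, logDeriv_apply]
    field_simp [h0 _ (hmem θ)]
  have hexp : ∀ θ, ψ (circleMap c r θ) = ψ (circleMap c r 0) * exp (h θ) := by
    have hconst : ∀ θ, HasDerivAt (fun θ => ψ (circleMap c r θ) * exp (-h θ)) 0 θ := fun θ => by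
      refine ((hψd θ).mul ((hhd θ).neg.cexp)).congr_deriv ?_
      ring
    intro θ
    have h1 := is_const_of_deriv_eq_zero (fun θ => (hconst θ).differentiableAt)
      (fun θ => (hconst θ).deriv) θ 0
    have h2 : h 0 = 0 := by simp [hh]
    simp only [h2, neg_zero, exp_zero, mul_one] at h1
    rw [← h1, mul_assoc, ← exp_add, neg_add_cancel, exp_zero, mul_one]
  have hper : exp (h (2 * Real.pi)) = 1 := by
    have h1 := hexp (2 * Real.pi)
    have h2 : circleMap c r (2 * Real.pi) = circleMap c r 0 := by
      simpa using (periodic_circleMap c r) 0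
    rw [h2] at h1
    exact (mul_right_eq_self₀.1 h1.symm).resolve_right (h0 _ (hmem 0))
  obtain ⟨k, hk⟩ := exp_eq_one_iff.1 hper
  refine ⟨k, ?_, ?_⟩
  · have : (∮ z in C(c, r), logDeriv ψ z) = h (2 * Real.pi) := rfl
    rw [this, hk]
    have : (2 * Real.pi * I : ℂ) ≠ 0 := by simp [Real.pi_ne_zero]
    field_simp
  -- Without the winding term the logarithm is periodic, so it splits additively; the factors U and
  -- V are the exponentials of the two parts.
  · set f : ℝ → ℂ := fun θ => log (ψ (circleMap c r 0)) + h θ - k * I * θ with hf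
    have hfd : ∀ θ, HasDerivAt f (q θ - k * I) θ := fun θ => by
      have h1 := ((hhd θ).const_add (log (ψ (circleMap c r 0)))).sub
        ((hasDerivAt_id θ).ofReal_comp.const_mul (k * I))
      exact h1.congr_deriv (by simp)
    have hf0 : f (2 * Real.pi) = f 0 := by
      have h2 : h 0 = 0 := by simp [hh]
      simp only [hf]
      rw [hk, h2]
      push_cast
      ring
    obtain ⟨u, v, hu, hv, huv⟩ := exists_add_of_periodic hfd (hqc.sub continuous_const) hf0
    refine ⟨fun s => exp (u s), fun s => exp (v s), differentiable_exp.comp_diffContOnCl hu,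
      differentiable_exp.comp_diffContOnCl hv, fun s => exp_ne_zero _, fun s => exp_ne_zero _,
      fun z hz => ?_⟩
    have : z ∈ circleMap c r '' Ioc 0 (2 * Real.pi) := by
      rwa [image_circleMap_Ioc, abs_of_pos hr]
    obtain ⟨θ, hθ, rfl⟩ := this
    rw [circleMap_sub_div hr, div_circleMap_sub hr, mul_assoc, ← exp_add, ← huv θ hθ, hexp θ,
      ← exp_int_mul, ← exp_add]
    have : (k : ℂ) * (θ * I) + (log (ψ (circleMap c r 0)) + h θ - k * I * θ) =
      log (ψ (circleMap c r 0)) + h θ := by ring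
    rw [this, exp_add, exp_log (h0 _ (hmem 0))]

end Factorization

end SchottkyModel

/-! ### Fractional-linear maps of the exterior of one circle onto the interior of another. -/

namespace SchottkyModel

section Gluing

open Complex

/-- `g` sends the exterior of the disk with center `c` and radius `r` onto the disk with center `c'`
and radius `r'`. -/
structure IsGluing (g : SL(2, ℂ)) (c : ℂ) (r : ℝ) (c' : ℂ) (r' : ℝ) : Prop where
  pos : 0 < r
  pos' : 0 < r'
  maps : ∀ z, ‖num g z - c' * den g z‖ ≤ r' * ‖den g z‖ ↔ r ≤ ‖z - c‖

variable {g : SL(2, ℂ)} {c c' : ℂ} {r r' : ℝ}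

theorem det_eq_one' (g : SL(2, ℂ)) : g 0 0 * g 1 1 - g 0 1 * g 1 0 = 1 := by
  have := g.det_coe
  rwa [Matrix.det_fin_two] at this

theorem num_mul_den_sub (g : SL(2, ℂ)) (z w : ℂ) :
    num g z * den g w - num g w * den g z = z - w := by
  have := det_eq_one' g
  simp only [num, den]
  linear_combination (z - w) * this

theorem num_ne_zero_of_den_eq_zero {z : ℂ} (h : den g z = 0) : num g z ≠ 0 := by
  intro h'
  have := num_mul_den_sub g z (z + 1)
  rw [h, h'] at this
  simp at this

theorem continuous_num (g : SL(2, ℂ)) : Continuous (num g) := by unfold num; fun_prop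

theorem continuous_den (g : SL(2, ℂ)) : Continuous (den g) := by unfold den; fun_prop

theorem measurable_mobius (g : SL(2, ℂ)) : Measurable (mobius g) :=
  (continuous_num g).measurable.div (continuous_den g).measurable

namespace IsGluing

variable (h : IsGluing g c r c' r')
include h

theorem den_ne_zero {z : ℂ} (hz : r ≤ ‖z - c‖) : den g z ≠ 0 := by
  intro h0
  have := (h.maps z).2 hz
  rw [h0, mul_zero, sub_zero, norm_zero, mul_zero] at this
  exact num_ne_zero_of_den_eq_zero h0 (norm_le_zero_iff.1 this)

theorem den_ne_zero_of_mem_sphere {z : ℂ} (hz : z ∈ sphere c r) : den g z ≠ 0 :=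
  h.den_ne_zero (by rw [mem_sphere_iff_norm] at hz; exact hz.ge)

theorem norm_eq {z : ℂ} (hz : z ∈ sphere c r) :
    ‖num g z - c' * den g z‖ = r' * ‖den g z‖ := by
  rw [mem_sphere_iff_norm] at hz
  refine le_antisymm ((h.maps z).2 hz.ge) ?_
  have hcont : Continuous fun w => ‖num g w - c' * den g w‖ - r' * ‖den g w‖ := by
    have := continuous_num g
    have := continuous_den g
    fun_prop
  have hmem : z ∈ closure (ball c r) := by
    rw [closure_ball _ h.pos.ne', mem_closedBall_iff_norm]
    exact hz.le
  have : z ∈ {w | 0 ≤ ‖num g w - c' * den g w‖ - r' * ‖den g w‖} := by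
    refine closure_minimal (fun w hw => ?_) (isClosed_le continuous_const hcont) hmem
    rw [mem_ball_iff_norm] at hw
    have := (h.maps w).not.2 (not_le.2 hw)
    exact sub_nonneg.2 (not_le.1 this).le
  exact sub_nonneg.1 this

theorem num_sub_ne_zero {z : ℂ} (hz : z ∈ closedBall c r) : num g z - c' * den g z ≠ 0 := by
  intro h0
  rw [mem_closedBall_iff_norm] at hz
  have h1 := (h.maps z).1 (by rw [h0, norm_zero]; have := h.pos'; positivity)
  have h2 := h.norm_eq (z := z) (mem_sphere_iff_norm.2 (le_antisymm hz h1))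
  rw [h0, norm_zero] at h2
  have := h.den_ne_zero h1
  have := h.pos'
  have : 0 < r' * ‖den g z‖ := by positivity
  linarith

/-- Otherwise the map is affine and sends distant points of the exterior of the first disk outside
of the second one. -/
theorem coeff_ne_zero : g 1 0 ≠ 0 := by
  intro h0
  have hdet := det_eq_one' g
  rw [h0, mul_zero, sub_zero] at hdet
  have ha : 0 < ‖g 0 0‖ := norm_pos_iff.2 (left_ne_zero_of_mul_eq_one hdet)
  have hden : ∀ z, den g z = g 1 1 := fun z => by rw [den, h0, zero_mul, zero_add]
  set K := r' * ‖g 1 1‖ + ‖g 0 0 * c + g 0 1 - c' * g 1 1‖ with hK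
  have hK0 : 0 ≤ K := by have := h.pos'; positivity
  set t : ℝ := r + (K / ‖g 0 0‖ + 1) with ht
  have ht0 : 0 < t := by have := h.pos; positivity
  have h1 := (h.maps (c + t)).2 (by
    rw [add_sub_cancel_left, norm_real, Real.norm_eq_abs, abs_of_pos ht0, ht]
    have : 0 ≤ K / ‖g 0 0‖ := by positivity
    linarith)
  rw [hden] at h1
  have h2 : ‖g 0 0 * t‖ ≤ K := by
    have e : g 0 0 * t = (num g (c + t) - c' * g 1 1) - (g 0 0 * c + g 0 1 - c' * g 1 1) := by
      rw [num]; ring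
    rw [e]
    exact (norm_sub_le _ _).trans (by rw [hK]; linarith)
  rw [norm_mul, norm_real, Real.norm_eq_abs, abs_of_pos ht0] at h2
  have h3 : ‖g 0 0‖ * t = ‖g 0 0‖ * r + K + ‖g 0 0‖ := by
    rw [ht]; field_simp; ring
  have := h.pos
  have : 0 < ‖g 0 0‖ * r := by positivity
  linarith

/-- The pole of the map cannot lie in the closed exterior, so it is at distance less than r from the
center. -/
theorem norm_den_center_lt : ‖den g c‖ < ‖g 1 0 * r‖ := by
  have h0 := h.coeff_ne_zero
  by_contra! hle
  refine h.den_ne_zero (z := -(g 1 1) / g 1 0) ?_ ?_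
  · have e : -(g 1 1) / g 1 0 - c = -(den g c / g 1 0) := by
      rw [den]; field_simp; ring
    rw [e, norm_neg, norm_div, le_div_iff₀ (norm_pos_iff.2 h0)]
    rwa [norm_mul, norm_real, Real.norm_eq_abs, abs_of_pos h.pos, mul_comm] at hle
  · rw [den]; field_simp; ring

omit h in
theorem den_eq (hr : 0 < r) (z : ℂ) : den g z = g 1 0 * r * ((z - c) / r) + den g c := by
  have : (r : ℂ) ≠ 0 := by exact_mod_cast hr.ne'
  simp only [den]
  field_simp
  ring

/-- The normal form of the map `g` in the standard coordinates of the two circles. -/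
theorem num_sub_eq (z : ℂ) : num g z - c' * den g z =
    -r' * ((starRingEnd ℂ) (den g c) * ((z - c) / r) + (starRingEnd ℂ) (g 1 0 * r)) := by
  have hr := h.pos
  have hr0 : (r : ℂ) ≠ 0 := by exact_mod_cast hr.ne'
  set C := g 1 0 * r with hC
  set D := den g c with hD
  set A := (g 0 0 - c' * g 1 0) * r with hA
  set B := num g c - c' * den g c with hB
  have hN : ∀ z, num g z - c' * den g z = A * ((z - c) / r) + B := fun z => by
    simp only [hA, hB, num, den]
    field_simp
    ring
  have hdet : A * D - B * C = r := by
    have := det_eq_one' g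
    simp only [hA, hB, hC, hD, num, den]
    linear_combination (r : ℂ) * this
  -- The map preserves the circles: |A s + B| = r' |C s + D| for |s| = 1. The values s = 1, −1, i
  -- already give the two relations A B̄ = r'² C D̄ and |A|² + |B|² = r'² (|C|² + |D|²).
  have hs : ∀ s : ℂ, ‖s‖ = 1 → normSq (A * s + B) = r' ^ 2 * normSq (C * s + D) := fun s hs => by
    have hz : c + r * s ∈ sphere c r := by
      rw [mem_sphere_iff_norm, add_sub_cancel_left, norm_mul, hs, norm_real, Real.norm_eq_abs,
        abs_of_pos hr, mul_one]
    have e : (c + r * s - c) / r = s := by field_simp; ring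
    have h1 := h.norm_eq hz
    rw [hN, den_eq hr (c := c), e] at h1
    rw [normSq_eq_norm_sq, normSq_eq_norm_sq, h1, mul_pow]
  have s1 := hs 1 (by simp)
  have s2 := hs (-1) (by simp)
  have s3 := hs I (by simp)
  have hCD : normSq D < normSq C := by
    rw [normSq_eq_norm_sq, normSq_eq_norm_sq]
    exact pow_lt_pow_left₀ h.norm_den_center_lt (norm_nonneg _) two_ne_zero
  have hX : A * (starRingEnd ℂ) B = r' ^ 2 * (C * (starRingEnd ℂ) D) := by
    simp only [normSq_apply, mul_re, mul_im, add_re, add_im, neg_re, neg_im, one_re, one_im, I_re,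
      I_im] at s1 s2 s3
    refine Complex.ext ?_ ?_
    · simp only [mul_re, mul_im, conj_re, conj_im, sq, ofReal_re, ofReal_im]
      linear_combination (s1 - s2) / 4
    · simp only [mul_re, mul_im, conj_re, conj_im, sq, ofReal_re, ofReal_im]
      linear_combination (s1 + s2) / 4 - s3 / 2
  have hE : normSq A + normSq B = r' ^ 2 * (normSq C + normSq D) := by
    simp only [normSq_apply, mul_re, mul_im, add_re, add_im, neg_re, neg_im, one_re, one_im]
      at s1 s2 ⊢
    linear_combination (s1 + s2) / 2
  -- With the determinant A D − B C = r, the relations force A = −κ D̄ and B = −κ C̄. Then κ > 0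
  -- because |D| < |C|, and the relation of norms gives κ = r'.
  set κ : ℝ := (normSq B - r' ^ 2 * normSq D) / r with hκ
  have hκr : normSq B - r' ^ 2 * normSq D = r * κ := by rw [hκ]; field_simp
  have nA := mul_conj A
  have nB := mul_conj B
  have nC := mul_conj C
  have nD := mul_conj D
  have hκc : (normSq B : ℂ) - r' ^ 2 * normSq D = r * κ := by exact_mod_cast hκr
  have hEc : (normSq A : ℂ) + normSq B = r' ^ 2 * (normSq C + normSq D) := by exact_mod_cast hE
  have hX' : (starRingEnd ℂ) A * B = r' ^ 2 * ((starRingEnd ℂ) C * D) := by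
    have := congrArg (starRingEnd ℂ) hX
    simpa using this
  have hB' : (starRingEnd ℂ) B = -κ * C := by
    have : (r : ℂ) * (starRingEnd ℂ) B = r * (-κ * C) := by
      rw [← hdet]
      linear_combination D * hX - C * nB - C * hκc + r' ^ 2 * C * nD + κ * C * hdet
    exact mul_left_cancel₀ hr0 this
  have hA' : (starRingEnd ℂ) A = -κ * D := by
    have : (r : ℂ) * (starRingEnd ℂ) A = r * (-κ * D) := by
      rw [← hdet]
      linear_combination D * nA - C * hX' + D * hEc - D * hκc - r' ^ 2 * D * nC + κ * D * hdet
    exact mul_left_cancel₀ hr0 this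
  have hA2 : A = -κ * (starRingEnd ℂ) D := by
    have := congrArg (starRingEnd ℂ) hA'
    simpa using this
  have hB2 : B = -κ * (starRingEnd ℂ) C := by
    have := congrArg (starRingEnd ℂ) hB'
    simpa using this
  have hκ0 : κ * (normSq C - normSq D) = r := by
    have : (κ : ℂ) * (normSq C - normSq D) = r := by
      rw [← hdet, hA2, hB2]
      linear_combination -κ * nC + κ * nD
    exact_mod_cast this
  have hκpos : 0 < κ := by
    by_contra! hle
    have : κ * (normSq C - normSq D) ≤ 0 := mul_nonpos_of_nonpos_of_nonneg hle (by linarith)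
    linarith
  have hκeq : κ = r' := by
    have h1 : normSq A = κ ^ 2 * normSq D := by rw [hA2]; simp [normSq_mul, sq]
    have h2 : normSq B = κ ^ 2 * normSq C := by rw [hB2]; simp [normSq_mul, sq]
    rw [h1, h2] at hE
    have h3 : 0 < normSq C + normSq D := by linarith [normSq_nonneg D]
    have h4 : κ ^ 2 = r' ^ 2 := by
      have : κ ^ 2 * (normSq C + normSq D) = r' ^ 2 * (normSq C + normSq D) := by linarith
      exact mul_right_cancel₀ h3.ne' this
    exact (pow_left_inj₀ hκpos.le h.pos'.le two_ne_zero).1 h4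
  rw [hN, hA2, hB2, hκeq]
  ring

end IsGluing

/-- Two finite measures on a circle with equal Fourier coefficients are equal. -/
theorem measure_ext_of_integral_zpow (hr : 0 < r) {μ ν : Measure ℂ} [IsFiniteMeasure μ]
    [IsFiniteMeasure ν] (hμ : ∀ᵐ z ∂μ, z ∈ sphere c r) (hν : ∀ᵐ z ∂ν, z ∈ sphere c r)
    (heq : ∀ n : ℤ, ∫ z, (z - c) ^ n ∂μ = ∫ z, (z - c) ^ n ∂ν) : μ = ν := by
  have : Fact (0 < 2 * Real.pi) := ⟨Real.two_pi_pos⟩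
  have hr0 : (r : ℂ) ≠ 0 := by exact_mod_cast hr.ne'
  -- The angle transports the measures to the compact group where trigonometric polynomials form a
  -- separating star subalgebra; b is its inverse on the circle.
  let e : ℂ → AddCircle (2 * Real.pi) := fun z => ((arg (z - c) : ℝ) : AddCircle (2 * Real.pi))
  let b : AddCircle (2 * Real.pi) → ℂ := fun t => c + r * fourier 1 t
  have he : Measurable e := (AddCircle.continuous_mk' (2 * Real.pi)).measurable.comp
    (measurable_arg.comp (measurable_id.sub_const c))
  have hb : Measurable b := (Continuous.measurable (by fun_prop))
  have hfe : ∀ z ∈ sphere c r, ∀ n : ℤ, fourier n (e z) = ((r : ℂ) ^ n)⁻¹ * (z - c) ^ n := by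
    intro z hz n
    have h1 : exp (arg (z - c) * I) = (z - c) / r := by
      rw [mem_sphere_iff_norm] at hz
      have := norm_mul_exp_arg_mul_I (z - c)
      rw [hz] at this
      rw [eq_div_iff hr0, mul_comm, this]
    have h2 : fourier n (e z) = exp (arg (z - c) * I) ^ n := by
      rw [fourier_coe_apply, ← exp_int_mul]
      congr 1
      have : (Real.pi : ℂ) ≠ 0 := by exact_mod_cast Real.pi_ne_zero
      push_cast
      field_simp
    rw [h2, h1, div_zpow, div_eq_mul_inv, mul_comm]
  have hbe : ∀ z ∈ sphere c r, b (e z) = z := fun z hz => by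
    simp only [b]
    rw [hfe z hz]
    simp only [zpow_one]
    field_simp
    ring
  have key : ∀ {ρ : Measure ℂ}, (∀ᵐ z ∂ρ, z ∈ sphere c r) → (ρ.map e).map b = ρ := fun {ρ} hρ => by
    rw [Measure.map_map hb he]
    conv_rhs => rw [← Measure.map_id (μ := ρ)]
    exact Measure.map_congr (hρ.mono fun z hz => hbe z hz)
  rw [← key hμ, ← key hν]
  congr 1
  have hA : ((((fourierSubalgebra (T := 2 * Real.pi)).comap
      (BoundedContinuousFunction.toContinuousMapStarₐ ℂ)).map
        (BoundedContinuousFunction.toContinuousMapStarₐ ℂ))).SeparatesPoints := by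
    intro x y hxy
    obtain ⟨f, ⟨f', hf', rfl⟩, hf⟩ := fourierSubalgebra_separatesPoints hxy
    refine ⟨f', ⟨f', ⟨BoundedContinuousFunction.mkOfCompact f', ?_, ?_⟩, rfl⟩, hf⟩
    · exact hf'
    · ext; rfl
  refine ext_of_forall_mem_subalgebra_integral_eq_of_polish hA fun f hf => ?_
  have hf2 : f.toContinuousMap ∈ Submodule.span ℂ (range (fourier (T := 2 * Real.pi))) := by
    rw [← fourierSubalgebra_coe]
    exact hf
  have hint : ∀ {ρ : Measure ℂ} [IsFiniteMeasure ρ] (u : C(AddCircle (2 * Real.pi), ℂ)),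
      Integrable u (ρ.map e) := fun {ρ} _ u =>
    (BoundedContinuousFunction.mkOfCompact u).integrable (ρ.map e)
  have hgen : ∀ u ∈ Submodule.span ℂ (range (fourier (T := 2 * Real.pi))),
      ∫ x, u x ∂(μ.map e) = ∫ x, u x ∂(ν.map e) := by
    intro u hu
    induction hu using Submodule.span_induction with
    | mem u hu =>
      obtain ⟨n, rfl⟩ := hu
      have : ∀ {ρ : Measure ℂ}, (∀ᵐ z ∂ρ, z ∈ sphere c r) → ∫ x, fourier n x ∂(ρ.map e) =
          ((r : ℂ) ^ n)⁻¹ * ∫ z, (z - c) ^ n ∂ρ := fun {ρ} hρ => by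
        rw [integral_map he.aemeasurable (fourier n).continuous.aestronglyMeasurable,
          ← integral_const_mul]
        exact integral_congr_ae (hρ.mono fun z hz => hfe z hz n)
      rw [this hμ, this hν, heq]
    | zero => simp
    | add u v _ _ hu hv =>
      simp only [ContinuousMap.add_apply]
      rw [integral_add (hint u) (hint v), integral_add (hint u) (hint v), hu, hv]
    | smul a u _ hu =>
      simp only [ContinuousMap.smul_apply]
      rw [integral_smul, integral_smul, hu]
  exact hgen _ hf2

end Gluing

end SchottkyModel

/-! ### The pull-back of half-forms is unitary and exchanges the Hardy spaces. -/

namespace SchottkyModel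

section Pullback

open Complex

variable {g : SL(2, ℂ)} {c c' : ℂ} {r r' : ℝ}

theorem hasDerivAt_mobius_sub {z : ℂ} (hz : den g z ≠ 0) :
    HasDerivAt (fun z => mobius g z - c') ((den g z ^ 2)⁻¹) z := by
  have h1 : HasDerivAt (num g) (g 0 0) z := by
    unfold num
    simpa using ((hasDerivAt_id z).const_mul (g 0 0)).add_const (g 0 1)
  have h2 : HasDerivAt (den g) (g 1 0) z := by
    unfold den
    simpa using ((hasDerivAt_id z).const_mul (g 1 0)).add_const (g 1 1)
  refine ((h1.div h2 hz).sub_const c').congr_deriv ?_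
  have : g 0 0 * den g z - num g z * g 1 0 = 1 := by
    have := det_eq_one' g
    simp only [num, den]
    linear_combination this
  rw [this, one_div]

namespace IsGluing

variable (h : IsGluing g c r c' r')
include h

theorem mobius_sub_eq {z : ℂ} (hz : z ∈ sphere c r) :
    mobius g z - c' = (num g z - c' * den g z) / den g z := by
  have := h.den_ne_zero_of_mem_sphere hz
  rw [mobius]
  field_simp

theorem mobius_mem_sphere {z : ℂ} (hz : z ∈ sphere c r) : mobius g z ∈ sphere c' r' := by
  have := norm_pos_iff.2 (h.den_ne_zero_of_mem_sphere hz)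
  rw [mem_sphere_iff_norm, h.mobius_sub_eq hz, norm_div, h.norm_eq hz]
  field_simp

/-- On the circle the conjugate of z − c is r²/(z − c), so the normal form of the map turns the
density |φ'| = |den|⁻² into a rational function of z, to which residue calculus applies. -/
theorem inv_normSq_den {z : ℂ} (hz : z ∈ sphere c r) : (((‖den g z‖ ^ 2)⁻¹ : ℝ) : ℂ) * r =
    -r' * (z - c) / (den g z * (num g z - c' * den g z)) := by
  have hr := h.pos
  have hr0 : (r : ℂ) ≠ 0 := by exact_mod_cast hr.ne'
  have h1 := h.den_ne_zero_of_mem_sphere hz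
  have h2 := h.num_sub_ne_zero (sphere_subset_closedBall hz)
  have h3 : (‖den g z‖ ^ 2 : ℂ) = den g z * (starRingEnd ℂ) (den g z) := by
    rw [mul_conj, normSq_eq_norm_sq]; push_cast; rfl
  have h4 : (z - c) * (starRingEnd ℂ) (z - c) = r ^ 2 := by
    rw [mem_sphere_iff_norm] at hz
    rw [mul_conj, normSq_eq_norm_sq, hz]; push_cast; rfl
  have h5 : (num g z - c' * den g z) * r = -r' * (z - c) * (starRingEnd ℂ) (den g z) := by
    rw [h.num_sub_eq z, den_eq hr (c := c) z]
    simp only [map_add, map_mul, map_div₀, conj_ofReal]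
    field_simp
    linear_combination (r' * (starRingEnd ℂ) (g 1 0)) * h4
  have h6 : (starRingEnd ℂ) (den g z) ≠ 0 := (map_ne_zero _).2 h1
  push_cast
  rw [h3]
  rw [inv_mul_eq_div, div_eq_div_iff (mul_ne_zero h1 h6) (mul_ne_zero h1 h2)]
  linear_combination den g z * h5

/-- As φ' = den⁻², the integrand is (φ − c')^(n−1) φ', which has a primitive for n ≠ 0. For n = 0,
partial fractions leave only the pole of φ inside the disk; the sign reflects the reversal of
orientation. -/
theorem circleIntegral_mobius_zpow (n : ℤ) :
    ∮ z in C(c, r), (mobius g z - c') ^ n / (den g z * (num g z - c' * den g z)) =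
      if n = 0 then -(2 * Real.pi * I) else 0 := by
  have hr := h.pos
  have hr0 : (r : ℂ) ≠ 0 := by exact_mod_cast hr.ne'
  split_ifs with hn
  · subst hn
    have e1 : ∀ z ∈ sphere c r, (mobius g z - c') ^ (0 : ℤ) / (den g z * (num g z - c' * den g z)) =
        (g 0 0 - c' * g 1 0) / (num g z - c' * den g z) - (z - -(g 1 1) / g 1 0)⁻¹ := by
      intro z hz
      have h1 := h.den_ne_zero_of_mem_sphere hz
      have h2 := h.num_sub_ne_zero (sphere_subset_closedBall hz)
      have h3 := h.coeff_ne_zero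
      have e : z - -(g 1 1) / g 1 0 = den g z / g 1 0 := by rw [den]; field_simp; ring
      have e' : (g 0 0 - c' * g 1 0) * den g z - (num g z - c' * den g z) * g 1 0 = 1 := by
        have := det_eq_one' g
        simp only [num, den]
        linear_combination this
      rw [e, zpow_zero, inv_div, div_sub_div _ _ h2 h1, e', mul_comm]
    have hd : DiffContOnCl ℂ (fun z => (g 0 0 - c' * g 1 0) / (num g z - c' * den g z))
        (ball c r) := by
      refine DifferentiableOn.diffContOnCl ?_
      rw [closure_ball _ hr.ne']
      refine DifferentiableOn.div (by fun_prop) ?_ fun z hz => h.num_sub_ne_zero hz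
      unfold num den
      fun_prop
    have hp : -(g 1 1) / g 1 0 ∈ ball c r := by
      rw [mem_ball_iff_norm]
      by_contra! hle
      refine h.den_ne_zero hle ?_
      have h3 := h.coeff_ne_zero
      rw [den]; field_simp; ring
    rw [circleIntegral.integral_congr hr.le e1, circleIntegral.integral_sub,
      hd.circleIntegral_eq_zero hr.le, circleIntegral.integral_sub_inv_of_mem_ball hp, zero_sub]
    · refine ContinuousOn.circleIntegrable hr.le (hd.continuousOn.mono ?_)
      rw [closure_ball _ hr.ne']
      exact sphere_subset_closedBall
    · refine ContinuousOn.circleIntegrable hr.le (ContinuousOn.inv₀ (by fun_prop) fun z hz => ?_)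
      refine sub_ne_zero.2 ?_
      rintro rfl
      exact absurd hp (by rw [mem_ball, mem_sphere.1 hz]; exact lt_irrefl _)
  · refine circleIntegral.integral_eq_zero_of_hasDerivWithinAt
      (f := fun z => (n : ℂ)⁻¹ * (mobius g z - c') ^ n) hr.le fun z hz => ?_
    have h1 := h.den_ne_zero_of_mem_sphere hz
    have h2 := h.num_sub_ne_zero (sphere_subset_closedBall hz)
    have h3 : mobius g z - c' ≠ 0 := by
      rw [h.mobius_sub_eq hz]
      exact div_ne_zero h2 h1
    have hn' : (n : ℂ) ≠ 0 := by exact_mod_cast hn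
    have h4 := ((hasDerivAt_zpow n _ (Or.inl h3)).comp z
      (hasDerivAt_mobius_sub (c' := c') h1)).const_mul (n : ℂ)⁻¹
    refine (h4.congr_deriv ?_).hasDerivWithinAt
    rw [zpow_sub₀ h3, zpow_one, h.mobius_sub_eq hz]
    field_simp

/-- The change of variables for the arc length. -/
theorem map_mobius : ((arcLength c r).withDensity
    fun z => ENNReal.ofReal ((‖den g z‖ ^ 2)⁻¹)).map (mobius g) = arcLength c' r' := by
  have hr := h.pos
  have hr' := h.pos'
  have hcont : ContinuousOn (fun z => (‖den g z‖ ^ 2)⁻¹) (sphere c r) :=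
    ContinuousOn.inv₀ ((continuous_den g).norm.pow 2).continuousOn fun z hz =>
      pow_ne_zero _ (norm_ne_zero_iff.2 (h.den_ne_zero_of_mem_sphere hz))
  have hmeas : Measurable fun z => (‖den g z‖ ^ 2)⁻¹ :=
    ((continuous_den g).norm.pow 2).measurable.inv
  have hfin : IsFiniteMeasure ((arcLength c r).withDensity
      fun z => ENNReal.ofReal ((‖den g z‖ ^ 2)⁻¹)) := by
    obtain ⟨K, hK⟩ := (isCompact_sphere c r).exists_bound_of_continuousOn hcont
    refine isFiniteMeasure_withDensity_ofReal ?_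
    refine (memLp_one_iff_integrable.1 (MemLp.of_bound hmeas.aestronglyMeasurable K ?_)).2
    exact ae_arcLength_of_forall_mem_sphere hr.le hK
  have hs : ∀ᵐ z ∂((arcLength c r).withDensity fun z => ENNReal.ofReal ((‖den g z‖ ^ 2)⁻¹)),
      z ∈ sphere c r :=
    (withDensity_absolutelyContinuous _ _).ae_le
      (ae_arcLength_of_forall_mem_sphere hr.le fun z hz => hz)
  -- Comparing moments avoids a lift of the map to the angle. Only the moment n = 0 is nonzero, and
  -- it is 2π r' on both sides.
  refine measure_ext_of_integral_zpow hr' ?_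
    (ae_arcLength_of_forall_mem_sphere hr'.le fun z hz => hz) fun n => ?_
  · refine (ae_map_iff (p := (· ∈ sphere c' r')) (measurable_mobius g).aemeasurable
      isClosed_sphere.measurableSet).2 ?_
    exact hs.mono fun z hz => h.mobius_mem_sphere hz
  · have m1 : Measurable fun w : ℂ => (w - c') ^ n := (measurable_id.sub_const c').pow_const n
    rw [integral_map (measurable_mobius g).aemeasurable m1.aestronglyMeasurable]
    have e1 : ∫ z, (mobius g z - c') ^ n ∂((arcLength c r).withDensity
        fun z => ENNReal.ofReal ((‖den g z‖ ^ 2)⁻¹)) =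
          ∫ z, (((‖den g z‖ ^ 2)⁻¹ : ℝ) : ℂ) * (mobius g z - c') ^ n ∂arcLength c r := by
      rw [integral_withDensity_eq_integral_toReal_smul hmeas.ennreal_ofReal
        (Eventually.of_forall fun z => ENNReal.ofReal_lt_top)]
      refine integral_congr_ae (Eventually.of_forall fun z => ?_)
      beta_reduce
      rw [ENNReal.toReal_ofReal (by positivity), Complex.real_smul]
    have m2 : Measurable fun z => (((‖den g z‖ ^ 2)⁻¹ : ℝ) : ℂ) * (mobius g z - c') ^ n :=
      (measurable_ofReal.comp hmeas).mul (m1.comp (measurable_mobius g))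
    rw [e1, integral_arcLength hr.le m2.aestronglyMeasurable,
      integral_arcLength hr'.le m1.aestronglyMeasurable]
    have e2 := h.circleIntegral_mobius_zpow n
    rw [circleIntegral] at e2
    have e3 : (r : ℂ) * ∫ θ in 0..2 * Real.pi, (((‖den g (circleMap c r θ)‖ ^ 2)⁻¹ : ℝ) : ℂ) *
        (mobius g (circleMap c r θ) - c') ^ n = (I * r') * (if n = 0 then -(2 * Real.pi * I) else 0) := by
      rw [← e2, ← intervalIntegral.integral_const_mul, ← intervalIntegral.integral_const_mul]
      congr 1
      ext θ
      have hz := circleMap_mem_sphere c hr.le θ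
      have := h.inv_normSq_den hz
      rw [deriv_circleMap, ← circleMap_sub_center, smul_eq_mul, ← mul_assoc, mul_comm (r : ℂ), this]
      linear_combination (-(r' : ℂ) * (circleMap c r θ - c) *
        (mobius g (circleMap c r θ) - c') ^ n / (den g (circleMap c r θ) *
          (num g (circleMap c r θ) - c' * den g (circleMap c r θ)))) * I_sq
    rw [e3]
    have e4 := circleCoeff_zpow (c := c') (r := r') 0 n
    unfold circleCoeff at e4
    simp only [Int.cast_zero, zero_mul, neg_zero, exp_zero, one_mul] at e4
    split_ifs with hn
    · subst hn
      simp
      linear_combination (-(r' : ℂ) * Real.pi * 2) * I_sq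
    · rw [e4 hn, mul_zero, mul_zero]

theorem lintegral_mobius {F : ℂ → ℝ≥0∞} (hF : Measurable F) :
    ∫⁻ z, ENNReal.ofReal ((‖den g z‖ ^ 2)⁻¹) * F (mobius g z) ∂arcLength c r =
      ∫⁻ z, F z ∂arcLength c' r' := by
  have hmeas : Measurable fun z => (‖den g z‖ ^ 2)⁻¹ :=
    ((continuous_den g).norm.pow 2).measurable.inv
  rw [← h.map_mobius, lintegral_map hF (measurable_mobius g)]
  exact (lintegral_withDensity_eq_lintegral_mul _ hmeas.ennreal_ofReal
    (hF.comp (measurable_mobius g))).symm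

/-- The density |den|⁻² does not vanish on the circle, so null sets pull back to null sets. -/
theorem ae_mobius {p : ℂ → Prop} (hp : ∀ᵐ z ∂arcLength c' r', p z) :
    ∀ᵐ z ∂arcLength c r, p (mobius g z) := by
  have hmeas : Measurable fun z => (‖den g z‖ ^ 2)⁻¹ :=
    ((continuous_den g).norm.pow 2).measurable.inv
  rw [← h.map_mobius] at hp
  have := ae_of_ae_map (measurable_mobius g).aemeasurable hp
  rw [ae_withDensity_iff hmeas.ennreal_ofReal] at this
  filter_upwards [this, ae_arcLength_of_forall_mem_sphere h.pos.le fun z hz =>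
    h.den_ne_zero_of_mem_sphere hz] with z h1 h2
  refine h1 ?_
  have : 0 < ‖den g z‖ := norm_pos_iff.2 h2
  simp only [ne_eq, ENNReal.ofReal_eq_zero, not_le]
  positivity

theorem halfFormPullback_congr {F G : ℂ → ℂ} (hFG : F =ᵐ[arcLength c' r'] G) :
    halfFormPullback g F =ᵐ[arcLength c r] halfFormPullback g G := by
  filter_upwards [h.ae_mobius hFG] with z hz
  rw [halfFormPullback, halfFormPullback, hz]

omit h in
theorem enorm_halfFormPullback_sq (F : ℂ → ℂ) (z : ℂ) : ‖halfFormPullback g F z‖ₑ ^ 2 =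
    ENNReal.ofReal ((‖den g z‖ ^ 2)⁻¹) * ‖F (mobius g z)‖ₑ ^ 2 := by
  rw [halfFormPullback, enorm_mul, mul_pow, ← ofReal_norm_sq, norm_inv, inv_pow]

omit h in
theorem aestronglyMeasurable_halfFormPullback (f : CircleL2 c' r') :
    AEStronglyMeasurable (halfFormPullback g f) (arcLength c r) :=
  ((continuous_den g).measurable.inv.mul
    ((Lp.stronglyMeasurable f).measurable.comp (measurable_mobius g))).aestronglyMeasurable

theorem lintegral_halfFormPullback (f : CircleL2 c' r') :
    ∫⁻ z, ‖halfFormPullback g f z‖ₑ ^ 2 ∂arcLength c r =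
      ∫⁻ z, ‖(f : ℂ → ℂ) z‖ₑ ^ 2 ∂arcLength c' r' := by
  simp only [enorm_halfFormPullback_sq]
  exact h.lintegral_mobius (F := fun z => ‖(f : ℂ → ℂ) z‖ₑ ^ 2)
    ((Lp.stronglyMeasurable f).enorm.pow_const 2)

theorem eLpNorm_halfFormPullback (f : CircleL2 c' r') :
    eLpNorm (halfFormPullback g f) 2 (arcLength c r) = eLpNorm f 2 (arcLength c' r') := by
  rw [eLpNorm_eq_lintegral_rpow_enorm_toReal two_ne_zero ENNReal.ofNat_ne_top,
    eLpNorm_eq_lintegral_rpow_enorm_toReal two_ne_zero ENNReal.ofNat_ne_top]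
  simp only [ENNReal.toReal_ofNat, ENNReal.rpow_ofNat]
  rw [h.lintegral_halfFormPullback]

theorem memLp_halfFormPullback (f : CircleL2 c' r') :
    MemLp (halfFormPullback g f) 2 (arcLength c r) :=
  ⟨aestronglyMeasurable_halfFormPullback f, by
    rw [h.eLpNorm_halfFormPullback]; exact (Lp.memLp f).2⟩

/-- The pull-back of square-integrable half-forms. -/
def pullbackIsometry : CircleL2 c' r' →ₗᵢ[ℂ] CircleL2 c r where
  toFun f := (h.memLp_halfFormPullback f).toLp _
  map_add' f₁ f₂ := by
    rw [← MemLp.toLp_add (h.memLp_halfFormPullback f₁) (h.memLp_halfFormPullback f₂)]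
    refine MemLp.toLp_congr _ _ ?_
    filter_upwards [h.ae_mobius (Lp.coeFn_add f₁ f₂)] with z hz
    rw [Pi.add_apply, halfFormPullback, hz, Pi.add_apply, mul_add]
    rfl
  map_smul' a f := by
    rw [RingHom.id_apply, ← MemLp.toLp_const_smul a (h.memLp_halfFormPullback f)]
    refine MemLp.toLp_congr _ _ ?_
    filter_upwards [h.ae_mobius (Lp.coeFn_smul a f)] with z hz
    rw [Pi.smul_apply, halfFormPullback, hz, Pi.smul_apply, smul_eq_mul, smul_eq_mul,
      halfFormPullback]
    ring
  norm_map' f := by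
    change ‖(h.memLp_halfFormPullback f).toLp _‖ = _
    rw [Lp.norm_toLp, h.eLpNorm_halfFormPullback, Lp.norm_def]

theorem coeFn_pullbackIsometry (f : CircleL2 c' r') :
    (h.pullbackIsometry f : ℂ → ℂ) =ᵐ[arcLength c r] halfFormPullback g f :=
  (h.memLp_halfFormPullback f).coeFn_toLp

theorem pullbackIsometry_pullbackIsometry {g₂ : SL(2, ℂ)} (hg : g₂ = g⁻¹)
    (h' : IsGluing g₂ c' r' c r) (f : CircleL2 c r) :
    h.pullbackIsometry (h'.pullbackIsometry f) = f := by
  subst hg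
  refine Lp.ext ?_
  filter_upwards [h.coeFn_pullbackIsometry (h'.pullbackIsometry f),
    h.ae_mobius (h'.coeFn_pullbackIsometry f),
    ae_arcLength_of_forall_mem_sphere h.pos.le fun z hz => h.den_ne_zero_of_mem_sphere hz]
    with z h1 h2 h3
  rw [h1, halfFormPullback, h2, halfFormPullback]
  have hdet := det_eq_one' g
  have e1 : den g⁻¹ (mobius g z) = (den g z)⁻¹ := by
    refine eq_inv_of_mul_eq_one_left ?_
    rw [mobius, den]
    rw [Matrix.SpecialLinearGroup.SL2_inv_expl]
    simp
    field_simp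
    rw [num, den]
    linear_combination hdet
  have e2 : num g⁻¹ (mobius g z) = z * (den g z)⁻¹ := by
    rw [← div_eq_mul_inv, eq_div_iff h3, mobius, num]
    rw [Matrix.SpecialLinearGroup.SL2_inv_expl]
    simp
    field_simp
    rw [num, den]
    linear_combination z * hdet
  rw [show mobius g⁻¹ (mobius g z) = num g⁻¹ (mobius g z) / den g⁻¹ (mobius g z) from rfl, e1, e2,
    inv_inv, ← mul_assoc, inv_mul_cancel₀ h3, one_mul, mul_div_cancel_right₀]
  exact inv_ne_zero h3

theorem pullbackIsometry_mem_hardyMinus {f : CircleL2 c' r'} (hf : f ∈ hardyPlus c' r') :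
    h.pullbackIsometry f ∈ hardyMinus c r := by
  have hr := h.pos
  have hr0 : (r : ℂ) ≠ 0 := by exact_mod_cast hr.ne'
  have := hardyPlus_le (c := c') (r := r')
    (W := (hardyMinus c r).comap h.pullbackIsometry.toLinearMap)
    ((Submodule.isClosed_topologicalClosure _).preimage h.pullbackIsometry.continuous)
    fun n => ?_
  · exact this hf
  rw [Submodule.mem_comap]
  -- In the coordinate w = r/(z − c) the normal form shows that the pull-back of the n-th power is w
  -- G(w); the denominator has no zeros in the disk because the pole of the map is closer to the
  -- center than r.
  set G : ℂ → ℂ := fun w => (-r' * ((starRingEnd ℂ) (den g c) + (starRingEnd ℂ) (g 1 0 * r) * w)) ^ n /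
    (g 1 0 * r + den g c * w) ^ (n + 1) with hG
  have hne : ∀ w ∈ closedBall (0 : ℂ) 1, g 1 0 * r + den g c * w ≠ 0 := fun w hw h0 => by
    rw [mem_closedBall_zero_iff] at hw
    have h1 : ‖g 1 0 * r‖ = ‖den g c‖ * ‖w‖ := by
      rw [eq_neg_of_add_eq_zero_left h0, norm_neg, norm_mul]
    have := h.norm_den_center_lt
    nlinarith [norm_nonneg (den g c)]
  have hGd : DiffContOnCl ℂ G (ball 0 1) := by
    refine DifferentiableOn.diffContOnCl ?_
    rw [closure_ball _ one_ne_zero]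
    exact DifferentiableOn.div (by fun_prop) (by fun_prop) fun w hw => pow_ne_zero _ (hne w hw)
  refine mem_hardyMinus_of_outside hr hGd ?_
  filter_upwards [h.coeFn_pullbackIsometry (monomial c' r' n),
    h.ae_mobius (coeFn_monomial (c := c') (r := r') n),
    ae_arcLength_of_forall_mem_sphere hr.le fun z hz => hz] with z h1 h2 hz
  refine h1.trans ?_
  have hd := h.den_ne_zero_of_mem_sphere hz
  have hz0 := sub_ne_zero_of_mem_sphere hr hz
  rw [halfFormPullback, h2, h.mobius_sub_eq hz, h.num_sub_eq z, hG, zpow_natCast]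
  have e1 : g 1 0 * r + den g c * (r / (z - c)) = r / (z - c) * den g z := by
    rw [den_eq hr (c := c) z]; field_simp
  have e2 : (starRingEnd ℂ) (den g c) + (starRingEnd ℂ) (g 1 0 * r) * (r / (z - c)) =
      r / (z - c) * ((starRingEnd ℂ) (den g c) * ((z - c) / r) + (starRingEnd ℂ) (g 1 0 * r)) := by
    field_simp
  have hw : (r : ℂ) / (z - c) ≠ 0 := div_ne_zero hr0 hz0
  beta_reduce
  rw [e1, e2, div_pow, mul_left_comm, mul_pow (r / (z - c) : ℂ), mul_pow (r / (z - c) : ℂ), pow_succ,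
    pow_succ (den g z)]
  generalize (r : ℂ) / (z - c) = w at hw
  field_simp

theorem pullbackIsometry_mem_hardyPlus {f : CircleL2 c' r'} (hf : f ∈ hardyMinus c' r') :
    h.pullbackIsometry f ∈ hardyPlus c r := by
  have hr := h.pos
  have hr0 : (r : ℂ) ≠ 0 := by exact_mod_cast hr.ne'
  have := hardyMinus_le (c := c') (r := r')
    (W := (hardyPlus c r).comap h.pullbackIsometry.toLinearMap)
    ((Submodule.isClosed_topologicalClosure _).preimage h.pullbackIsometry.continuous)
    fun n => ?_
  · exact this hf
  rw [Submodule.mem_comap]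
  have e0 : ∀ s : ℂ, c + r * s - c = r * s := fun s => by ring
  -- The pull-back of the power −n − 1 is denⁿ/(num − c' den)^(n+1), and num − c' den has no zeros
  -- in the closed disk.
  set G : ℂ → ℂ := fun s => den g (c + r * s) ^ n /
    (num g (c + r * s) - c' * den g (c + r * s)) ^ (n + 1) with hG
  have hne : ∀ s ∈ closedBall (0 : ℂ) 1, num g (c + r * s) - c' * den g (c + r * s) ≠ 0 :=
    fun s hs => h.num_sub_ne_zero (by
      rw [mem_closedBall_zero_iff] at hs
      rw [mem_closedBall_iff_norm, add_sub_cancel_left, norm_mul, norm_real, Real.norm_eq_abs,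
        abs_of_pos hr]
      nlinarith)
  have hGd : DiffContOnCl ℂ G (ball 0 1) := by
    refine DifferentiableOn.diffContOnCl ?_
    rw [closure_ball _ one_ne_zero]
    refine DifferentiableOn.div ?_ ?_ fun w hw => pow_ne_zero _ (hne w hw)
    · unfold den; fun_prop
    · unfold num den; fun_prop
  refine mem_hardyPlus_of_inside hr hGd ?_
  filter_upwards [h.coeFn_pullbackIsometry (monomial c' r' (-(n : ℤ) - 1)),
    h.ae_mobius (coeFn_monomial (c := c') (r := r') (-(n : ℤ) - 1)),
    ae_arcLength_of_forall_mem_sphere hr.le fun z hz => hz] with z h1 h2 hz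
  refine h1.trans ?_
  have hd := h.den_ne_zero_of_mem_sphere hz
  have hN := h.num_sub_ne_zero (sphere_subset_closedBall hz)
  have e : (-(n : ℤ) - 1) = -((n + 1 : ℕ) : ℤ) := by push_cast; ring
  have e1 : c + r * ((z - c) / r) = z := by field_simp; ring
  rw [halfFormPullback, h2, h.mobius_sub_eq hz, hG, e, zpow_neg, zpow_natCast]
  beta_reduce
  rw [e1, div_pow, inv_div, pow_succ (den g z)]
  field_simp

/-- The pull-back as a unitary operator. -/
def pullback (h' : IsGluing g⁻¹ c' r' c r) : CircleL2 c' r' ≃ₗᵢ[ℂ] CircleL2 c r where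
  toLinearEquiv := LinearEquiv.ofLinearMap h.pullbackIsometry.toLinearMap
    h'.pullbackIsometry.toLinearMap
    (LinearMap.ext fun f => h.pullbackIsometry_pullbackIsometry rfl h' f)
    (LinearMap.ext fun f => h'.pullbackIsometry_pullbackIsometry (inv_inv g).symm h f)
  norm_map' := h.pullbackIsometry.norm_map

theorem coeFn_pullback (h' : IsGluing g⁻¹ c' r' c r) (f : CircleL2 c' r') :
    (h.pullback h' f : ℂ → ℂ) =ᵐ[arcLength c r] halfFormPullback g f :=
  h.coeFn_pullbackIsometry f

theorem swapsHardy_pullback (h' : IsGluing g⁻¹ c' r' c r) : SwapsHardy (h.pullback h') where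
  plus _ hf := h.pullbackIsometry_mem_hardyMinus hf
  minus _ hf := h.pullbackIsometry_mem_hardyPlus hf
  symm_plus _ hf := h'.pullbackIsometry_mem_hardyMinus hf

end IsGluing

end Pullback

end SchottkyModel

/-! ### Gluing spaces, blocks and indices of a bundle. -/

namespace SchottkyCurve

variable {I : Type*} (X : SchottkyCurve I)

theorem isGluing (i : I) : IsGluing (X.φ i) (X.center i) (X.radius i) (X.center (X.inv i))
    (X.radius (X.inv i)) :=
  ⟨X.radius_pos i, X.radius_pos _, X.φ_maps i⟩

theorem isGluing_inv (i : I) : IsGluing (X.φ i)⁻¹ (X.center (X.inv i)) (X.radius (X.inv i))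
    (X.center i) (X.radius i) := by
  have := X.isGluing (X.inv i)
  rwa [X.inv_inv, X.φ_inv] at this

/-- The pull-back of half-forms from `∂ K i'` to `∂ K i`. -/
def pull (i : I) : X.L2 (X.inv i) ≃ₗᵢ[ℂ] X.L2 i := (X.isGluing i).pullback (X.isGluing_inv i)

theorem coeFn_pull (i : I) (f : X.L2 (X.inv i)) :
    (X.pull i f : ℂ → ℂ) =ᵐ[X.arc i] halfFormPullback (X.φ i) f :=
  (X.isGluing i).coeFn_pullback (X.isGluing_inv i) f

theorem swapsHardy_pull (i : I) : SwapsHardy (X.pull i) :=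
  (X.isGluing i).swapsHardy_pullback (X.isGluing_inv i)

theorem one_lt_exp : 1 < Real.exp (2 * X.ε) :=
  Real.one_lt_exp_iff.2 (mul_pos two_pos X.ε_pos)

theorem isOpen_annulus (i : I) : IsOpen (X.annulus i) := by
  have h1 := continuous_num (X.φ i)
  have h2 := continuous_den (X.φ i)
  have h3 : Continuous fun z => ‖z - X.center i‖ := by fun_prop
  have h4 : Continuous fun z => ‖num (X.φ i) z - X.center (X.inv i) * den (X.φ i) z‖ := by fun_prop
  have h5 : Continuous fun z => Real.exp (2 * X.ε) * X.radius (X.inv i) * ‖den (X.φ i) z‖ := by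
    fun_prop
  exact (isOpen_lt h3 continuous_const).inter (isOpen_lt h4 h5)

theorem sphere_subset_annulus (i : I) : sphere (X.center i) (X.radius i) ⊆ X.annulus i := by
  intro z hz
  have h1 := (X.isGluing i).norm_eq hz
  have h2 := norm_pos_iff.2 ((X.isGluing i).den_ne_zero_of_mem_sphere hz)
  have h3 := X.one_lt_exp
  have h4 := X.radius_pos i
  have h5 := X.radius_pos (X.inv i)
  refine ⟨?_, ?_⟩
  · rw [mem_sphere_iff_norm.1 hz]
    nlinarith
  · rw [h1]
    have : 0 < X.radius (X.inv i) * ‖den (X.φ i) z‖ := by positivity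
    nlinarith

theorem blockGraph_eq (i : I)
    (P : (X.Plus i × X.Plus (X.inv i)) →L[ℂ] (X.Minus i × X.Minus (X.inv i))) :
    X.blockGraph i P = operatorGraph P := rfl

namespace Bundle

variable {X} (L M : X.Bundle)

theorem continuousOn_sphere (i : I) : ContinuousOn (L.ψ i) (sphere (X.center i) (X.radius i)) :=
  (L.holomorphic i).continuousOn.mono (X.sphere_subset_annulus i)

/-- The representative G in the gluing condition may be taken to be g itself, since the pull-back
respects equality almost everywhere. The condition becomes the operator equation S g = ψ f. -/
theorem gluingSpace_eq (i : I) :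
    L.gluingSpace i = intertwiner (X.pull i) (mulOp (X.center i) (X.radius i) (L.ψ i)) := by
  have h := coeFn_mulOp (X.radius_pos i) (L.continuousOn_sphere i)
  ext ⟨f, g⟩
  rw [mem_intertwiner]
  change (∃ G : ℂ → ℂ, (g : ℂ → ℂ) =ᵐ[X.arc (X.inv i)] G ∧
    (fun z => L.ψ i z * (f : ℂ → ℂ) z) =ᵐ[X.arc i] halfFormPullback (X.φ i) G) ↔ X.pull i g = _
  constructor
  · rintro ⟨G, hG, hG'⟩
    refine Lp.ext ?_
    exact (X.coeFn_pull i g).trans (((X.isGluing i).halfFormPullback_congr hG).trans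
      (hG'.symm.trans (h f).symm))
  · intro e
    refine ⟨g, EventuallyEq.rfl, ?_⟩
    have := X.coeFn_pull i g
    rw [e] at this
    exact (h f).symm.trans this

theorem exists_factorization (i : I) : ∃ k : ℤ, L.index i = k ∧
      ∃ U V : ℂ → ℂ, DiffContOnCl ℂ U (ball 0 1) ∧ DiffContOnCl ℂ V (ball 0 1) ∧
        (∀ s, U s ≠ 0) ∧ (∀ s, V s ≠ 0) ∧
        ∀ z ∈ sphere (X.center i) (X.radius i), L.ψ i z =
          ((z - X.center i) / X.radius i) ^ k * U ((z - X.center i) / X.radius i) *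
            V (X.radius i / (z - X.center i)) :=
  SchottkyModel.exists_factorization (X.radius_pos i) (X.isOpen_annulus i) (X.sphere_subset_annulus i)
    (L.holomorphic i) (L.ne_zero i)

/-- A proof of the Hilbert–Schmidt property has to supply blocks for all indices, including those
where ψ has nonzero index. -/
theorem exists_isGluingBlock (i : I) : ∃ P, L.IsGluingBlock i P := by
  obtain ⟨k, hk, U, V, hU, hV, hU0, hV0, hψ⟩ := L.exists_factorization i
  obtain ⟨P, h1, h2⟩ := exists_operatorGraph_mulOp (X.radius_pos i) (X.radius_pos (X.inv i))
    (X.swapsHardy_pull i) hU (fun s _ => hU0 s) hV (fun s _ => hV0 s) hψ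
  refine ⟨P, fun h => ?_, fun _ => ?_⟩
  · rw [X.blockGraph_eq, L.gluingSpace_eq]
    refine h2 ?_
    rw [hk] at h
    exact_mod_cast h
  · rw [X.blockGraph_eq, L.gluingSpace_eq]
    exact h1

theorem differentiableAt_of_mem_sphere {i : I} {z : ℂ} (hz : z ∈ sphere (X.center i) (X.radius i)) :
    DifferentiableAt ℂ (L.ψ i) z :=
  (L.holomorphic i).differentiableAt ((X.isOpen_annulus i).mem_nhds (X.sphere_subset_annulus i hz))

theorem ne_zero_of_mem_sphere {i : I} {z : ℂ} (hz : z ∈ sphere (X.center i) (X.radius i)) :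
    L.ψ i z ≠ 0 :=
  L.ne_zero i z (X.sphere_subset_annulus i hz)

theorem circleIntegrable_logDeriv (i : I) :
    CircleIntegrable (logDeriv (L.ψ i)) (X.center i) (X.radius i) := by
  refine ContinuousOn.circleIntegrable (X.radius_pos i).le ?_
  exact ((((L.holomorphic i).deriv (X.isOpen_annulus i)).continuousOn).div
    (L.holomorphic i).continuousOn (L.ne_zero i)).mono (X.sphere_subset_annulus i)

theorem index_tensor (i : I) : (L.tensor M).index i = L.index i + M.index i := by
  have : ∀ z ∈ sphere (X.center i) (X.radius i), logDeriv ((L.tensor M).ψ i) z =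
      logDeriv (L.ψ i) z + logDeriv (M.ψ i) z := fun z hz =>
    logDeriv_mul z (L.ne_zero_of_mem_sphere hz) (M.ne_zero_of_mem_sphere hz)
      (L.differentiableAt_of_mem_sphere hz) (M.differentiableAt_of_mem_sphere hz)
  rw [index, circleIntegral.integral_congr (X.radius_pos i).le this, circleIntegral.integral_add
    (L.circleIntegrable_logDeriv i) (M.circleIntegrable_logDeriv i), mul_add]
  rfl

theorem index_pow (n : ℤ) (i : I) : (L.pow n).index i = n * L.index i := by
  have : ∀ z ∈ sphere (X.center i) (X.radius i), logDeriv ((L.pow n).ψ i) z =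
      n * logDeriv (L.ψ i) z := fun z hz =>
    logDeriv_fun_zpow (L.differentiableAt_of_mem_sphere hz) n
  rw [index, circleIntegral.integral_congr (X.radius_pos i).le this,
    circleIntegral.integral_const_mul, mul_left_comm]
  rfl

theorem index_eq_zero_of_const {i : I} {a : ℂ} (h : ∀ z ∈ X.annulus i, L.ψ i z = a) :
    L.index i = 0 := by
  have : ∀ z ∈ sphere (X.center i) (X.radius i), logDeriv (L.ψ i) z = 0 := fun z hz => by
    have h1 : L.ψ i =ᶠ[nhds z] fun _ => a :=
      ((X.isOpen_annulus i).eventually_mem (X.sphere_subset_annulus i hz)).mono h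
    rw [logDeriv_apply, h1.deriv_eq, deriv_const, zero_div]
  rw [index, circleIntegral.integral_congr (X.radius_pos i).le this]
  simp [circleIntegral]

end Bundle

end SchottkyCurve

/-! ### Hilbert–Schmidt operators and the monomial basis of L₂⁻. -/

namespace SchottkyModel

section HilbertSchmidt

theorem summable_norm_sq_iff {ι : Type*} {E : ι → Type*} [∀ i, NormedAddCommGroup (E i)]
    {f : ∀ i, E i} :
    (Summable fun i => ‖f i‖ ^ 2) ↔ ∑' i, ‖f i‖ₑ ^ 2 ≠ ∞ := by
  have h1 : ∀ i, ‖f i‖ₑ ^ 2 = ((‖f i‖₊ ^ 2 : NNReal) : ℝ≥0∞) := fun i => by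
    rw [ENNReal.coe_pow]; rfl
  simp only [h1]
  rw [ENNReal.tsum_coe_ne_top_iff_summable, ← NNReal.summable_coe]
  simp

theorem lp_enorm_sq {ι : Type*} {F : ι → Type*} [∀ i, NormedAddCommGroup (F i)] (f : lp F 2) :
    ‖f‖ₑ ^ 2 = ∑' i, ‖f i‖ₑ ^ 2 := by
  have h := lp.hasSum_norm (p := 2) (by norm_num) f
  simp only [ENNReal.toReal_ofNat, Real.rpow_ofNat] at h
  have h1 := congrArg ENNReal.ofReal h.tsum_eq
  rw [ENNReal.ofReal_tsum_of_nonneg (fun _ => by positivity) h.summable] at h1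
  have h2 : ∀ i, ENNReal.ofReal (‖f i‖ ^ 2) = ‖f i‖ₑ ^ 2 := fun i => by
    rw [ENNReal.ofReal_pow (norm_nonneg _), ofReal_norm]
  simp only [h2] at h1
  rw [h1, ENNReal.ofReal_pow (norm_nonneg _), ofReal_norm]

variable {E F : Type*} [NormedAddCommGroup E] [InnerProductSpace ℂ E] [NormedAddCommGroup F]
  [InnerProductSpace ℂ F]

theorem tsum_enorm_inner_sq {ι : Type*} (b : HilbertBasis ι ℂ E) (x : E) :
    ∑' i, ‖inner ℂ (b i) x‖ₑ ^ 2 = ‖x‖ₑ ^ 2 := by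
  have h1 : ‖b.repr x‖ₑ = ‖x‖ₑ := by
    rw [← ofReal_norm, ← ofReal_norm, b.repr.norm_map]
  rw [← h1, lp_enorm_sq]
  simp only [b.repr_apply_apply]

/-- Both sides are the double sum of |⟨A b_i, c_k⟩|². The right-hand side does not involve b, which
gives independence of the basis. -/
theorem tsum_enorm_apply_sq_eq_adjoint [CompleteSpace E] [CompleteSpace F] {ι κ : Type*}
    (b : HilbertBasis ι ℂ E) (c : HilbertBasis κ ℂ F) (A : E →L[ℂ] F) :
    ∑' i, ‖A (b i)‖ₑ ^ 2 = ∑' k, ‖A.adjoint (c k)‖ₑ ^ 2 := by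
  simp only [← tsum_enorm_inner_sq c (A _)]
  rw [ENNReal.tsum_comm]
  refine tsum_congr fun k => ?_
  rw [← tsum_enorm_inner_sq b (A.adjoint (c k))]
  refine tsum_congr fun i => ?_
  rw [ContinuousLinearMap.adjoint_inner_right, ← ofReal_norm, ← ofReal_norm, norm_inner_symm]

/-- The Hilbert–Schmidt norm does not depend on the orthonormal basis. -/
theorem tsum_enorm_apply_sq_eq [CompleteSpace E] [CompleteSpace F] {ι ι' : Type*}
    (b : HilbertBasis ι ℂ E) (b' : HilbertBasis ι' ℂ E) (A : E →L[ℂ] F) :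
    ∑' i, ‖A (b i)‖ₑ ^ 2 = ∑' i, ‖A (b' i)‖ₑ ^ 2 := by
  obtain ⟨w, c, -⟩ := exists_hilbertBasis ℂ F
  rw [tsum_enorm_apply_sq_eq_adjoint b c, tsum_enorm_apply_sq_eq_adjoint b' c]

/-- The operator norm is at most the Hilbert–Schmidt norm: x/‖x‖ is a member of some orthonormal
basis, and the sum does not depend on the basis. -/
theorem enorm_apply_sq_le [CompleteSpace E] [CompleteSpace F] {ι : Type*} (b : HilbertBasis ι ℂ E)
    (A : E →L[ℂ] F) (x : E) : ‖A x‖ₑ ^ 2 ≤ (∑' i, ‖A (b i)‖ₑ ^ 2) * ‖x‖ₑ ^ 2 := by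
  rcases eq_or_ne x 0 with rfl | hx
  · simp
  have hx' : ‖x‖ ≠ 0 := norm_ne_zero_iff.2 hx
  set y : E := ((‖x‖ : ℂ)⁻¹) • x with hy
  have hy1 : ‖y‖ = 1 := by
    rw [hy, norm_smul, norm_inv, Complex.norm_real, norm_norm, inv_mul_cancel₀ hx']
  have hon : Orthonormal ℂ ((↑) : ({y} : Set E) → E) := by
    refine ⟨?_, ?_⟩
    · rintro ⟨z, hz⟩
      rw [mem_singleton_iff] at hz
      subst hz
      exact hy1
    · rintro ⟨z, hz⟩ ⟨z', hz'⟩ hne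
      rw [mem_singleton_iff] at hz hz'
      exact absurd (Subtype.ext (hz.trans hz'.symm)) hne
  obtain ⟨w, b', hw, hb'⟩ := hon.exists_hilbertBasis_extension
  have hxy : x = (‖x‖ : ℂ) • y := by
    rw [hy, smul_smul, mul_inv_cancel₀ (by exact_mod_cast hx'), one_smul]
  have h1 : ‖A y‖ₑ ^ 2 ≤ ∑' i, ‖A (b i)‖ₑ ^ 2 := by
    rw [tsum_enorm_apply_sq_eq b b' A]
    have h2 := ENNReal.le_tsum (f := fun i => ‖A (b' i)‖ₑ ^ 2) ⟨y, hw rfl⟩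
    simpa [hb'] using h2
  have h3 : ‖A x‖ₑ ^ 2 = ‖A y‖ₑ ^ 2 * ‖x‖ₑ ^ 2 := by
    conv_lhs => rw [hxy, map_smul, enorm_smul, mul_pow]
    rw [mul_comm]
    congr 2
    rw [← ofReal_norm, ← ofReal_norm, Complex.norm_real, norm_norm]
  rw [h3]
  gcongr

theorem isHilbertSchmidtOperator_iff [CompleteSpace E] [CompleteSpace F] {ι : Type*}
    (b : HilbertBasis ι ℂ E) (A : E →L[ℂ] F) :
    IsHilbertSchmidtOperator A ↔ ∑' i, ‖A (b i)‖ₑ ^ 2 ≠ ∞ := by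
  constructor
  · rintro ⟨w, b', h⟩
    rw [summable_norm_sq_iff, tsum_enorm_apply_sq_eq b' b] at h
    exact h
  · intro h
    obtain ⟨w, b', -⟩ := exists_hilbertBasis ℂ E
    exact ⟨w, b', by rwa [summable_norm_sq_iff, tsum_enorm_apply_sq_eq b' b]⟩

/-- A family of operators with a finite total Hilbert–Schmidt norm gives a Hilbert–Schmidt operator to
the Hilbert sum. -/
theorem exists_isHilbertSchmidtOperator_lp {κ ι : Type*} {G : κ → Type*}
    [∀ k, NormedAddCommGroup (G k)] [∀ k, InnerProductSpace ℂ (G k)] [∀ k, CompleteSpace (G k)]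
    [CompleteSpace E] (b : HilbertBasis ι ℂ E) (S : ∀ k, E →L[ℂ] G k)
    (h : ∑' k, ∑' i, ‖S k (b i)‖ₑ ^ 2 ≠ ∞) :
    ∃ T : E →L[ℂ] lp G 2, IsHilbertSchmidtOperator T ∧ ∀ x k, T x k = S k x := by
  set C := ∑' k, ∑' i, ‖S k (b i)‖ₑ ^ 2 with hC
  have hle : ∀ x, ∑' k, ‖S k x‖ₑ ^ 2 ≤ C * ‖x‖ₑ ^ 2 := fun x => by
    rw [hC, ← ENNReal.tsum_mul_right]
    exact ENNReal.tsum_le_tsum fun k => enorm_apply_sq_le b (S k) x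
  have hmem : ∀ x, Memℓp (fun k => S k x) 2 := fun x => by
    refine memℓp_gen ?_
    simp only [ENNReal.toReal_ofNat, Real.rpow_ofNat]
    rw [summable_norm_sq_iff]
    exact ne_top_of_le_ne_top (ENNReal.mul_ne_top h (by simp)) (hle x)
  let T₀ : E →ₗ[ℂ] lp G 2 :=
    { toFun := fun x => ⟨fun k => S k x, hmem x⟩
      map_add' := fun x y => by
        refine lp.ext (funext fun k => ?_)
        exact map_add (S k) x y
      map_smul' := fun a x => by
        refine lp.ext (funext fun k => ?_)
        exact map_smul (S k) a x }
  have hT₀ : ∀ x k, T₀ x k = S k x := fun x k => rfl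
  have hbd : ∀ x, ‖T₀ x‖ ≤ Real.sqrt C.toReal * ‖x‖ := fun x => by
    have h1 : ‖T₀ x‖ₑ ^ 2 ≤ C * ‖x‖ₑ ^ 2 := by
      rw [lp_enorm_sq]
      simp only [hT₀]
      exact hle x
    have h2 := ENNReal.toReal_mono (ENNReal.mul_ne_top h (by simp)) h1
    rw [ENNReal.toReal_mul, ENNReal.toReal_pow, ENNReal.toReal_pow, toReal_enorm, toReal_enorm] at h2
    refine (pow_le_pow_iff_left₀ (norm_nonneg _) (by positivity) two_ne_zero).1 ?_
    rw [mul_pow, Real.sq_sqrt ENNReal.toReal_nonneg]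
    exact h2
  refine ⟨T₀.mkContinuous _ hbd, ?_, fun x k => rfl⟩
  rw [isHilbertSchmidtOperator_iff b]
  have : ∀ i, ‖T₀.mkContinuous _ hbd (b i)‖ₑ ^ 2 = ∑' k, ‖S k (b i)‖ₑ ^ 2 := fun i => by
    rw [lp_enorm_sq]
    rfl
  simp only [this]
  rwa [ENNReal.tsum_comm]

end HilbertSchmidt

section MonomialBasis

open Complex

variable {c : ℂ} {r : ℝ}

/-- The factor that normalizes `(z - c) ^ (-m - 1) dz^{1/2}` on a circle. -/
def monomialScale (r : ℝ) (m : ℕ) : ℝ := (Real.sqrt (2 * Real.pi * r))⁻¹ * r ^ (m + 1)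

/-- The orthonormal basis of `L₂⁻` of a circle. -/
def minusVector (c : ℂ) (r : ℝ) (m : ℕ) : hardyMinus c r :=
  (monomialScale r m : ℂ) • ⟨monomial c r (-(m : ℤ) - 1), monomial_mem_hardyMinus m⟩

theorem coe_minusVector (m : ℕ) : (minusVector c r m : CircleL2 c r) =
    (monomialScale r m : ℂ) • monomial c r (-(m : ℤ) - 1) := rfl

theorem orthonormal_minusVector (hr : 0 < r) : Orthonormal ℂ (minusVector c r) := by
  have hr0 : (r : ℂ) ≠ 0 := by exact_mod_cast hr.ne'
  rw [orthonormal_iff_ite]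
  intro i j
  rw [Submodule.coe_inner, coe_minusVector, coe_minusVector, inner_smul_left, inner_smul_right]
  split_ifs with hij
  · subst hij
    rw [norm_monomial_sq hr, conj_ofReal, monomialScale]
    have h1 : ((Real.sqrt (2 * Real.pi * r) : ℝ) : ℂ) ^ 2 = 2 * Real.pi * r := by
      rw [← ofReal_pow, Real.sq_sqrt (by positivity)]
      push_cast; rfl
    have h2 : ((Real.sqrt (2 * Real.pi * r) : ℝ) : ℂ) ≠ 0 := by
      have : 0 < Real.sqrt (2 * Real.pi * r) := Real.sqrt_pos.2 (by positivity)
      exact_mod_cast this.ne'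
    have h3 : (2 * (-(i : ℤ) - 1) + 1) = -((2 * i + 1 : ℕ) : ℤ) := by push_cast; ring
    rw [h3, zpow_neg, zpow_natCast]
    push_cast
    field_simp
    rw [h1]
    ring
  · rw [inner_monomial_monomial hr (by lia), mul_zero, mul_zero]

theorem eq_zero_of_inner_minusVector (hr : 0 < r) {f : hardyMinus c r}
    (h : ∀ m, inner ℂ (minusVector c r m) f = 0) : f = 0 := by
  refine Subtype.ext (eq_zero_of_inner_monomial hr fun n => ?_)
  rcases le_or_gt 0 n with hn | hn
  · obtain ⟨k, rfl⟩ := Int.eq_ofNat_of_zero_le hn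
    exact inner_eq_zero_of_mem_hardyMinus hr f.2 k
  · obtain ⟨m, rfl⟩ : ∃ m : ℕ, n = -(m : ℤ) - 1 := ⟨(-n - 1).toNat, by lia⟩
    have := h m
    rw [Submodule.coe_inner, coe_minusVector, inner_smul_left] at this
    refine (mul_eq_zero.1 this).resolve_left ?_
    rw [conj_ofReal, monomialScale]
    have : 0 < Real.sqrt (2 * Real.pi * r) := Real.sqrt_pos.2 (by positivity)
    exact_mod_cast (by positivity : (Real.sqrt (2 * Real.pi * r))⁻¹ * r ^ (m + 1) ≠ 0)

end MonomialBasis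

end SchottkyModel

/-! ### The monomial basis of ℋ⁻ and uniqueness of the Hilbert operator. -/

namespace SchottkyCurve

variable {I : Type*} (X : SchottkyCurve I)

open scoped Classical in
/-- The vectors of the monomial basis of `ℋ⁻`. -/
def basisVector (p : I × ℕ) : X.HMinus :=
  lp.single 2 p.1 (minusVector (X.center p.1) (X.radius p.1) p.2)

theorem orthonormal_basisVector : Orthonormal ℂ X.basisVector := by
  classical
  rw [orthonormal_iff_ite]
  rintro ⟨i, m⟩ ⟨j, n⟩
  rw [basisVector, basisVector, lp.inner_single_left]
  have h := orthonormal_iff_ite.1 (orthonormal_minusVector (c := X.center j) (X.radius_pos j)) m n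
  by_cases hij : i = j
  · subst hij
    simp only [lp.single_apply_self, Prod.mk.injEq, true_and]
    exact h
  · rw [lp.single_apply_ne _ _ _ hij, inner_zero_right, if_neg]
    simp [hij]

theorem orthogonal_span_basisVector : (Submodule.span ℂ (range X.basisVector))ᗮ = ⊥ := by
  classical
  rw [Submodule.eq_bot_iff]
  intro x hx
  refine lp.ext (funext fun j => ?_)
  refine eq_zero_of_inner_minusVector (X.radius_pos j) fun m => ?_
  have := (Submodule.mem_orthogonal _ _).1 hx (X.basisVector (j, m)) (Submodule.subset_span ⟨_, rfl⟩)
  rw [basisVector, lp.inner_single_left] at this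
  exact this

/-- The monomial basis of `ℋ⁻`. -/
def basis : HilbertBasis (I × ℕ) ℂ X.HMinus :=
  HilbertBasis.mkOfOrthogonalEqBot X.orthonormal_basisVector X.orthogonal_span_basisVector

theorem basis_apply (p : I × ℕ) : X.basis p = X.basisVector p := by
  rw [basis, HilbertBasis.coe_mkOfOrthogonalEqBot]

/-- The Hilbert operator is unique. -/
theorem isHilbertOperator_unique {K K' : X.HMinus →L[ℂ] X.HPlus} (h : X.IsHilbertOperator K)
    (h' : X.IsHilbertOperator K') : K = K' := by
  classical
  refine ContinuousLinearMap.ext_on (s := range X.basisVector) ?_ ?_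
  · have := X.basis.dense_span
    rw [show ⇑X.basis = X.basisVector from funext X.basis_apply] at this
    rw [← Submodule.dense_iff_topologicalClosure_eq_top] at this
    exact this
  · rintro _ ⟨⟨j, m⟩, rfl⟩
    refine lp.ext (funext fun i => ?_)
    have h1 := h j (minusVector (X.center j) (X.radius j) m)
    have h2 := h' j (minusVector (X.center j) (X.radius j) m)
    by_cases hij : i = j
    · subst hij
      have e1 : K (X.basisVector (i, m)) i = 0 := by
        rw [← h1.1, basisVector]
      have e2 : K' (X.basisVector (i, m)) i = 0 := by
        rw [← h2.1, basisVector]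
      rw [e1, e2]
    · refine Subtype.ext (Lp.ext ?_)
      have e1 := (h1.2 i hij).trans (h2.2 i hij).symm
      rw [basisVector]
      convert e1

end SchottkyCurve

/-! ### Pairings with basis vectors and their Parseval identity. -/

namespace SchottkyModel

open Complex

variable {c c' : ℂ} {r r' : ℝ}

/-- The factor that turns Fourier coefficients into pairings with `minusVector`. -/
def pairScale (r : ℝ) : ℝ := r / (2 * Real.pi * Real.sqrt (2 * Real.pi * r))

/-- The pairing `(2 π i)⁻¹ ∮ e t dζ` with the vector `e` number `m` of the basis of `L₂⁻`. -/
def pairing (c : ℂ) (r : ℝ) (m : ℕ) (t : ℂ → ℂ) : ℂ := pairScale r * circleCoeff c r t m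

/-- The factor e^{iθ} of dζ shifts (ζ − c)^(−m−1) to the mode e^{−imθ}, so the integral against the
m-th basis vector reads off the m-th Fourier coefficient of t. -/
theorem circleIntegral_minusVector (hr : 0 < r) (m : ℕ) (t : ℂ → ℂ) :
    (2 * Real.pi * I)⁻¹ * ∮ ζ in C(c, r), ((minusVector c r m : CircleL2 c r) : ℂ → ℂ) ζ * t ζ =
      pairing c r m t := by
  have h0 : (minusVector c r m : ℂ → ℂ) =ᵐ[arcLength c r]
      fun z => monomialScale r m * (z - c) ^ (-(m : ℤ) - 1) := by
    rw [coe_minusVector]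
    filter_upwards [Lp.coeFn_smul (monomialScale r m : ℂ) (monomial c r (-(m : ℤ) - 1)),
      coeFn_monomial (c := c) (r := r) (-(m : ℤ) - 1)] with z h1 h2
    rw [h1, Pi.smul_apply, h2, smul_eq_mul]
  have hr0 : (r : ℂ) ≠ 0 := by exact_mod_cast hr.ne'
  have hs : (Real.sqrt (2 * Real.pi * r) : ℂ) ≠ 0 := by
    have : 0 < Real.sqrt (2 * Real.pi * r) := Real.sqrt_pos.2 (by positivity)
    exact_mod_cast this.ne'
  rw [pairing, circleCoeff, circleIntegral, ← intervalIntegral.integral_const_mul,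
    ← intervalIntegral.integral_const_mul, intervalIntegral.integral_of_le (by positivity),
    intervalIntegral.integral_of_le (by positivity)]
  refine integral_congr_ae ?_
  filter_upwards [ae_circleMap_of_ae_arcLength hr h0] with θ hθ
  have h1 : (circleMap c r θ - c) ^ (-(m : ℤ) - 1) =
      ((r : ℂ) ^ (m + 1))⁻¹ * (exp (θ * I))⁻¹ * exp (-(((m : ℕ) : ℤ) * θ * I)) := by
    have : exp (-(((m : ℕ) : ℤ) * θ * I)) = (exp (θ * I) ^ m)⁻¹ := by
      rw [← exp_nat_mul, ← exp_neg]
      push_cast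
      ring_nf
    rw [this, circleMap_sub_center, circleMap, zero_add,
      show (-(m : ℤ) - 1) = -((m + 1 : ℕ) : ℤ) by push_cast; ring, zpow_neg, zpow_natCast, mul_pow,
      mul_inv, pow_succ (exp _) m, mul_inv]
    ring
  have h2 : exp (θ * I) ≠ 0 := exp_ne_zero _
  rw [hθ, h1, deriv_circleMap, circleMap, zero_add, smul_eq_mul, monomialScale, pairScale]
  push_cast
  have hπ : (Real.pi : ℂ) ≠ 0 := by exact_mod_cast Real.pi_ne_zero
  field_simp

/-- Pairings see the nonnegative Fourier coefficients only; if the others vanish, Parseval recovers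
the whole norm. The constant is `pairScale r ^ 2` times 2π/r. -/
theorem tsum_enorm_pairing_sq (hr : 0 < r) {t : ℂ → ℂ} (ht : MemLp t 2 (arcLength c r))
    (h : ∀ n : ℕ, circleCoeff c r t (-(n : ℤ) - 1) = 0) :
    ∑' m, ‖pairing c r m t‖ₑ ^ 2 =
      ENNReal.ofReal (4 * Real.pi ^ 2)⁻¹ * ∫⁻ z, ‖t z‖ₑ ^ 2 ∂arcLength c r := by
  have h1 : ∑' n : ℤ, ‖circleCoeff c r t n‖ₑ ^ 2 = ∑' m : ℕ, ‖circleCoeff c r t m‖ₑ ^ 2 := by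
    refine (Function.Injective.tsum_eq Nat.cast_injective ?_).symm
    intro n hn
    rcases le_or_gt 0 n with h0 | h0
    · exact ⟨n.toNat, by simp [h0]⟩
    · exfalso
      refine hn ?_
      have := h (-n - 1).toNat
      rw [show (-(((-n - 1).toNat : ℕ) : ℤ) - 1) = n by lia] at this
      simp [this]
  simp only [pairing, enorm_mul, mul_pow]
  rw [ENNReal.tsum_mul_left, ← h1, tsum_sq_circleCoeff hr ht, ← mul_assoc]
  congr 1
  rw [← ofReal_norm_sq, ← ENNReal.ofReal_mul (by positivity)]
  congr 1
  rw [norm_real, Real.norm_eq_abs, sq_abs, pairScale, div_pow, mul_pow,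
    Real.sq_sqrt (by positivity)]
  field_simp
  ring

theorem continuousOn_circleCoeff (hr : 0 ≤ r) {s : Set ℂ} {k : ℂ → ℂ → ℂ}
    (hk : ContinuousOn (fun p : ℂ × ℂ => k p.1 p.2) (s ×ˢ sphere c r)) (n : ℤ) :
    ContinuousOn (fun z => circleCoeff c r (k z) n) s := by
  rw [continuousOn_iff_continuous_domRestrict]
  refine intervalIntegral.continuous_parametric_intervalIntegral_of_continuous'
    (f := fun (z : s) θ => exp (-(n * θ * I)) * k z (circleMap c r θ)) ?_ 0 (2 * Real.pi)
  have h1 : Continuous fun p : s × ℝ => k p.1 (circleMap c r p.2) := by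
    have : Continuous fun p : s × ℝ => ((p.1 : ℂ), circleMap c r p.2) := by fun_prop
    exact hk.comp_continuous this fun p => ⟨p.1.2, circleMap_mem_sphere c hr p.2⟩
  refine Continuous.mul ?_ h1
  fun_prop

theorem continuousOn_pairing (hr : 0 ≤ r) {s : Set ℂ} {k : ℂ → ℂ → ℂ}
    (hk : ContinuousOn (fun p : ℂ × ℂ => k p.1 p.2) (s ×ˢ sphere c r)) (m : ℕ) :
    ContinuousOn (fun z => pairing c r m (k z)) s :=
  continuousOn_const.mul (continuousOn_circleCoeff hr hk m)

theorem circleCoeff_circleCoeff_comm (hr : 0 ≤ r) (hr' : 0 ≤ r') {k : ℂ → ℂ → ℂ}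
    (hk : ContinuousOn (fun p : ℂ × ℂ => k p.1 p.2) (sphere c r ×ˢ sphere c' r')) (n n' : ℤ) :
    circleCoeff c r (fun z => circleCoeff c' r' (k z) n') n =
      circleCoeff c' r' (fun ζ => circleCoeff c r (fun z => k z ζ) n) n' := by
  have h1 : Continuous fun p : ℝ × ℝ => k (circleMap c r p.1) (circleMap c' r' p.2) := by
    have : Continuous fun p : ℝ × ℝ => (circleMap c r p.1, circleMap c' r' p.2) := by fun_prop
    exact hk.comp_continuous this fun p =>
      ⟨circleMap_mem_sphere c hr p.1, circleMap_mem_sphere c' hr' p.2⟩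
  simp only [circleCoeff, ← intervalIntegral.integral_const_mul]
  rw [intervalIntegral_intervalIntegral_swap]
  · refine intervalIntegral.integral_congr fun θ _ => ?_
    refine intervalIntegral.integral_congr fun η _ => ?_
    ring
  · have h2 : Continuous (Function.uncurry fun (θ η : ℝ) => exp (-(n * θ * I)) *
        (exp (-(n' * η * I)) * k (circleMap c r θ) (circleMap c' r' η))) := by
      refine Continuous.mul (by fun_prop) (Continuous.mul (by fun_prop) h1)
    exact (h2.continuousOn.integrableOn_compact (isCompact_uIcc.prod isCompact_uIcc)).mono_set
      (prod_mono uIoc_subset_uIcc uIoc_subset_uIcc)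

/-- Fubini. This passes membership in L₂⁺ or L₂⁻ from a kernel with ζ fixed to its integrals over ζ.
-/
theorem circleCoeff_pairing (hr : 0 ≤ r) (hr' : 0 ≤ r') {k : ℂ → ℂ → ℂ}
    (hk : ContinuousOn (fun p : ℂ × ℂ => k p.1 p.2) (sphere c r ×ˢ sphere c' r')) (n : ℤ) (m : ℕ)
    (h : ∀ ζ ∈ sphere c' r', circleCoeff c r (fun z => k z ζ) n = 0) :
    circleCoeff c r (fun z => pairing c' r' m (k z)) n = 0 := by
  have h1 : circleCoeff c r (fun z => pairing c' r' m (k z)) n =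
      pairScale r' * circleCoeff c r (fun z => circleCoeff c' r' (k z) m) n := by
    simp only [circleCoeff, pairing, ← intervalIntegral.integral_const_mul]
    refine intervalIntegral.integral_congr fun θ _ => ?_
    simp only [intervalIntegral.integral_const_mul]
    ring
  rw [h1, circleCoeff_circleCoeff_comm hr hr' hk]
  have : circleCoeff c' r' (fun ζ => circleCoeff c r (fun z => k z ζ) n) m = 0 := by
    rw [circleCoeff]
    simp [fun θ => h _ (circleMap_mem_sphere c' hr' θ)]
  rw [this, mul_zero]

theorem pairing_sub (hr : 0 ≤ r) {f g : ℂ → ℂ} (hf : ContinuousOn f (sphere c r))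
    (hg : ContinuousOn g (sphere c r)) (m : ℕ) :
    pairing c r m (fun z => f z - g z) = pairing c r m f - pairing c r m g := by
  have h : ∀ {f : ℂ → ℂ}, ContinuousOn f (sphere c r) → IntervalIntegrable
      (fun θ : ℝ => exp (-((m : ℤ) * θ * I)) * f (circleMap c r θ)) volume 0 (2 * Real.pi) :=
    fun {f} hf => by
    have h1 : Continuous fun θ => f (circleMap c r θ) :=
      hf.comp_continuous (continuous_circleMap c r) fun θ => circleMap_mem_sphere c hr θ
    refine Continuous.intervalIntegrable ?_ _ _
    exact Continuous.mul (by fun_prop) h1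
  simp only [pairing, circleCoeff, mul_sub]
  rw [intervalIntegral.integral_sub (h hf) (h hg), mul_sub]

theorem pairing_const_mul (a : ℂ) (f : ℂ → ℂ) (m : ℕ) :
    pairing c r m (fun z => a * f z) = a * pairing c r m f := by
  simp only [pairing, circleCoeff, mul_left_comm _ a, intervalIntegral.integral_const_mul]

end SchottkyModel

namespace SchottkyModel

open Complex

variable {c c' c₂ : ℂ} {r r' r₂ : ℝ}

/-- The values of a gluing block with an explicit factorization on pairs of boundary values of
integrals with given kernels. -/
theorem apply_pairing (hr : 0 < r) (hr' : 0 < r') (hr₂ : 0 < r₂)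
    {S : CircleL2 c' r' ≃ₗᵢ[ℂ] CircleL2 c r} (hS : SwapsHardy S) {ψ U V : ℂ → ℂ}
    (hU : DiffContOnCl ℂ U (ball 0 1)) (hU0 : ∀ s, U s ≠ 0)
    (hV : DiffContOnCl ℂ V (ball 0 1)) (hV0 : ∀ s, V s ≠ 0)
    (hψ : ∀ z ∈ sphere c r, ψ z = U ((z - c) / r) * V (r / (z - c)))
    {P : (hardyPlus c r × hardyPlus c' r') →L[ℂ] (hardyMinus c r × hardyMinus c' r')}
    (hP : operatorGraph P = intertwiner S (mulOp c r ψ)) {A B D : ℂ → ℂ → ℂ}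
    (hA : ContinuousOn (fun p : ℂ × ℂ => A p.1 p.2) (sphere c r ×ˢ sphere c₂ r₂))
    (hB : ContinuousOn (fun p : ℂ × ℂ => B p.1 p.2) (sphere c r ×ˢ sphere c₂ r₂))
    (hD : ContinuousOn (fun p : ℂ × ℂ => D p.1 p.2) (sphere c r ×ˢ sphere c₂ r₂))
    (hAB : ∀ ζ ∈ sphere c₂ r₂, ∀ n : ℕ,
      circleCoeff c r (fun z => A z ζ - V (r / (z - c)) * B z ζ) n = 0)
    (hAD : ∀ ζ ∈ sphere c₂ r₂, ∀ n : ℕ,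
      circleCoeff c r (fun z => A z ζ - (U ((z - c) / r))⁻¹ * D z ζ) (-(n : ℤ) - 1) = 0)
    (m : ℕ) {x : hardyPlus c r} {y : hardyPlus c' r'}
    (hx : (x : CircleL2 c r) =ᵐ[arcLength c r] fun z => pairing c₂ r₂ m (B z))
    (hy : S y =ᵐ[arcLength c r] fun z => pairing c₂ r₂ m (D z)) :
    (((P (x, y)).1 : CircleL2 c r) =ᵐ[arcLength c r] fun z =>
      pairing c₂ r₂ m fun ζ => (V (r / (z - c)))⁻¹ * A z ζ - B z ζ) ∧
    (S (P (x, y)).2 =ᵐ[arcLength c r] fun z =>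
      pairing c₂ r₂ m fun ζ => U ((z - c) / r) * A z ζ - D z ζ) := by
  have hUi : DiffContOnCl ℂ U⁻¹ (ball 0 1) := hU.inv fun s _ => hU0 s
  have hVi : DiffContOnCl ℂ V⁻¹ (ball 0 1) := hV.inv fun s _ => hV0 s
  have cU := continuousOn_inside (c := c) hr hU
  have cV := continuousOn_outside (c := c) hr hV
  have cUi : ContinuousOn (fun z => (U ((z - c) / r))⁻¹) (sphere c r) := continuousOn_inside hr hUi
  have cVi : ContinuousOn (fun z => (V (r / (z - c)))⁻¹) (sphere c r) := continuousOn_outside hr hVi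
  have slice : ∀ {k : ℂ → ℂ → ℂ},
      ContinuousOn (fun p : ℂ × ℂ => k p.1 p.2) (sphere c r ×ˢ sphere c₂ r₂) →
      ∀ z ∈ sphere c r, ContinuousOn (k z) (sphere c₂ r₂) := fun {k} hk z hz =>
    hk.comp (f := fun ζ => (z, ζ)) (by fun_prop) fun ζ hζ => ⟨hz, hζ⟩
  have fst : ∀ {u : ℂ → ℂ}, ContinuousOn u (sphere c r) →
      ContinuousOn (fun p : ℂ × ℂ => u p.1) (sphere c r ×ˢ sphere c₂ r₂) := fun {u} hu =>
    hu.comp (f := Prod.fst) (by fun_prop) fun p hp => hp.1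
  have cb := continuousOn_pairing hr₂.le hA m
  have hb : MemLp (fun z => pairing c₂ r₂ m (A z)) 2 (arcLength c r) :=
    memLp_arcLength_of_continuousOn hr.le cb
  -- With f = b/V and S g = U b the gluing condition S g = U V f is automatic. It remains that f − x
  -- and g − y are in L₂⁻, i.e. that b − V x is in L₂⁻ and b − U⁻¹ S y is in L₂⁺, and this is what
  -- the hypotheses on the kernels say.
  set b : CircleL2 c r := hb.toLp _ with hbdef
  have eb := hb.coeFn_toLp
  rw [← hbdef] at eb
  set f := mulOp c r (fun z => (V (r / (z - c)))⁻¹) b with hf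
  set g := S.symm (mulOp c r (fun z => U ((z - c) / r)) b) with hg
  have hfg : (f, g) ∈ operatorGraph P := by
    rw [hP, mem_intertwiner]
    change S g = mulOp c r ψ f
    rw [hg, S.apply_symm_apply, hf]
    refine (mulOp_mulOp hr ((cU.mul cV).congr hψ) cVi (fun z hz => ?_) b).symm
    rw [hψ z hz, mul_inv_cancel_right₀ (hV0 _)]
  have hVx : b - mulOp c r (fun z => V (r / (z - c))) x ∈ hardyMinus c r := by
    rw [mem_hardyMinus_iff hr]
    intro n
    have hc := hA.sub ((fst cV).mul hB)
    rw [← circleCoeff_pairing hr.le hr₂.le (k := fun z ζ => A z ζ - V (r / (z - c)) * B z ζ) hc n m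
      fun ζ hζ => hAB ζ hζ n]
    refine circleCoeff_congr_ae hr ?_ _
    filter_upwards [Lp.coeFn_sub b (mulOp c r (fun z => V (r / (z - c))) x), eb, hx,
      coeFn_mulOp hr cV x, ae_arcLength_of_forall_mem_sphere hr.le (p := (· ∈ sphere c r))
        fun z hz => hz] with z h1 h2 h3 h4 h5
    rw [h1, Pi.sub_apply, h2, h4, h3, ← pairing_const_mul]
    exact (pairing_sub hr₂.le (slice hA z h5) (continuousOn_const.mul (slice hB z h5)) m).symm
  have hUy : b - mulOp c r (fun z => (U ((z - c) / r))⁻¹) (S y) ∈ hardyPlus c r := by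
    rw [mem_hardyPlus_iff hr]
    intro n
    have hc := hA.sub ((fst cUi).mul hD)
    rw [← circleCoeff_pairing hr.le hr₂.le (k := fun z ζ => A z ζ - (U ((z - c) / r))⁻¹ * D z ζ) hc
      (-(n : ℤ) - 1) m fun ζ hζ => hAD ζ hζ n]
    refine circleCoeff_congr_ae hr ?_ _
    filter_upwards [Lp.coeFn_sub b (mulOp c r (fun z => (U ((z - c) / r))⁻¹) (S y)), eb, hy,
      coeFn_mulOp hr cUi (S y), ae_arcLength_of_forall_mem_sphere hr.le (p := (· ∈ sphere c r))
        fun z hz => hz] with z h1 h2 h3 h4 h5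
    rw [h1, Pi.sub_apply, h2, h4, h3, ← pairing_const_mul]
    exact (pairing_sub hr₂.le (slice hA z h5) (continuousOn_const.mul (slice hD z h5)) m).symm
  have h1 : f - x ∈ hardyMinus c r := by
    have h := mulOp_mem_hardyMinus hr hVi hVx
    rw [map_sub] at h
    have e : mulOp c r (fun z => V⁻¹ (r / (z - c))) (mulOp c r (fun z => V (r / (z - c))) x) = x :=
      mulOp_mulOp_cancel hr cVi cV (fun z _ => inv_mul_cancel₀ (hV0 _)) x
    rwa [e] at h
  have h2 : g - y ∈ hardyMinus c' r' := by
    have h := hS.symm_plus _ (mulOp_mem_hardyPlus hr hU hUy)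
    rw [map_sub] at h
    rwa [mulOp_mulOp_cancel hr cU cUi (fun z _ => mul_inv_cancel₀ (hU0 _)), map_sub,
      S.symm_apply_apply] at h
  obtain ⟨e1, e2⟩ := apply_eq_of_mem_operatorGraph hr hr' hfg h1 h2
  constructor
  · rw [e1]
    filter_upwards [Lp.coeFn_sub f x, coeFn_mulOp hr cVi b, eb, hx,
      ae_arcLength_of_forall_mem_sphere hr.le (p := (· ∈ sphere c r)) fun z hz => hz]
      with z h1 h2 h3 h4 h5
    rw [h1, Pi.sub_apply, h4, hf, h2, h3, ← pairing_const_mul]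
    exact (pairing_sub hr₂.le (continuousOn_const.mul (slice hA z h5)) (slice hB z h5) m).symm
  · rw [e2, map_sub, hg, S.apply_symm_apply]
    filter_upwards [Lp.coeFn_sub (mulOp c r (fun z => U ((z - c) / r)) b) (S y),
      coeFn_mulOp hr cU b, eb, hy,
      ae_arcLength_of_forall_mem_sphere hr.le (p := (· ∈ sphere c r)) fun z hz => hz]
      with z h1 h2 h3 h4 h5
    rw [h1, Pi.sub_apply, h4, h2, h3, ← pairing_const_mul]
    exact (pairing_sub hr₂.le (continuousOn_const.mul (slice hA z h5)) (slice hD z h5) m).symm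

theorem enorm_sq_eq_lintegral (f : CircleL2 c r) :
    ‖f‖ₑ ^ 2 = ∫⁻ z, ‖(f : ℂ → ℂ) z‖ₑ ^ 2 ∂arcLength c r := by
  rw [Lp.enorm_def, eLpNorm_eq_lintegral_rpow_enorm_toReal (by norm_num) (by norm_num)]
  simp only [ENNReal.toReal_ofNat, ENNReal.rpow_ofNat, one_div]
  rw [← ENNReal.rpow_natCast, ← ENNReal.rpow_mul]
  simp

/-- Parseval's identity for a family of functions given by integrals of a kernel. -/
theorem tsum_enorm_sq_of_pairing (hr : 0 < r) (hr₂ : 0 < r₂) {k : ℂ → ℂ → ℂ}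
    (hk : ContinuousOn (fun p : ℂ × ℂ => k p.1 p.2) (sphere c r ×ˢ sphere c₂ r₂))
    (h : ∀ z ∈ sphere c r, ∀ n : ℕ, circleCoeff c₂ r₂ (k z) (-(n : ℤ) - 1) = 0)
    {f : ℕ → CircleL2 c r}
    (hf : ∀ m, f m =ᵐ[arcLength c r] fun z => pairing c₂ r₂ m (k z)) :
    ∑' m, ‖f m‖ₑ ^ 2 = ENNReal.ofReal (4 * Real.pi ^ 2)⁻¹ *
      ∫⁻ z, ∫⁻ ζ, ‖k z ζ‖ₑ ^ 2 ∂arcLength c₂ r₂ ∂arcLength c r := by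
  have e : ∀ m, ‖f m‖ₑ ^ 2 = ∫⁻ z, ‖pairing c₂ r₂ m (k z)‖ₑ ^ 2 ∂arcLength c r := fun m => by
    rw [enorm_sq_eq_lintegral]
    refine lintegral_congr_ae ?_
    filter_upwards [hf m] with z hz
    rw [hz]
  simp only [e]
  rw [← lintegral_tsum, ← lintegral_const_mul' _ _ ENNReal.ofReal_ne_top]
  · refine lintegral_congr_ae ?_
    refine ae_arcLength_of_forall_mem_sphere hr.le fun z hz => ?_
    refine tsum_enorm_pairing_sq hr₂ (memLp_arcLength_of_continuousOn hr₂.le ?_) (h z hz)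
    exact hk.comp (f := fun ζ => (z, ζ)) (by fun_prop) fun ζ hζ => ⟨hz, hζ⟩
  · intro m
    exact ((aestronglyMeasurable_arcLength_of_continuousOn hr.le
      (continuousOn_pairing hr₂.le hk m)).enorm).pow_const 2

end SchottkyModel

/-! ### Hardy projections of a Cauchy kernel times a multiplier. -/

namespace SchottkyModel

section CauchyKernel

variable {c : ℂ} {r : ℝ}

theorem diffContOnCl_dslope {F : ℂ → ℂ} (hF : DiffContOnCl ℂ F (ball 0 1)) {ω : ℂ}
    (hω : ω ∈ ball (0 : ℂ) 1) : DiffContOnCl ℂ (dslope F ω) (ball 0 1) := by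
  have h := isOpen_ball.mem_nhds hω
  refine ⟨(Complex.differentiableOn_dslope h).2 hF.differentiableOn, ?_⟩
  refine (continuousOn_dslope (mem_of_superset h subset_closure)).2 ⟨hF.continuousOn, ?_⟩
  exact hF.differentiableOn.differentiableAt h

theorem sub_ne_zero_of_norm_lt (hr : 0 < r) {ζ : ℂ} (hζ : r < ‖ζ - c‖) : ζ - c ≠ 0 :=
  norm_pos_iff.1 (hr.trans hζ)

theorem div_sub_mem_ball (hr : 0 < r) {ζ : ℂ} (hζ : r < ‖ζ - c‖) :
    (r / (ζ - c) : ℂ) ∈ ball (0 : ℂ) 1 := by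
  rw [mem_ball_zero_iff, norm_div, Complex.norm_real, Real.norm_eq_abs, abs_of_pos hr,
    div_lt_one (hr.trans hζ)]
  exact hζ

theorem sub_div_mem_ball (hr : 0 < r) {ξ : ℂ} (hξ : ‖ξ - c‖ < r) :
    ((ξ - c) / r : ℂ) ∈ ball (0 : ℂ) 1 := by
  rw [mem_ball_zero_iff, norm_div, Complex.norm_real, Real.norm_eq_abs, abs_of_pos hr,
    div_lt_one hr]
  exact hξ

theorem circleCoeff_congr (hr : 0 ≤ r) {f g : ℂ → ℂ} (h : ∀ z ∈ sphere c r, f z = g z) (n : ℤ) :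
    circleCoeff c r f n = circleCoeff c r g n := by
  unfold circleCoeff
  refine intervalIntegral.integral_congr fun θ _ => ?_
  simp only [h _ (circleMap_mem_sphere c hr θ)]

/-- The difference quotient of V at r/(ζ − c) removes the pole, and what is left belongs to L₂⁻.
Hence the plus part of V(r/(z − c))/(z − ζ) is the Cauchy kernel with V evaluated at its pole. -/
theorem circleCoeff_outside_mul_cauchy (hr : 0 < r) {V : ℂ → ℂ} (hV : DiffContOnCl ℂ V (ball 0 1))
    {ζ : ℂ} (hζ : r < ‖ζ - c‖) (n : ℕ) :
    circleCoeff c r (fun z => (V (r / (ζ - c)) - V (r / (z - c))) * (z - ζ)⁻¹) n = 0 := by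
  have hr0 : (r : ℂ) ≠ 0 := by exact_mod_cast hr.ne'
  have h0 := sub_ne_zero_of_norm_lt hr hζ
  have hG := (diffContOnCl_dslope hV (div_sub_mem_ball hr hζ)).const_smul (ζ - c)⁻¹
  rw [← circleCoeff_eq_zero_of_outside (c := c) hr hG n]
  refine circleCoeff_congr hr.le (fun z hz => ?_) _
  have h1 := sub_ne_zero_of_mem_sphere hr hz
  have h2 : z - ζ ≠ 0 := by
    intro h
    rw [mem_sphere_iff_norm, sub_eq_zero.1 h] at hz
    exact hζ.ne' hz
  have h3 : r / (z - c) ≠ r / (ζ - c) := by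
    intro h
    rw [div_eq_div_iff h1 h0] at h
    apply h2
    have := mul_left_cancel₀ hr0 h
    linear_combination -this
  simp only [Pi.smul_apply, smul_eq_mul]
  rw [dslope_of_ne _ h3, slope_def_field]
  have h4 : r / (z - c) - r / (ζ - c) = -(r * (z - ζ) / ((z - c) * (ζ - c))) := by
    field_simp
    ring
  rw [h4]
  field_simp
  ring

theorem circleCoeff_cauchy_outside (hr : 0 < r) {ζ : ℂ} (hζ : r < ‖ζ - c‖) (n : ℕ) :
    circleCoeff c r (fun z => (z - ζ)⁻¹) (-(n : ℤ) - 1) = 0 := by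
  have hr0 : (r : ℂ) ≠ 0 := by exact_mod_cast hr.ne'
  have hG : DiffContOnCl ℂ (fun s : ℂ => (c + r * s - ζ)⁻¹) (ball 0 1) := by
    have h : DiffContOnCl ℂ (fun s : ℂ => c + r * s - ζ) (ball 0 1) :=
      (Differentiable.diffContOnCl (by fun_prop))
    refine h.inv fun s hs h0 => ?_
    rw [closure_ball _ one_ne_zero, mem_closedBall_zero_iff] at hs
    have : ζ - c = r * s := by linear_combination -h0
    rw [this, norm_mul, Complex.norm_real, Real.norm_eq_abs, abs_of_pos hr] at hζ
    nlinarith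
  rw [← circleCoeff_eq_zero_of_inside (c := c) hr hG n]
  refine circleCoeff_congr hr.le (fun z hz => ?_) _
  congr 1
  field_simp
  ring

theorem circleCoeff_cauchy_inside (hr : 0 < r) {ξ : ℂ} (hξ : ‖ξ - c‖ < r) (n : ℕ) :
    circleCoeff c r (fun z => (z - ξ)⁻¹) n = 0 := by
  have hr0 : (r : ℂ) ≠ 0 := by exact_mod_cast hr.ne'
  have hG : DiffContOnCl ℂ (fun w : ℂ => (r - (ξ - c) * w)⁻¹) (ball 0 1) := by
    have h : DiffContOnCl ℂ (fun w : ℂ => r - (ξ - c) * w) (ball 0 1) :=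
      (Differentiable.diffContOnCl (by fun_prop))
    refine h.inv fun s hs h0 => ?_
    rw [closure_ball _ one_ne_zero, mem_closedBall_zero_iff] at hs
    have h1 : (r : ℂ) = (ξ - c) * s := by linear_combination h0
    have h2 := congrArg norm h1
    rw [norm_mul, Complex.norm_real, Real.norm_eq_abs, abs_of_pos hr] at h2
    nlinarith [norm_nonneg (ξ - c)]
  rw [← circleCoeff_eq_zero_of_outside (c := c) hr hG n]
  refine circleCoeff_congr hr.le (fun z hz => ?_) _
  have h1 := sub_ne_zero_of_mem_sphere hr hz
  have h2 : (r - (ξ - c) * (r / (z - c)) : ℂ) = r / (z - c) * (z - ξ) := by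
    field_simp
    ring
  have h3 : (r / (z - c) : ℂ) ≠ 0 := div_ne_zero hr0 h1
  rw [h2, mul_inv, mul_inv_cancel_left₀ h3]

/-- The mirror image for a pole ξ inside: the difference quotient of F at (ξ − c)/r is holomorphic
inside, so the minus part of F((z − c)/r)/(z − ξ) is obtained by evaluation of F at the pole. -/
theorem circleCoeff_inside_mul_cauchy (hr : 0 < r) {F : ℂ → ℂ} (hF : DiffContOnCl ℂ F (ball 0 1))
    {ξ : ℂ} (hξ : ‖ξ - c‖ < r) (n : ℕ) :
    circleCoeff c r (fun z => (F ((ξ - c) / r) - F ((z - c) / r)) * (z - ξ)⁻¹) (-(n : ℤ) - 1) =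
      0 := by
  have hr0 : (r : ℂ) ≠ 0 := by exact_mod_cast hr.ne'
  have hG := (diffContOnCl_dslope hF (sub_div_mem_ball hr hξ)).const_smul (-(r : ℂ)⁻¹)
  rw [← circleCoeff_eq_zero_of_inside (c := c) hr hG n]
  refine circleCoeff_congr hr.le (fun z hz => ?_) _
  have h2 : z - ξ ≠ 0 := by
    intro h
    rw [mem_sphere_iff_norm, sub_eq_zero.1 h] at hz
    exact hξ.ne hz
  have h3 : (z - c) / r ≠ (ξ - c) / r := by
    intro h
    rw [div_left_inj' hr0] at h
    apply h2
    linear_combination h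
  simp only [Pi.smul_apply, smul_eq_mul]
  rw [dslope_of_ne _ h3, slope_def_field]
  have h4 : (z - c) / r - (ξ - c) / r = (z - ξ) / r := by ring
  rw [h4]
  field_simp
  ring

theorem circleCoeff_const_mul (a : ℂ) (f : ℂ → ℂ) (n : ℤ) :
    circleCoeff c r (fun z => a * f z) n = a * circleCoeff c r f n := by
  simp only [circleCoeff, mul_left_comm _ a, intervalIntegral.integral_const_mul]

theorem circleCoeff_add (hr : 0 ≤ r) {f g : ℂ → ℂ} (hf : ContinuousOn f (sphere c r))
    (hg : ContinuousOn g (sphere c r)) (n : ℤ) :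
    circleCoeff c r (fun z => f z + g z) n = circleCoeff c r f n + circleCoeff c r g n := by
  have h : ∀ {f : ℂ → ℂ}, ContinuousOn f (sphere c r) → IntervalIntegrable
      (fun θ : ℝ => Complex.exp (-(n * θ * Complex.I)) * f (circleMap c r θ)) volume 0
        (2 * Real.pi) := fun {f} hf => by
    have h1 : Continuous fun θ => f (circleMap c r θ) :=
      hf.comp_continuous (continuous_circleMap c r) fun θ => circleMap_mem_sphere c hr θ
    refine Continuous.intervalIntegrable ?_ _ _
    exact Continuous.mul (by fun_prop) h1
  simp only [circleCoeff, mul_add]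
  rw [intervalIntegral.integral_add (h hf) (h hg)]

theorem circleCoeff_eq_zero_of_closedBall (hr : 0 < r) {f : ℂ → ℂ}
    (hf : DifferentiableOn ℂ f (closedBall c r)) (n : ℕ) :
    circleCoeff c r f (-(n : ℤ) - 1) = 0 := by
  have hr0 : (r : ℂ) ≠ 0 := by exact_mod_cast hr.ne'
  have hG : DiffContOnCl ℂ (fun s : ℂ => f (c + r * s)) (ball 0 1) := by
    refine DifferentiableOn.diffContOnCl ?_
    rw [closure_ball _ one_ne_zero]
    refine hf.comp (f := fun s : ℂ => c + r * s) (by fun_prop) fun s hs => ?_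
    rw [mem_closedBall_zero_iff] at hs
    rw [mem_closedBall_iff_norm, add_sub_cancel_left, norm_mul, Complex.norm_real, Real.norm_eq_abs,
      abs_of_pos hr]
    nlinarith
  rw [← circleCoeff_eq_zero_of_inside (c := c) hr hG n]
  refine circleCoeff_congr hr.le (fun z hz => ?_) _
  congr 1
  field_simp
  ring

end CauchyKernel

section Inverse

variable {g : SL(2, ℂ)} {c c' : ℂ} {r r' : ℝ}

theorem num_sub_mul_den (z ζ : ℂ) :
    num g z - ζ * den g z = den g⁻¹ ζ * z - num g⁻¹ ζ := by
  simp only [num, den, Matrix.SpecialLinearGroup.SL2_inv_expl]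
  simp
  ring

theorem num_sub_mul_den_eq (z : ℂ) {ζ : ℂ} (h : den g⁻¹ ζ ≠ 0) :
    num g z - ζ * den g z = den g⁻¹ ζ * (z - mobius g⁻¹ ζ) := by
  rw [num_sub_mul_den, mobius]
  field_simp

/-- The weak inequality is the defining property of the inverse map; equality is impossible because
the map sends circle to circle. -/
theorem norm_mobius_inv_sub_lt (h : IsGluing g c r c' r') (h' : IsGluing g⁻¹ c' r' c r) {ζ : ℂ}
    (hζ : r' < ‖ζ - c'‖) : ‖mobius g⁻¹ ζ - c‖ < r := by
  have h0 := h'.den_ne_zero hζ.le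
  have h0' := norm_pos_iff.2 h0
  have h1 := (h'.maps ζ).2 hζ.le
  have h2 : mobius g⁻¹ ζ - c = (num g⁻¹ ζ - c * den g⁻¹ ζ) / den g⁻¹ ζ := by
    rw [mobius]
    field_simp
  refine lt_of_le_of_ne ?_ fun he => ?_
  · rw [h2, norm_div, div_le_iff₀ h0']
    exact h1
  · have hs : mobius g⁻¹ ζ ∈ sphere c r := mem_sphere_iff_norm.2 he
    have h3 := h.norm_eq hs
    have h4 := norm_pos_iff.2 (h.den_ne_zero_of_mem_sphere hs)
    have h5 := num_sub_mul_den_eq (g := g) (mobius g⁻¹ ζ) h0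
    rw [sub_self, mul_zero, sub_eq_zero] at h5
    rw [h5, ← sub_mul, norm_mul] at h3
    exact hζ.ne' (mul_right_cancel₀ h4.ne' h3)

theorem differentiableAt_mobius {ζ : ℂ} (h : den g ζ ≠ 0) : DifferentiableAt ℂ (mobius g) ζ := by
  unfold mobius
  refine DifferentiableAt.div ?_ ?_ h
  · unfold num; fun_prop
  · unfold den; fun_prop

end Inverse

end SchottkyModel

/-! ### The Cauchy kernels of the curve and the kernel of a block. -/

namespace SchottkyCurve

variable {I : Type*} (X : SchottkyCurve I)

theorem norm_sub_center_gt {i j : I} (hij : j ≠ i) {ζ : ℂ}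
    (hζ : ζ ∈ closedBall (X.center j) (X.radius j)) :
    Real.exp (2 * X.ε) * X.radius i < ‖ζ - X.center i‖ := by
  by_contra! h
  have h1 := X.one_lt_exp
  have h2 := X.radius_pos j
  refine Set.disjoint_left.1 (X.disjoint j i hij) ?_ (mem_closedBall_iff_norm.2 h)
  refine closedBall_subset_closedBall ?_ hζ
  nlinarith

theorem radius_lt_norm_sub {i j : I} (hij : j ≠ i) {ζ : ℂ}
    (hζ : ζ ∈ closedBall (X.center j) (X.radius j)) : X.radius i < ‖ζ - X.center i‖ := by
  have h1 := X.one_lt_exp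
  have h2 := X.radius_pos i
  have h3 := X.norm_sub_center_gt hij hζ
  nlinarith

theorem sub_ne_zero_of_ne {i j : I} (hij : j ≠ i) {z ζ : ℂ}
    (hz : z ∈ closedBall (X.center i) (X.radius i))
    (hζ : ζ ∈ closedBall (X.center j) (X.radius j)) : z - ζ ≠ 0 := by
  intro h
  rw [sub_eq_zero] at h
  subst h
  exact (X.radius_lt_norm_sub hij hζ).not_ge (mem_closedBall_iff_norm.1 hz)

open scoped Classical in
/-- The Cauchy kernel between `∂ K i` and `∂ K j`, with a zero diagonal block. -/
def kernelX (i j : I) (z ζ : ℂ) : ℂ := if j = i then 0 else (z - ζ)⁻¹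

/-- The pull-back to `∂ K i` of the Cauchy kernel between `∂ K i'` and `∂ K j`. -/
def kernelY (i j : I) (z ζ : ℂ) : ℂ :=
  (den (X.φ i) z)⁻¹ * kernelX (X.inv i) j (mobius (X.φ i) z) ζ

variable {X}

theorem kernelX_self (i : I) (z ζ : ℂ) : kernelX i i z ζ = 0 := if_pos rfl

theorem kernelX_of_ne {i j : I} (h : j ≠ i) (z ζ : ℂ) : kernelX i j z ζ = (z - ζ)⁻¹ := if_neg h

theorem kernelY_inv (i : I) (z ζ : ℂ) : X.kernelY i (X.inv i) z ζ = 0 := by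
  rw [kernelY, kernelX_self, mul_zero]

theorem den_inv_ne_zero {i j : I} (h : j ≠ X.inv i) {ζ : ℂ}
    (hζ : ζ ∈ closedBall (X.center j) (X.radius j)) : den (X.φ i)⁻¹ ζ ≠ 0 :=
  (X.isGluing_inv i).den_ne_zero (X.radius_lt_norm_sub h hζ).le

theorem kernelY_of_ne {i j : I} (h : j ≠ X.inv i) {z ζ : ℂ}
    (hz : z ∈ sphere (X.center i) (X.radius i))
    (hζ : ζ ∈ closedBall (X.center j) (X.radius j)) : X.kernelY i j z ζ =
      (den (X.φ i)⁻¹ ζ)⁻¹ * (z - mobius (X.φ i)⁻¹ ζ)⁻¹ := by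
  have h0 := (X.isGluing i).den_ne_zero_of_mem_sphere hz
  rw [kernelY, kernelX_of_ne h, ← mul_inv, ← mul_inv,
    ← num_sub_mul_den_eq z (den_inv_ne_zero h hζ), mobius]
  congr 1
  field_simp

theorem norm_preimage_sub_lt {i j : I} (h : j ≠ X.inv i) {ζ : ℂ}
    (hζ : ζ ∈ closedBall (X.center j) (X.radius j)) :
    ‖mobius (X.φ i)⁻¹ ζ - X.center i‖ < X.radius i :=
  norm_mobius_inv_sub_lt (X.isGluing i) (X.isGluing_inv i) (X.radius_lt_norm_sub h hζ)

theorem sub_preimage_ne_zero {i j : I} (h : j ≠ X.inv i) {z ζ : ℂ}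
    (hz : z ∈ sphere (X.center i) (X.radius i))
    (hζ : ζ ∈ closedBall (X.center j) (X.radius j)) : z - mobius (X.φ i)⁻¹ ζ ≠ 0 := by
  intro h0
  have := norm_preimage_sub_lt h hζ
  rw [← sub_eq_zero.1 h0, mem_sphere_iff_norm.1 hz] at this
  exact lt_irrefl _ this

variable (X)

/-- The kernel that the gluing block with the factorization `U (s) * V (1 / s)` gives from the two
Cauchy kernels. -/
def kernelA (i : I) (U V : ℂ → ℂ) (j : I) (z ζ : ℂ) : ℂ :=
  V (X.radius i / (ζ - X.center i)) * kernelX i j z ζ +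
    (U ((mobius (X.φ i)⁻¹ ζ - X.center i) / X.radius i))⁻¹ * X.kernelY i j z ζ

variable {X} {i j : I} {U V : ℂ → ℂ}

theorem continuousOn_kernelX : ContinuousOn (fun p : ℂ × ℂ => kernelX i j p.1 p.2)
    (sphere (X.center i) (X.radius i) ×ˢ closedBall (X.center j) (X.radius j)) := by
  by_cases h : j = i
  · subst h
    simp only [kernelX_self]
    exact continuousOn_const
  · simp only [kernelX_of_ne h]
    exact ContinuousOn.inv₀ (by fun_prop) fun p hp =>
      X.sub_ne_zero_of_ne h (sphere_subset_closedBall hp.1) hp.2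

theorem continuousOn_mobius_inv (h : j ≠ X.inv i) :
    ContinuousOn (mobius (X.φ i)⁻¹) (closedBall (X.center j) (X.radius j)) := fun _ hζ =>
  (differentiableAt_mobius (den_inv_ne_zero h hζ)).continuousAt.continuousWithinAt

theorem continuousOn_kernelY : ContinuousOn (fun p : ℂ × ℂ => X.kernelY i j p.1 p.2)
    (sphere (X.center i) (X.radius i) ×ˢ closedBall (X.center j) (X.radius j)) := by
  by_cases h : j = X.inv i
  · subst h
    simp only [kernelY_inv]
    exact continuousOn_const
  · have h1 : ContinuousOn (fun p : ℂ × ℂ => mobius (X.φ i)⁻¹ p.2)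
      (sphere (X.center i) (X.radius i) ×ˢ closedBall (X.center j) (X.radius j)) :=
      (continuousOn_mobius_inv h).comp (f := Prod.snd) (by fun_prop) fun p hp => hp.2
    have h2 : ContinuousOn (fun p : ℂ × ℂ =>
        (den (X.φ i)⁻¹ p.2)⁻¹ * (p.1 - mobius (X.φ i)⁻¹ p.2)⁻¹)
        (sphere (X.center i) (X.radius i) ×ˢ closedBall (X.center j) (X.radius j)) := by
      refine ContinuousOn.mul (ContinuousOn.inv₀ ?_ fun p hp => den_inv_ne_zero h hp.2)
        (ContinuousOn.inv₀ (continuousOn_fst.sub h1) fun p hp => sub_preimage_ne_zero h hp.1 hp.2)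
      exact ((continuous_den _).comp continuous_snd).continuousOn
    exact h2.congr fun p hp => kernelY_of_ne h hp.1 hp.2

theorem differentiableAt_outside (hV : DiffContOnCl ℂ V (ball 0 1)) (h : j ≠ i) {ζ : ℂ}
    (hζ : ζ ∈ closedBall (X.center j) (X.radius j)) :
    DifferentiableAt ℂ (fun ζ => V (X.radius i / (ζ - X.center i))) ζ := by
  have h1 := X.radius_lt_norm_sub h hζ
  have h2 := (hV.differentiableAt isOpen_ball (div_sub_mem_ball (X.radius_pos i) h1))
  refine h2.comp ζ (f := fun ζ => X.radius i / (ζ - X.center i)) ?_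
  exact DifferentiableAt.div (by fun_prop) (by fun_prop) (sub_ne_zero_of_norm_lt (X.radius_pos i) h1)

theorem differentiableAt_inside (hU : DiffContOnCl ℂ U (ball 0 1)) (hU0 : ∀ s, U s ≠ 0)
    (h : j ≠ X.inv i) {ζ : ℂ} (hζ : ζ ∈ closedBall (X.center j) (X.radius j)) :
    DifferentiableAt ℂ (fun ζ => (U ((mobius (X.φ i)⁻¹ ζ - X.center i) / X.radius i))⁻¹) ζ := by
  have h1 := norm_preimage_sub_lt h hζ
  have h2 := (hU.differentiableAt isOpen_ball (sub_div_mem_ball (X.radius_pos i) h1))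
  have h3 : DifferentiableAt ℂ (fun ζ => (mobius (X.φ i)⁻¹ ζ - X.center i) / X.radius i) ζ :=
    ((differentiableAt_mobius (den_inv_ne_zero h hζ)).sub_const _).div_const _
  exact (h2.comp ζ h3).inv (hU0 _)

theorem continuousOn_kernelA (hU : DiffContOnCl ℂ U (ball 0 1)) (hU0 : ∀ s, U s ≠ 0)
    (hV : DiffContOnCl ℂ V (ball 0 1)) : ContinuousOn (fun p : ℂ × ℂ => X.kernelA i U V j p.1 p.2)
    (sphere (X.center i) (X.radius i) ×ˢ closedBall (X.center j) (X.radius j)) := by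
  have snd : ∀ {u : ℂ → ℂ}, (∀ ζ ∈ closedBall (X.center j) (X.radius j), DifferentiableAt ℂ u ζ) →
      ContinuousOn (fun p : ℂ × ℂ => u p.2)
        (sphere (X.center i) (X.radius i) ×ˢ closedBall (X.center j) (X.radius j)) := fun {u} hu =>
    ContinuousOn.comp (g := u) (f := Prod.snd) (t := closedBall (X.center j) (X.radius j))
      (fun ζ hζ => (hu ζ hζ).continuousAt.continuousWithinAt) (by fun_prop) fun p hp => hp.2
  unfold kernelA
  refine ContinuousOn.add ?_ ?_
  -- For j = i the point ζ lies inside the circle, where nothing is known about V(r/(ζ − c)); the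
  -- factor is harmless because the kernel next to it is zero. The case j = i' of the second term is
  -- similar.
  · by_cases h : j = i
    · subst h
      simp only [kernelX_self, mul_zero]
      exact continuousOn_const
    · exact (snd fun ζ hζ => differentiableAt_outside hV h hζ).mul continuousOn_kernelX
  · by_cases h : j = X.inv i
    · subst h
      simp only [kernelY_inv, mul_zero]
      exact continuousOn_const
    · exact (snd fun ζ hζ => differentiableAt_inside hU hU0 h hζ).mul continuousOn_kernelY

theorem differentiableOn_kernelX {z : ℂ} (hz : z ∈ sphere (X.center i) (X.radius i)) :
    DifferentiableOn ℂ (kernelX i j z) (closedBall (X.center j) (X.radius j)) := by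
  by_cases h : j = i
  · subst h
    exact (differentiableOn_const 0).congr fun ζ _ => kernelX_self j z ζ
  · refine DifferentiableOn.congr ?_ fun ζ _ => kernelX_of_ne h z ζ
    exact DifferentiableOn.inv (by fun_prop) fun ζ hζ =>
      X.sub_ne_zero_of_ne h (sphere_subset_closedBall hz) hζ

theorem differentiableOn_kernelY {z : ℂ} (hz : z ∈ sphere (X.center i) (X.radius i)) :
    DifferentiableOn ℂ (X.kernelY i j z) (closedBall (X.center j) (X.radius j)) :=
  (differentiableOn_kernelX ((X.isGluing i).mobius_mem_sphere hz)).const_mul _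

theorem differentiableOn_kernelA (hU : DiffContOnCl ℂ U (ball 0 1)) (hU0 : ∀ s, U s ≠ 0)
    (hV : DiffContOnCl ℂ V (ball 0 1)) {z : ℂ} (hz : z ∈ sphere (X.center i) (X.radius i)) :
    DifferentiableOn ℂ (X.kernelA i U V j z) (closedBall (X.center j) (X.radius j)) := by
  unfold kernelA
  refine DifferentiableOn.add ?_ ?_
  · by_cases h : j = i
    · subst h
      simp only [kernelX_self, mul_zero]
      exact differentiableOn_const 0
    · exact DifferentiableOn.mul (fun ζ hζ => (differentiableAt_outside hV h hζ).differentiableWithinAt)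
        (differentiableOn_kernelX hz)
  · by_cases h : j = X.inv i
    · subst h
      simp only [kernelY_inv, mul_zero]
      exact differentiableOn_const 0
    · exact DifferentiableOn.mul
        (fun ζ hζ => (differentiableAt_inside hU hU0 h hζ).differentiableWithinAt)
        (differentiableOn_kernelY hz)

theorem continuousOn_slice {k : ℂ → ℂ → ℂ} {s t : Set ℂ}
    (hk : ContinuousOn (fun p : ℂ × ℂ => k p.1 p.2) (s ×ˢ t)) {ζ : ℂ} (hζ : ζ ∈ t) :
    ContinuousOn (fun z => k z ζ) s :=
  hk.comp (f := fun z => (z, ζ)) (by fun_prop) fun _ hz => ⟨hz, hζ⟩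

/-- A − V(z) X = (V(ζ) − V(z)) X + U(ξ)⁻¹ Y. The first term is in L₂⁻ by the difference quotient,
the second one because its pole ξ is inside the circle. -/
theorem circleCoeff_kernelA_sub_kernelX (hV : DiffContOnCl ℂ V (ball 0 1)) {ζ : ℂ}
    (hζ : ζ ∈ closedBall (X.center j) (X.radius j)) (n : ℕ) :
    circleCoeff (X.center i) (X.radius i) (fun z => X.kernelA i U V j z ζ -
      V (X.radius i / (z - X.center i)) * kernelX i j z ζ) n = 0 := by
  have hr := X.radius_pos i
  have cX := continuousOn_slice (continuousOn_kernelX (X := X) (i := i)) hζ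
  have cY := continuousOn_slice (continuousOn_kernelY (X := X) (i := i)) hζ
  have e : (fun z => X.kernelA i U V j z ζ -
      V (X.radius i / (z - X.center i)) * kernelX i j z ζ) = fun z =>
      (V (X.radius i / (ζ - X.center i)) - V (X.radius i / (z - X.center i))) * kernelX i j z ζ +
      (U ((mobius (X.φ i)⁻¹ ζ - X.center i) / X.radius i))⁻¹ * X.kernelY i j z ζ := by
    funext z
    rw [kernelA]
    ring
  have hadd := circleCoeff_add (n := n) hr.le
    (f := fun z => (V (X.radius i / (ζ - X.center i)) - V (X.radius i / (z - X.center i))) *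
      kernelX i j z ζ)
    (g := fun z => (U ((mobius (X.φ i)⁻¹ ζ - X.center i) / X.radius i))⁻¹ * X.kernelY i j z ζ)
    ((continuousOn_const.sub (continuousOn_outside hr hV)).mul cX) (continuousOn_const.mul cY)
  have h1 : circleCoeff (X.center i) (X.radius i) (fun z => (V (X.radius i / (ζ - X.center i)) -
      V (X.radius i / (z - X.center i))) * kernelX i j z ζ) n = 0 := by
    by_cases h : j = i
    · subst h
      simp [kernelX_self, circleCoeff]
    · simp only [kernelX_of_ne h]
      exact circleCoeff_outside_mul_cauchy hr hV (X.radius_lt_norm_sub h hζ) n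
  have h2 : circleCoeff (X.center i) (X.radius i) (fun z => X.kernelY i j z ζ) n = 0 := by
    by_cases h : j = X.inv i
    · subst h
      simp [kernelY_inv, circleCoeff]
    · rw [circleCoeff_congr hr.le fun z hz => kernelY_of_ne h hz hζ, circleCoeff_const_mul,
        circleCoeff_cauchy_inside hr (norm_preimage_sub_lt h hζ), mul_zero]
  rw [e]
  refine hadd.trans ((congrArg₂ (· + ·) h1 ((circleCoeff_const_mul _ _ _).trans ?_)).trans
    (add_zero 0))
  rw [h2, mul_zero]

/-- A − U(z)⁻¹ Y = V(ζ) X + (U(ξ)⁻¹ − U(z)⁻¹) Y. The first term is in L₂⁺ because its pole ζ is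
outside the circle, the second one by the difference quotient. -/
theorem circleCoeff_kernelA_sub_kernelY (hU : DiffContOnCl ℂ U (ball 0 1)) (hU0 : ∀ s, U s ≠ 0)
    {ζ : ℂ} (hζ : ζ ∈ closedBall (X.center j) (X.radius j)) (n : ℕ) :
    circleCoeff (X.center i) (X.radius i) (fun z => X.kernelA i U V j z ζ -
      (U ((z - X.center i) / X.radius i))⁻¹ * X.kernelY i j z ζ) (-(n : ℤ) - 1) = 0 := by
  have hr := X.radius_pos i
  have hUi : DiffContOnCl ℂ U⁻¹ (ball 0 1) := hU.inv fun s _ => hU0 s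
  have cX := continuousOn_slice (continuousOn_kernelX (X := X) (i := i)) hζ
  have cY := continuousOn_slice (continuousOn_kernelY (X := X) (i := i)) hζ
  have e : (fun z => X.kernelA i U V j z ζ -
      (U ((z - X.center i) / X.radius i))⁻¹ * X.kernelY i j z ζ) = fun z =>
      V (X.radius i / (ζ - X.center i)) * kernelX i j z ζ +
      (U⁻¹ ((mobius (X.φ i)⁻¹ ζ - X.center i) / X.radius i) -
        U⁻¹ ((z - X.center i) / X.radius i)) * X.kernelY i j z ζ := by
    funext z
    rw [kernelA, Pi.inv_apply, Pi.inv_apply]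
    ring
  have hadd := circleCoeff_add (n := -(n : ℤ) - 1) hr.le
    (f := fun z => V (X.radius i / (ζ - X.center i)) * kernelX i j z ζ)
    (g := fun z => (U⁻¹ ((mobius (X.φ i)⁻¹ ζ - X.center i) / X.radius i) -
        U⁻¹ ((z - X.center i) / X.radius i)) * X.kernelY i j z ζ)
    (continuousOn_const.mul cX) ((continuousOn_const.sub (continuousOn_inside hr hUi)).mul cY)
  have h1 : circleCoeff (X.center i) (X.radius i) (fun z => kernelX i j z ζ) (-(n : ℤ) - 1) = 0 := by
    by_cases h : j = i
    · subst h
      simp [kernelX_self, circleCoeff]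
    · simp only [kernelX_of_ne h]
      exact circleCoeff_cauchy_outside hr (X.radius_lt_norm_sub h hζ) n
  have h2 : circleCoeff (X.center i) (X.radius i) (fun z =>
      (U⁻¹ ((mobius (X.φ i)⁻¹ ζ - X.center i) / X.radius i) -
        U⁻¹ ((z - X.center i) / X.radius i)) * X.kernelY i j z ζ) (-(n : ℤ) - 1) = 0 := by
    by_cases h : j = X.inv i
    · subst h
      simp [kernelY_inv, circleCoeff]
    · have e2 : ∀ z ∈ sphere (X.center i) (X.radius i),
          (U⁻¹ ((mobius (X.φ i)⁻¹ ζ - X.center i) / X.radius i) -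
            U⁻¹ ((z - X.center i) / X.radius i)) * X.kernelY i j z ζ =
          (den (X.φ i)⁻¹ ζ)⁻¹ * ((U⁻¹ ((mobius (X.φ i)⁻¹ ζ - X.center i) / X.radius i) -
            U⁻¹ ((z - X.center i) / X.radius i)) * (z - mobius (X.φ i)⁻¹ ζ)⁻¹) := fun z hz => by
        rw [kernelY_of_ne h hz hζ]
        ring
      rw [circleCoeff_congr hr.le e2, circleCoeff_const_mul,
        circleCoeff_inside_mul_cauchy hr hUi (norm_preimage_sub_lt h hζ), mul_zero]
  rw [e]
  refine hadd.trans ((congrArg₂ (· + ·) ((circleCoeff_const_mul _ _ _).trans ?_) h2).trans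
    (add_zero 0))
  rw [h1, mul_zero]

end SchottkyCurve

/-! ### Hilbert–Schmidt norms of rows as energies of kernels. -/

namespace SchottkyCurve

variable {I : Type*} {X : SchottkyCurve I}

theorem coeFn_hilbert_basis {K : X.HMinus →L[ℂ] X.HPlus} (hK : X.IsHilbertOperator K) (i j : I)
    (m : ℕ) : (K (X.basis (j, m)) i : X.L2 i) =ᵐ[X.arc i] fun z =>
      pairing (X.center j) (X.radius j) m (kernelX i j z) := by
  have h := hK j (minusVector (X.center j) (X.radius j) m)
  rw [X.basis_apply, basisVector]
  by_cases hij : i = j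
  · subst hij
    rw [h.1]
    filter_upwards [Lp.coeFn_zero ℂ 2 (X.arc i)] with z hz
    refine hz.trans ?_
    have : kernelX i i z = fun _ => 0 := funext fun ζ => kernelX_self i z ζ
    rw [this]
    simp [pairing, circleCoeff]
  · filter_upwards [h.2 i hij] with z hz
    rw [hz, ← circleIntegral_minusVector (X.radius_pos j)]
    simp only [kernelX_of_ne (Ne.symm hij), div_eq_mul_inv]

theorem coeFn_pull_hilbert_basis {K : X.HMinus →L[ℂ] X.HPlus} (hK : X.IsHilbertOperator K) (i j : I)
    (m : ℕ) : X.pull i (K (X.basis (j, m)) (X.inv i)) =ᵐ[X.arc i] fun z =>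
      pairing (X.center j) (X.radius j) m (X.kernelY i j z) := by
  refine (X.coeFn_pull i _).trans (((X.isGluing i).halfFormPullback_congr
    (coeFn_hilbert_basis hK (X.inv i) j m)).trans (Eventually.of_forall fun z => ?_))
  exact (pairing_const_mul _ _ _).symm

variable (X) in
/-- The square of the Hilbert–Schmidt norm of the operator from `∂ K j` to `∂ K i` with a given
kernel. -/
def kernelEnergy (i j : I) (k : ℂ → ℂ → ℂ) : ℝ≥0∞ := ∫⁻ z, ∫⁻ ζ, ‖k z ζ‖ₑ ^ 2 ∂X.arc j ∂X.arc i

/-- Holomorphy of the kernel in ζ on the whole disk K_j kills its negative Fourier coefficients in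
ζ, so no part of it is lost by pairing with ℋ⁻ only. -/
theorem tsum_enorm_sq_of_basis {i : I} {k : I → ℂ → ℂ → ℂ}
    (hk : ∀ j, ContinuousOn (fun p : ℂ × ℂ => k j p.1 p.2)
      (sphere (X.center i) (X.radius i) ×ˢ closedBall (X.center j) (X.radius j)))
    (hd : ∀ j, ∀ z ∈ sphere (X.center i) (X.radius i),
      DifferentiableOn ℂ (k j z) (closedBall (X.center j) (X.radius j)))
    {f : I × ℕ → X.L2 i} (hf : ∀ j m, f (j, m) =ᵐ[X.arc i] fun z =>
      pairing (X.center j) (X.radius j) m (k j z)) :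
    ∑' p, ‖f p‖ₑ ^ 2 =
      ENNReal.ofReal (4 * Real.pi ^ 2)⁻¹ * ∑' j, X.kernelEnergy i j (k j) := by
  rw [ENNReal.tsum_prod', ← ENNReal.tsum_mul_left]
  refine tsum_congr fun j => ?_
  refine tsum_enorm_sq_of_pairing (X.radius_pos i) (X.radius_pos j)
    ((hk j).mono (prod_mono_right sphere_subset_closedBall)) (fun z hz n => ?_) (hf j)
  exact circleCoeff_eq_zero_of_closedBall (X.radius_pos j) (hd j z hz) n

theorem tsum_enorm_hilbert_basis_sq {K : X.HMinus →L[ℂ] X.HPlus} (hK : X.IsHilbertOperator K)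
    (i : I) : ∑' p, ‖K (X.basis p) i‖ₑ ^ 2 =
      ENNReal.ofReal (4 * Real.pi ^ 2)⁻¹ * ∑' j, X.kernelEnergy i j (kernelX i j) :=
  tsum_enorm_sq_of_basis (f := fun p => (K (X.basis p) i : X.L2 i)) (fun _ => continuousOn_kernelX)
    (fun _ _ hz => differentiableOn_kernelX hz) fun j m => coeFn_hilbert_basis hK i j m

/-- The energy between `∂ K i` and `∂ K j` of the block with the factorization `U (s) * V (1 / s)`. -/
def blockEnergy (X : SchottkyCurve I) (i : I) (U V : ℂ → ℂ) (j : I) : ℝ≥0∞ :=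
  X.kernelEnergy i j (fun z ζ => (V (X.radius i / (z - X.center i)))⁻¹ * X.kernelA i U V j z ζ -
    kernelX i j z ζ) +
  X.kernelEnergy i j (fun z ζ => U ((z - X.center i) / X.radius i) * X.kernelA i U V j z ζ -
    X.kernelY i j z ζ)

/-- Reduces the Hilbert–Schmidt norm of a row to integrals of explicit functions. The component on
∂K_i' is measured on ∂K_i, after the isometric pull-back. -/
theorem tsum_enorm_block_hilbert_basis_sq {K : X.HMinus →L[ℂ] X.HPlus} (hK : X.IsHilbertOperator K)
    {i : I} {P : (X.Plus i × X.Plus (X.inv i)) →L[ℂ] (X.Minus i × X.Minus (X.inv i))}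
    {ψ U V : ℂ → ℂ} (hU : DiffContOnCl ℂ U (ball 0 1)) (hU0 : ∀ s, U s ≠ 0)
    (hV : DiffContOnCl ℂ V (ball 0 1)) (hV0 : ∀ s, V s ≠ 0)
    (hψ : ∀ z ∈ sphere (X.center i) (X.radius i), ψ z =
      U ((z - X.center i) / X.radius i) * V (X.radius i / (z - X.center i)))
    (hP : X.blockGraph i P = intertwiner (X.pull i) (mulOp (X.center i) (X.radius i) ψ)) :
    (∑' p, (‖(P (K (X.basis p) i, K (X.basis p) (X.inv i))).1‖ₑ ^ 2 +
      ‖(P (K (X.basis p) i, K (X.basis p) (X.inv i))).2‖ₑ ^ 2)) =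
      ENNReal.ofReal (4 * Real.pi ^ 2)⁻¹ * ∑' j, X.blockEnergy i U V j := by
  have hr := X.radius_pos i
  have hUi : DiffContOnCl ℂ U⁻¹ (ball 0 1) := hU.inv fun s _ => hU0 s
  have hVi : DiffContOnCl ℂ V⁻¹ (ball 0 1) := hV.inv fun s _ => hV0 s
  have cU := continuousOn_inside (c := X.center i) hr hU
  have cVi : ContinuousOn (fun z => (V (X.radius i / (z - X.center i)))⁻¹)
    (sphere (X.center i) (X.radius i)) := continuousOn_outside hr hVi
  have fst : ∀ {u : ℂ → ℂ} (j : I), ContinuousOn u (sphere (X.center i) (X.radius i)) →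
      ContinuousOn (fun p : ℂ × ℂ => u p.1)
        (sphere (X.center i) (X.radius i) ×ˢ closedBall (X.center j) (X.radius j)) :=
    fun {u} j hu => hu.comp (f := Prod.fst) (by fun_prop) fun p hp => hp.1
  have key : ∀ j m, _ := fun j m => apply_pairing (m := m) hr (X.radius_pos (X.inv i))
    (X.radius_pos j) (X.swapsHardy_pull i) hU hU0 hV hV0 hψ hP
    ((continuousOn_kernelA (j := j) hU hU0 hV).mono (prod_mono_right sphere_subset_closedBall))
    (continuousOn_kernelX.mono (prod_mono_right sphere_subset_closedBall))
    (continuousOn_kernelY.mono (prod_mono_right sphere_subset_closedBall))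
    (fun ζ hζ n => circleCoeff_kernelA_sub_kernelX hV (sphere_subset_closedBall hζ) n)
    (fun ζ hζ n => circleCoeff_kernelA_sub_kernelY hU hU0 (sphere_subset_closedBall hζ) n)
    (coeFn_hilbert_basis hK i j m) (coeFn_pull_hilbert_basis hK i j m)
  rw [ENNReal.tsum_add]
  simp only [blockEnergy]
  rw [ENNReal.tsum_add, mul_add]
  congr 1
  · exact tsum_enorm_sq_of_basis
      (f := fun p => ((P (K (X.basis p) i, K (X.basis p) (X.inv i))).1 : X.L2 i))
      (k := fun j z ζ => (V (X.radius i / (z - X.center i)))⁻¹ * X.kernelA i U V j z ζ -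
        kernelX i j z ζ)
      (fun j => ((fst j cVi).mul (continuousOn_kernelA hU hU0 hV)).sub continuousOn_kernelX)
      (fun j z hz => ((differentiableOn_kernelA hU hU0 hV hz).const_mul _).sub
        (differentiableOn_kernelX hz))
      fun j m => (key j m).1
  · have e : ∀ p, ‖(P (K (X.basis p) i, K (X.basis p) (X.inv i))).2‖ₑ =
        ‖X.pull i (P (K (X.basis p) i, K (X.basis p) (X.inv i))).2‖ₑ := fun p => by
      rw [← ofReal_norm, ← ofReal_norm, LinearIsometryEquiv.norm_map]
      rfl
    simp only [e]
    exact tsum_enorm_sq_of_basis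
      (f := fun p => X.pull i (P (K (X.basis p) i, K (X.basis p) (X.inv i))).2)
      (k := fun j z ζ => U ((z - X.center i) / X.radius i) * X.kernelA i U V j z ζ -
        X.kernelY i j z ζ)
      (fun j => ((fst j cU).mul (continuousOn_kernelA hU hU0 hV)).sub continuousOn_kernelY)
      (fun j z hz => ((differentiableOn_kernelA hU hU0 hV hz).const_mul _).sub
        (differentiableOn_kernelY hz))
      fun j m => (key j m).2

end SchottkyCurve

/-! ### Well-separation makes every row of the Hilbert operator Hilbert–Schmidt. -/

namespace SchottkyModel

/-- Invariance of the cross-ratio: each z − w equals num z · den w − num w · den z up to sign, so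
the inequality may be read in the model of the unit disk and the exterior of the circle of radius
e^l. -/
theorem IsConformalDistance.mul_le {K₁ K₂ : Set ℂ} {l : ℝ} (h : IsConformalDistance K₁ K₂ l)
    {z₁ z₂ w₁ w₂ : ℂ} (hz₁ : z₁ ∈ K₁) (hz₂ : z₂ ∈ K₁) (hw₁ : w₁ ∈ K₂) (hw₂ : w₂ ∈ K₂) :
    ‖z₁ - z₂‖ * ‖w₁ - w₂‖ * (1 - Real.exp (-l)) ^ 2 ≤
      4 * Real.exp (-l) * (‖z₁ - w₁‖ * ‖z₂ - w₂‖) := by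
  obtain ⟨hl, g, h1, h2⟩ := h
  have hle : Real.exp (-l) ≤ 1 := Real.exp_le_one_iff.2 (by linarith)
  have he := Real.exp_pos (-l)
  have h2' : ∀ {w}, w ∈ K₂ → ‖den g w‖ ≤ Real.exp (-l) * ‖num g w‖ := fun {w} hw => by
    have := mul_le_mul_of_nonneg_left ((h2 w).1 hw) he.le
    rwa [← mul_assoc, ← Real.exp_add, neg_add_cancel, Real.exp_zero, one_mul] at this
  have hzz : ‖z₁ - z₂‖ ≤ 2 * (‖den g z₁‖ * ‖den g z₂‖) := by
    rw [← num_mul_den_sub g]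
    refine (norm_sub_le _ _).trans ?_
    rw [norm_mul, norm_mul]
    have a1 := mul_le_mul_of_nonneg_right ((h1 _).1 hz₁) (norm_nonneg (den g z₂))
    have a2 := mul_le_mul_of_nonneg_right ((h1 _).1 hz₂) (norm_nonneg (den g z₁))
    linarith
  have hww : ‖w₁ - w₂‖ ≤ 2 * Real.exp (-l) * (‖num g w₁‖ * ‖num g w₂‖) := by
    rw [← num_mul_den_sub g]
    refine (norm_sub_le _ _).trans ?_
    rw [norm_mul, norm_mul]
    have a1 := mul_le_mul_of_nonneg_left (h2' hw₁) (norm_nonneg (num g w₂))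
    have a2 := mul_le_mul_of_nonneg_left (h2' hw₂) (norm_nonneg (num g w₁))
    linarith
  have hzw : ∀ {z w}, z ∈ K₁ → w ∈ K₂ →
      ‖den g z‖ * ‖num g w‖ * (1 - Real.exp (-l)) ≤ ‖z - w‖ := fun {z w} hz hw => by
    rw [norm_sub_rev z w, ← num_mul_den_sub g w z]
    refine le_trans ?_ (norm_sub_norm_le _ _)
    rw [norm_mul, norm_mul]
    have a1 := mul_le_mul ((h1 z).1 hz) (h2' hw) (norm_nonneg _) (norm_nonneg _)
    linarith
  have e1 := mul_le_mul hzz hww (norm_nonneg _) (by positivity)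
  have e2 := mul_le_mul (hzw hz₁ hw₁) (hzw hz₂ hw₂)
    (mul_nonneg (by positivity) (by linarith)) (norm_nonneg _)
  calc ‖z₁ - z₂‖ * ‖w₁ - w₂‖ * (1 - Real.exp (-l)) ^ 2
      ≤ (2 * (‖den g z₁‖ * ‖den g z₂‖) * (2 * Real.exp (-l) * (‖num g w₁‖ * ‖num g w₂‖))) *
        (1 - Real.exp (-l)) ^ 2 := mul_le_mul_of_nonneg_right e1 (sq_nonneg _)
    _ = 4 * Real.exp (-l) * ((‖den g z₁‖ * ‖num g w₁‖ * (1 - Real.exp (-l))) *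
        (‖den g z₂‖ * ‖num g w₂‖ * (1 - Real.exp (-l)))) := by ring
    _ ≤ _ := mul_le_mul_of_nonneg_left e2 (by positivity)

theorem arcLength_univ (c : ℂ) {r : ℝ} (hr : 0 ≤ r) :
    arcLength c r univ = ENNReal.ofReal (2 * Real.pi * r) := by
  have h := lintegral_arcLength (c := c) (r := r) (f := fun _ => 1) aemeasurable_const
  rw [lintegral_one] at h
  rw [h, lintegral_one, Measure.restrict_apply_univ, Real.volume_Ioc, ← ENNReal.ofReal_mul hr]
  congr 1
  ring

/-- A column is the image of a basis vector. -/
theorem IsBoundedMatrix.summable_sq {I : Type*} {m : I → I → ℝ} (h : IsBoundedMatrix m) (j : I) :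
    Summable fun i => m i j ^ 2 := by
  classical
  obtain ⟨A, hA⟩ := h
  have h1 := (lp.memℓp (A (lp.single 2 j (1 : ℝ)))).summable (by norm_num)
  simp only [ENNReal.toReal_ofNat, Real.rpow_ofNat, Real.norm_eq_abs, sq_abs] at h1
  refine h1.congr fun i => ?_
  rw [← hA i j]

end SchottkyModel

namespace SchottkyCurve

variable {I : Type*} {X : SchottkyCurve I}

theorem exp_sub_one_mul_le {i j : I} (hij : j ≠ i) {z ζ : ℂ}
    (hz : z ∈ sphere (X.center i) (X.radius i)) (hζ : ζ ∈ closedBall (X.center j) (X.radius j)) :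
    (Real.exp (2 * X.ε) - 1) * X.radius i ≤ ‖z - ζ‖ := by
  have h1 := X.norm_sub_center_gt hij hζ
  rw [mem_sphere_iff_norm] at hz
  have h2 : ‖ζ - X.center i‖ ≤ ‖z - ζ‖ + ‖z - X.center i‖ := by
    rw [norm_sub_rev z ζ]
    have := norm_add_le (ζ - z) (z - X.center i)
    rwa [sub_add_sub_cancel] at this
  linarith

/-- The cross-ratio estimate for z, ζ and their antipodes, which are at distances 2 r_i and 2 r_j
from them. The distance of the antipodes is comparable with ‖z − ζ‖ because the gap around K_i is at
least (e^{2ε} − 1) r_i, and likewise for K_j. The sums of e^{−l} are those of the squares of the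
matrix entries e^{−l/2}. -/
theorem exists_radius_mul_radius_le (X : SchottkyCurve I) : ∃ C : ℝ, 0 ≤ C ∧ ∃ l : I → I → ℝ,
    (∀ j, Summable fun i => Real.exp (-(l i j))) ∧ ∀ i j, i ≠ j →
      ∀ z ∈ sphere (X.center i) (X.radius i), ∀ ζ ∈ sphere (X.center j) (X.radius j),
        X.radius i * X.radius j ≤ C * Real.exp (-(l i j)) * ‖z - ζ‖ ^ 2 := by
  obtain ⟨l, -, hl, ⟨δ, hδ, hle⟩, hb⟩ := X.wellSeparated
  have hq := X.one_lt_exp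
  set q := Real.exp (2 * X.ε) with hqdef
  have ha : 0 < 1 - Real.exp (-δ) := by
    have : Real.exp (-δ) < 1 := Real.exp_lt_one_iff.2 (by linarith)
    linarith
  refine ⟨(1 + 4 / (q - 1)) / (1 - Real.exp (-δ)) ^ 2,
    div_nonneg (add_nonneg zero_le_one (div_nonneg (by norm_num) (by linarith))) (sq_nonneg _), l,
    fun j => ?_, fun i j hij z hz ζ hζ => ?_⟩
  · refine (hb.summable_sq j).congr fun i => ?_
    rw [← Real.exp_nat_mul]
    congr 1
    push_cast
    ring
  · have ri := X.radius_pos i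
    have rj := X.radius_pos j
    have sub : ∀ k, closedBall (X.center k) (X.radius k) ⊆
        closedBall (X.center k) (q * X.radius k) := fun k =>
      closedBall_subset_closedBall (by have := X.radius_pos k; nlinarith)
    have anti : ∀ {k z}, z ∈ sphere (X.center k) (X.radius k) →
        2 * X.center k - z ∈ closedBall (X.center k) (X.radius k) := fun {k z} hz => by
      rw [mem_sphere_iff_norm] at hz
      rw [mem_closedBall_iff_norm, show 2 * X.center k - z - X.center k = -(z - X.center k) by ring,
        norm_neg, hz]
    have dist : ∀ {k z}, z ∈ sphere (X.center k) (X.radius k) →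
        ‖z - (2 * X.center k - z)‖ = 2 * X.radius k := fun {k z} hz => by
      rw [mem_sphere_iff_norm] at hz
      rw [show z - (2 * X.center k - z) = 2 * (z - X.center k) by ring, norm_mul, hz]
      norm_num
    have h := (hl i j hij).mul_le (sub i (sphere_subset_closedBall hz)) (sub i (anti hz))
      (sub j (sphere_subset_closedBall hζ)) (sub j (anti hζ))
    rw [dist hz, dist hζ] at h
    have h1 := exp_sub_one_mul_le hij.symm hz (sphere_subset_closedBall hζ)
    have h2 := exp_sub_one_mul_le hij hζ (sphere_subset_closedBall hz)
    rw [norm_sub_rev] at h2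
    rw [← hqdef] at h1 h2
    have h3 : ‖(2 * X.center i - z) - (2 * X.center j - ζ)‖ ≤
        2 * X.radius i + 2 * X.radius j + ‖z - ζ‖ := by
      rw [← dist hz, ← dist hζ, show (2 * X.center i - z) - (2 * X.center j - ζ) =
        -(z - (2 * X.center i - z)) + (ζ - (2 * X.center j - ζ)) + (z - ζ) by ring]
      refine (norm_add₃_le).trans ?_
      rw [norm_neg]
    have h4 : 2 * X.radius i + 2 * X.radius j + ‖z - ζ‖ ≤ (1 + 4 / (q - 1)) * ‖z - ζ‖ := by
      have : 4 / (q - 1) * ‖z - ζ‖ = 4 * (‖z - ζ‖ / (q - 1)) := by ring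
      have e1 : X.radius i ≤ ‖z - ζ‖ / (q - 1) := by
        rw [le_div_iff₀ (by linarith)]
        linarith
      have e2 : X.radius j ≤ ‖z - ζ‖ / (q - 1) := by
        rw [le_div_iff₀ (by linarith)]
        linarith
      rw [add_mul, this]
      linarith
    have h5 : (1 - Real.exp (-δ)) ^ 2 ≤ (1 - Real.exp (-(l i j))) ^ 2 := by
      have : Real.exp (-(l i j)) ≤ Real.exp (-δ) := Real.exp_le_exp.2 (by linarith [hle i j hij])
      exact pow_le_pow_left₀ ha.le (by linarith) 2
    have h6 : X.radius i * X.radius j * (1 - Real.exp (-δ)) ^ 2 ≤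
        (1 + 4 / (q - 1)) * Real.exp (-(l i j)) * ‖z - ζ‖ ^ 2 := by
      have e1 := mul_le_mul_of_nonneg_left h5 (mul_pos ri rj).le
      have e2 := mul_le_mul_of_nonneg_left (h3.trans h4)
        (mul_nonneg (Real.exp_pos (-(l i j))).le (norm_nonneg (z - ζ)))
      linarith
    have h7 : (1 + 4 / (q - 1)) / (1 - Real.exp (-δ)) ^ 2 * Real.exp (-(l i j)) * ‖z - ζ‖ ^ 2 =
        (1 + 4 / (q - 1)) * Real.exp (-(l i j)) * ‖z - ζ‖ ^ 2 / (1 - Real.exp (-δ)) ^ 2 := by ring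
    rw [h7, le_div_iff₀ (by positivity)]
    exact h6

/-- The rows of the Hilbert operator are Hilbert–Schmidt operators. -/
theorem tsum_kernelEnergy_kernelX_ne_top (X : SchottkyCurve I) (i : I) :
    ∑' j, X.kernelEnergy i j (kernelX i j) ≠ ∞ := by
  obtain ⟨C, hC, l, hs, h⟩ := X.exists_radius_mul_radius_le
  have hs' : Summable fun j => (2 * Real.pi) ^ 2 * C * Real.exp (-(l j i)) := (hs i).mul_left _
  refine ne_top_of_le_ne_top hs'.tsum_ofReal_ne_top (ENNReal.tsum_le_tsum fun j => ?_)
  by_cases hij : j = i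
  · subst hij
    simp [kernelEnergy, kernelX_self]
  · have ri := X.radius_pos i
    have rj := X.radius_pos j
    -- A pointwise bound for |z − ζ|⁻²; the radii cancel against the lengths of the two circles, and
    -- only the summable e^{−l} is left.
    set B := C * Real.exp (-(l j i)) / (X.radius j * X.radius i) with hB
    have hB0 : 0 ≤ B := by positivity
    have hle : X.kernelEnergy i j (kernelX i j) ≤
        ∫⁻ _, ∫⁻ _, ENNReal.ofReal B ∂X.arc j ∂X.arc i := by
      refine lintegral_mono_ae (ae_arcLength_of_forall_mem_sphere ri.le fun z hz => ?_)
      refine lintegral_mono_ae (ae_arcLength_of_forall_mem_sphere rj.le fun ζ hζ => ?_)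
      have h0 := norm_pos_iff.2 (X.sub_ne_zero_of_ne hij (sphere_subset_closedBall hz)
        (sphere_subset_closedBall hζ))
      have h1 := h j i hij ζ hζ z hz
      rw [norm_sub_rev] at h1
      rw [kernelX_of_ne hij, ← ofReal_norm_sq, norm_inv, inv_pow]
      refine ENNReal.ofReal_le_ofReal ?_
      rw [hB, inv_eq_one_div, div_le_div_iff₀ (by positivity) (by positivity)]
      linarith
    refine hle.trans (le_of_eq ?_)
    rw [lintegral_const, lintegral_const, arcLength_univ _ ri.le, arcLength_univ _ rj.le,
      ← ENNReal.ofReal_mul hB0, ← ENNReal.ofReal_mul (by positivity)]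
    congr 1
    rw [hB]
    field_simp

end SchottkyCurve

/-! ### Integrals of |·|^(−1/2) over a circle, uniformly in the position of the singularity. -/

namespace SchottkyModel

section SingularIntegral

theorem lintegral_enorm_rpow_neg_half_lt_top (b : ℝ) :
    ∫⁻ x in Icc (-b) b, ‖x‖ₑ ^ (-(1 / 2) : ℝ) < ∞ := by
  rw [setLIntegral_congr Ioc_ae_eq_Icc.symm]
  have h : IntervalIntegrable (fun x : ℝ => |x| ^ (-(1 / 2) : ℝ)) volume (-b) b := by
    refine intervalIntegrable_of_even (fun x => by rw [abs_neg]) fun x hx => ?_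
    refine (intervalIntegral.intervalIntegrable_rpow' (r := -(1 / 2)) (by norm_num)).congr ?_
    intro y hy
    rw [uIoc_of_le hx.le] at hy
    simp only [abs_of_pos hy.1]
  refine lt_of_le_of_lt ?_ h.1.2
  refine lintegral_mono_ae ?_
  have h0 : ∀ᵐ x : ℝ ∂volume.restrict (Ioc (-b) b), x ≠ 0 :=
    ae_restrict_of_ae (Measure.ae_ne volume 0)
  filter_upwards [h0] with x hx
  have hx' := abs_pos.2 hx
  rw [← ofReal_norm, ← ofReal_norm, Real.norm_eq_abs, ENNReal.ofReal_rpow_of_pos hx',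
    Real.norm_of_nonneg (by positivity)]

/-- The range of a allows for an argument in (−π, π] and for its shift by 2π; θ − a then stays in
[−5π, 5π]. -/
theorem exists_setLIntegral_sub_le : ∃ C : ℝ≥0∞, C ≠ ∞ ∧ ∀ a : ℝ, |a| ≤ 3 * Real.pi →
    ∫⁻ θ in Ioc 0 (2 * Real.pi), ‖θ - a‖ₑ ^ (-(1 / 2) : ℝ) ≤ C := by
  set b := 5 * Real.pi with hb
  refine ⟨_, (lintegral_enorm_rpow_neg_half_lt_top b).ne, fun a ha => ?_⟩
  have hπ := Real.pi_pos
  rw [← lintegral_indicator measurableSet_Ioc, ← lintegral_indicator measurableSet_Icc,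
    ← lintegral_sub_right_eq_self ((Icc (-b) b).indicator fun x => ‖x‖ₑ ^ (-(1 / 2) : ℝ)) a]
  refine lintegral_mono fun θ => ?_
  rw [abs_le] at ha
  by_cases hθ : θ ∈ Ioc 0 (2 * Real.pi)
  · have : θ - a ∈ Icc (-b) b := ⟨by linarith [hθ.1], by linarith [hθ.2]⟩
    rw [indicator_of_mem hθ, indicator_of_mem this]
  · rw [indicator_of_notMem hθ]
    exact zero_le

/-- The radial projection e^{iφ} of w is no farther from w than e^{iθ} is, so |e^{iθ} − w| is at
least half of the chord |e^{iθ} − e^{iφ}|. -/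
theorem norm_exp_sub_ge {θ φ : ℝ} {w : ℂ} (hw : w = ‖w‖ * Complex.exp (φ * Complex.I)) :
    |Real.sin ((θ - φ) / 2)| ≤ ‖Complex.exp (θ * Complex.I) - w‖ := by
  have h1 : ‖Complex.exp (θ * Complex.I) - Complex.exp (φ * Complex.I)‖ =
      2 * |Real.sin ((θ - φ) / 2)| := by
    have e : Complex.exp (θ * Complex.I) - Complex.exp (φ * Complex.I) =
        Complex.exp (φ * Complex.I) * (Complex.exp (Complex.I * ((θ - φ : ℝ) : ℂ)) - 1) := by
      rw [mul_sub, ← Complex.exp_add, mul_one]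
      congr 2
      push_cast
      ring
    rw [e, norm_mul, Complex.norm_exp_ofReal_mul_I, Complex.norm_exp_I_mul_ofReal_sub_one, one_mul,
      norm_mul, Real.norm_eq_abs, Real.norm_eq_abs, abs_two]
  have h2 : ‖w - Complex.exp (φ * Complex.I)‖ ≤ ‖Complex.exp (θ * Complex.I) - w‖ := by
    have e : w - Complex.exp (φ * Complex.I) =
        ((‖w‖ - 1 : ℝ) : ℂ) * Complex.exp (φ * Complex.I) := by
      conv_lhs => rw [hw]
      push_cast
      ring
    rw [e, norm_mul, Complex.norm_exp_ofReal_mul_I, mul_one, Complex.norm_real, Real.norm_eq_abs,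
      norm_sub_rev]
    have := abs_norm_sub_norm_le w (Complex.exp (θ * Complex.I))
    rwa [Complex.norm_exp_ofReal_mul_I] at this
  have h3 := norm_sub_le_norm_sub_add_norm_sub (Complex.exp (θ * Complex.I)) w
    (Complex.exp (φ * Complex.I))
  linarith

theorem rpow_neg_half_le_of_le {a b : ℝ≥0∞} (h : a ≤ b) :
    b ^ (-(1 / 2) : ℝ) ≤ a ^ (-(1 / 2) : ℝ) := by
  rw [ENNReal.rpow_neg, ENNReal.rpow_neg, ENNReal.inv_le_inv]
  exact ENNReal.rpow_le_rpow h (by norm_num)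

theorem rpow_neg_half_mul_ofReal {a : ℝ} (ha : 0 < a) (b : ℝ≥0∞) :
    (ENNReal.ofReal a * b) ^ (-(1 / 2) : ℝ) =
      ENNReal.ofReal a ^ (-(1 / 2) : ℝ) * b ^ (-(1 / 2) : ℝ) := by
  have h0 : ENNReal.ofReal a ≠ 0 := by simpa using ha
  by_cases hb : b = 0
  · subst hb
    rw [mul_zero, ENNReal.zero_rpow_of_neg (by norm_num), ENNReal.mul_top]
    rw [Ne, ENNReal.rpow_eq_zero_iff]
    simp [h0]
  · exact ENNReal.mul_rpow_of_ne_zero h0 hb _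

/-- The integrals of `|e ^ {i θ} - w| ^ (- 1 / 2)` are uniformly bounded. -/
theorem exists_lintegral_exp_sub_le : ∃ C : ℝ≥0∞, C ≠ ∞ ∧ ∀ w : ℂ,
    ∫⁻ θ in Ioc 0 (2 * Real.pi), ‖Complex.exp (θ * Complex.I) - w‖ₑ ^ (-(1 / 2) : ℝ) ≤ C := by
  obtain ⟨C, hC, h⟩ := exists_setLIntegral_sub_le
  set k : ℝ≥0∞ := ENNReal.ofReal (1 / Real.pi) ^ (-(1 / 2) : ℝ) with hk
  have hπ := Real.pi_pos
  have hkt : k ≠ ∞ := by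
    rw [hk, ENNReal.ofReal_rpow_of_pos (by positivity)]
    exact ENNReal.ofReal_ne_top
  refine ⟨k * (C + C), ENNReal.mul_ne_top hkt (by simpa using hC), fun w => ?_⟩
  set φ := Complex.arg w with hφ
  have hw : w = ‖w‖ * Complex.exp (φ * Complex.I) := (Complex.norm_mul_exp_arg_mul_I w).symm
  have hφ1 := Complex.neg_pi_lt_arg w
  have hφ2 := Complex.arg_le_pi w
  have key : ∀ θ ∈ Ioc 0 (2 * Real.pi),
      ‖Complex.exp (θ * Complex.I) - w‖ₑ ^ (-(1 / 2) : ℝ) ≤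
        k * (‖θ - φ‖ₑ ^ (-(1 / 2) : ℝ) + ‖θ - (φ + 2 * Real.pi)‖ₑ ^ (-(1 / 2) : ℝ)) := by
    intro θ hθ
    have hle : ∀ a : ℝ, 1 / Real.pi * |θ - a| ≤ ‖Complex.exp (θ * Complex.I) - w‖ →
        ‖Complex.exp (θ * Complex.I) - w‖ₑ ^ (-(1 / 2) : ℝ) ≤ k * ‖θ - a‖ₑ ^ (-(1 / 2) : ℝ) := by
      intro a ha
      rw [hk, ← rpow_neg_half_mul_ofReal (by positivity)]
      refine rpow_neg_half_le_of_le ?_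
      rw [← ofReal_norm, ← ofReal_norm, ← ENNReal.ofReal_mul (by positivity)]
      exact ENNReal.ofReal_le_ofReal ha
    have hs := norm_exp_sub_ge (θ := θ) hw
    rw [mul_add]
    -- The sine vanishes at θ = φ and at θ = φ + 2π; θ is compared with the nearer of the two.
    rcases le_total (θ - φ) Real.pi with h1 | h1
    · refine (hle φ (le_trans ?_ hs)).trans le_self_add
      have h2 : |(θ - φ) / 2| ≤ Real.pi / 2 := by
        rw [abs_le]
        constructor <;> linarith [hθ.1]
      refine le_trans (le_of_eq ?_) (Real.mul_abs_le_abs_sin h2)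
      rw [abs_div, abs_two]
      ring
    · refine (hle (φ + 2 * Real.pi) (le_trans ?_ hs)).trans le_add_self
      have h2 : |(θ - (φ + 2 * Real.pi)) / 2| ≤ Real.pi / 2 := by
        rw [abs_le]
        constructor <;> linarith [hθ.2]
      have h3 := Real.mul_abs_le_abs_sin h2
      have h4 : (θ - (φ + 2 * Real.pi)) / 2 = (θ - φ) / 2 - Real.pi := by ring
      rw [h4, Real.sin_sub_pi, abs_neg, ← h4] at h3
      refine le_trans (le_of_eq ?_) h3
      rw [abs_div, abs_two]
      ring
  have hm : ∀ a : ℝ, Measurable fun θ : ℝ => ‖θ - a‖ₑ ^ (-(1 / 2) : ℝ) := fun a =>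
    (measurable_id.sub_const a).enorm.pow_const _
  refine (setLIntegral_mono' measurableSet_Ioc key).trans ?_
  rw [lintegral_const_mul' _ _ hkt, lintegral_add_left (hm φ)]
  gcongr
  · exact h φ (abs_le.2 ⟨by linarith, by linarith⟩)
  · exact h _ (abs_le.2 ⟨by linarith, by linarith⟩)

theorem exists_lintegral_sub_le : ∃ C : ℝ≥0∞, C ≠ ∞ ∧ ∀ (c w : ℂ) (r : ℝ), 0 < r →
    ∫⁻ z, ‖(z - w) / r‖ₑ ^ (-(1 / 2) : ℝ) ∂arcLength c r ≤ C * ENNReal.ofReal r := by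
  obtain ⟨C, hC, h⟩ := exists_lintegral_exp_sub_le
  refine ⟨C, hC, fun c w r hr => ?_⟩
  have hr0 : (r : ℂ) ≠ 0 := by exact_mod_cast hr.ne'
  have hm : Measurable fun z : ℂ => ‖(z - w) / r‖ₑ ^ (-(1 / 2) : ℝ) :=
    ((measurable_id.sub_const w).div_const _).enorm.pow_const _
  rw [lintegral_arcLength hm.aemeasurable, mul_comm]
  gcongr
  refine le_trans (le_of_eq ?_) (h ((w - c) / r))
  refine lintegral_congr fun θ => ?_
  rw [← circleMap_sub_div (c := c) hr]
  congr 2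
  ring

end SingularIntegral

end SchottkyModel

/-! ### Uniform bounds for negative powers of fractional-linear functions. -/

namespace SchottkyModel

section SingularIntegral

/-- The function is (1 + τ)(z − w)/(z − ξ) with w its zero. The constant must not depend on τ, and
the normalization at z = ζ, where the function is 1, provides this: near w it is comparable with |z
− w|/r or larger, and far from w it is bounded below. -/
theorem exists_le_norm_one_add_mul {q : ℝ} (hq : 1 < q) {c ζ ξ : ℂ} {r : ℝ} (hr : 0 < r)
    (hζ : q * r ≤ ‖ζ - c‖) (hξ : ‖ξ - c‖ < r) (τ : ℂ) : ∃ w : ℂ, ∀ z ∈ sphere c r,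
      1 ≤ 5 * ((q + 1) / (q - 1)) * ‖1 + τ * ((z - ζ) / (z - ξ))‖ ∨
      ‖(z - w) / r‖ ≤ 5 * ((q + 1) / (q - 1)) * ‖1 + τ * ((z - ζ) / (z - ξ))‖ := by
  have hq1 : 0 < q - 1 := by linarith
  set k := (q + 1) / (q - 1) with hk
  have hkq : k * (q - 1) = q + 1 := div_mul_cancel₀ _ hq1.ne'
  have hk0 : 0 < k := by positivity
  have hξζ : (q - 1) * r ≤ ‖ξ - ζ‖ := by
    have := norm_sub_le_norm_sub_add_norm_sub ζ ξ c
    rw [norm_sub_rev ζ ξ] at this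
    linarith
  have hd0 : 0 < ‖ξ - ζ‖ := lt_of_lt_of_le (by positivity) hξζ
  have h2r : 2 * r ≤ k * ‖ξ - ζ‖ := by nlinarith
  have hzξ : ∀ z ∈ sphere c r, z - ξ ≠ 0 ∧ ‖z - ξ‖ ≤ 2 * r := fun z hz => by
    rw [mem_sphere_iff_norm] at hz
    constructor
    · intro h
      rw [sub_eq_zero.1 h] at hz
      exact hξ.ne hz
    · have := norm_sub_le_norm_sub_add_norm_sub z c ξ
      rw [norm_sub_rev c ξ] at this
      linarith
  by_cases hτ : 1 + τ = 0
  -- The zero is at infinity; the first alternative always holds and w is arbitrary.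
  · refine ⟨0, fun z hz => Or.inl ?_⟩
    obtain ⟨h0, h1⟩ := hzξ z hz
    have e : 1 + τ * ((z - ζ) / (z - ξ)) = (ζ - ξ) / (z - ξ) := by
      rw [show τ = -1 by linear_combination hτ]
      field_simp
      ring
    rw [e, norm_div, norm_sub_rev ζ ξ, mul_div_assoc', le_div_iff₀ (norm_pos_iff.2 h0)]
    nlinarith
  · set w := (ξ + τ * ζ) / (1 + τ) with hw
    refine ⟨w, fun z hz => ?_⟩
    obtain ⟨h0, h1⟩ := hzξ z hz
    -- Dividing the two identities eliminates 1 + τ, which is neither bounded nor bounded away from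
    -- 0.
    have e1 : (1 + τ) * (w - ζ) = ξ - ζ := by
      rw [hw]
      field_simp
      ring
    have e2 : (1 + τ * ((z - ζ) / (z - ξ))) * (z - ξ) = (1 + τ) * (z - w) := by
      rw [hw]
      field_simp
      ring
    have n1 := congrArg norm e1
    have n2 := congrArg norm e2
    rw [norm_mul, norm_mul] at n2
    rw [norm_mul] at n1
    set P := ‖1 + τ * ((z - ζ) / (z - ξ))‖ with hP
    have hwζ : ‖w - ζ‖ ≤ ‖z - w‖ + ‖z - ζ‖ := by
      have := norm_sub_le_norm_sub_add_norm_sub w z ζ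
      rwa [norm_sub_rev w z] at this
    have hzζ : ‖z - ζ‖ ≤ 2 * k * ‖ξ - ζ‖ := by
      have h3 := norm_sub_le_norm_sub_add_norm_sub z ξ ζ
      have : 1 ≤ k := by rw [hk, le_div_iff₀ hq1]; linarith
      nlinarith
    have hn : ‖(z - w) / r‖ = ‖z - w‖ / r := by
      rw [norm_div, Complex.norm_real, Real.norm_eq_abs, abs_of_pos hr]
    have ht : 0 < ‖1 + τ‖ := norm_pos_iff.2 hτ
    have key : ‖z - w‖ * ‖ξ - ζ‖ = P * (‖z - ξ‖ * ‖w - ζ‖) := by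
      have : ‖1 + τ‖ * (‖z - w‖ * ‖ξ - ζ‖) = ‖1 + τ‖ * (P * (‖z - ξ‖ * ‖w - ζ‖)) := by
        calc _ = (‖1 + τ‖ * ‖z - w‖) * ‖ξ - ζ‖ := by ring
          _ = _ := by rw [← n2, ← n1]; ring
      exact mul_left_cancel₀ ht.ne' this
    have hP0 : 0 ≤ P := norm_nonneg _
    have key2 : ‖z - w‖ * ‖ξ - ζ‖ ≤ P * (2 * r * (‖z - w‖ + 2 * k * ‖ξ - ζ‖)) := by
      rw [key]
      have := mul_le_mul h1 (hwζ.trans (add_le_add_right hzζ _)) (norm_nonneg _) (by positivity)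
      exact mul_le_mul_of_nonneg_left this hP0
    rcases le_total r ‖z - w‖ with h | h
    · left
      have h4 : 2 * r * (‖z - w‖ + 2 * k * ‖ξ - ζ‖) ≤ 5 * k * (‖z - w‖ * ‖ξ - ζ‖) := by
        have a1 := mul_le_mul_of_nonneg_right h2r (norm_nonneg (z - w))
        have a2 := mul_le_mul_of_nonneg_right h (by positivity : 0 ≤ 4 * k * ‖ξ - ζ‖)
        linarith
      have h5 := key2.trans (mul_le_mul_of_nonneg_left h4 hP0)
      have h6 : 0 < ‖z - w‖ * ‖ξ - ζ‖ := mul_pos (hr.trans_le h) hd0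
      refine le_of_mul_le_mul_right ?_ h6
      linarith
    · right
      rw [hn, div_le_iff₀ hr]
      have h4 : 2 * r * (‖z - w‖ + 2 * k * ‖ξ - ζ‖) ≤ 5 * k * (r * ‖ξ - ζ‖) := by
        have a1 := mul_le_mul_of_nonneg_right h2r hr.le
        have a2 := mul_le_mul_of_nonneg_left h (by positivity : 0 ≤ 2 * r)
        linarith
      have h5 := key2.trans (mul_le_mul_of_nonneg_left h4 hP0)
      refine le_of_mul_le_mul_right ?_ hd0
      linarith

/-- The exponent 1/2 is less than 1, so a simple zero on the circle or near it costs a bounded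
factor wherever it lies. -/
theorem exists_lintegral_one_add_mul_rpow_le {q : ℝ} (hq : 1 < q) : ∃ C : ℝ≥0∞, C ≠ ∞ ∧
    ∀ {c ζ ξ : ℂ} {r : ℝ}, 0 < r → q * r ≤ ‖ζ - c‖ → ‖ξ - c‖ < r → ∀ τ : ℂ,
      ∫⁻ z, ‖1 + τ * ((z - ζ) / (z - ξ))‖ₑ ^ (-(1 / 2) : ℝ) ∂arcLength c r ≤
        C * ENNReal.ofReal r := by
  obtain ⟨C, hC, h⟩ := exists_lintegral_sub_le
  have hq1 : 0 < q - 1 := by linarith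
  set k := 5 * ((q + 1) / (q - 1)) with hk
  have hk0 : 0 < k := by positivity
  set K : ℝ≥0∞ := ENNReal.ofReal k⁻¹ ^ (-(1 / 2) : ℝ) with hK
  have hKt : K ≠ ∞ := by
    rw [hK, ENNReal.ofReal_rpow_of_pos (by positivity)]
    exact ENNReal.ofReal_ne_top
  refine ⟨K * (ENNReal.ofReal (2 * Real.pi) + C), ENNReal.mul_ne_top hKt (ENNReal.add_ne_top.2 ⟨ENNReal.ofReal_ne_top, hC⟩), ?_⟩
  intro c ζ ξ r hr hζ hξ τ
  obtain ⟨w, hw⟩ := exists_le_norm_one_add_mul hq hr hζ hξ τ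
  rw [← hk] at hw
  have key : ∀ z ∈ sphere c r, ‖1 + τ * ((z - ζ) / (z - ξ))‖ₑ ^ (-(1 / 2) : ℝ) ≤
      K * (1 + ‖(z - w) / r‖ₑ ^ (-(1 / 2) : ℝ)) := fun z hz => by
    have hle : ∀ {a : ℝ}, a ≤ k * ‖1 + τ * ((z - ζ) / (z - ξ))‖ →
        ENNReal.ofReal (k⁻¹ * a) ≤ ‖1 + τ * ((z - ζ) / (z - ξ))‖ₑ := fun {a} ha => by
      rw [← ofReal_norm]
      refine ENNReal.ofReal_le_ofReal ?_
      rwa [inv_mul_le_iff₀ hk0]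
    rw [mul_add, mul_one]
    rcases hw z hz with h1 | h1
    · refine (rpow_neg_half_le_of_le (hle h1)).trans ?_
      rw [mul_one]
      exact le_self_add
    · refine (rpow_neg_half_le_of_le (hle h1)).trans ?_
      rw [ENNReal.ofReal_mul (by positivity), rpow_neg_half_mul_ofReal (by positivity), ofReal_norm]
      exact le_add_self
  refine (lintegral_mono_ae (ae_arcLength_of_forall_mem_sphere hr.le key)).trans ?_
  rw [lintegral_const_mul' _ _ hKt, lintegral_add_left measurable_const, lintegral_one,
    arcLength_univ c hr.le, ENNReal.ofReal_mul (by positivity), mul_assoc, add_mul]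
  gcongr
  exact h c w r hr

/-- Since ζ stays outside the enlarged disk, |z − ζ| varies on the circle by the bounded factor (q +
1)/(q − 1) at most, so |z − ζ|⁻² can be treated as a constant. -/
theorem exists_lintegral_cauchy_rpow_le {q : ℝ} (hq : 1 < q) : ∃ C : ℝ≥0∞, C ≠ ∞ ∧
    ∀ {c ζ ξ : ℂ} {r : ℝ}, 0 < r → q * r ≤ ‖ζ - c‖ → ‖ξ - c‖ < r → ∀ τ : ℂ,
      ∫⁻ z, ‖(z - ζ)⁻¹‖ₑ ^ 2 * ‖1 + τ * ((z - ζ) / (z - ξ))‖ₑ ^ (-(1 / 2) : ℝ) ∂arcLength c r ≤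
        C * ∫⁻ z, ‖(z - ζ)⁻¹‖ₑ ^ 2 ∂arcLength c r := by
  obtain ⟨C, hC, h⟩ := exists_lintegral_one_add_mul_rpow_le hq
  have hq1 : 0 < q - 1 := by linarith
  set k := (q + 1) / (q - 1) with hk
  have hk0 : 0 < k := by positivity
  refine ⟨C * ENNReal.ofReal (k ^ 2 / (2 * Real.pi)), ENNReal.mul_ne_top hC ENNReal.ofReal_ne_top, ?_⟩
  intro c ζ ξ r hr hζ hξ τ
  have hπ := Real.pi_pos
  set d := ‖ζ - c‖ with hd
  have hdr : 0 < d - r := by nlinarith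
  have hkd : d + r ≤ k * (d - r) := by
    rw [hk, div_mul_eq_mul_div, le_div_iff₀ hq1]
    nlinarith
  have hlow : ∀ z ∈ sphere c r, d - r ≤ ‖z - ζ‖ := fun z hz => by
    rw [mem_sphere_iff_norm] at hz
    have := norm_sub_le_norm_sub_add_norm_sub ζ z c
    rw [norm_sub_rev ζ z] at this
    linarith
  have hup : ∀ z ∈ sphere c r, ‖z - ζ‖ ≤ d + r := fun z hz => by
    rw [mem_sphere_iff_norm] at hz
    have := norm_sub_le_norm_sub_add_norm_sub z c ζ
    rw [norm_sub_rev c ζ] at this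
    linarith
  have h1 : ∫⁻ z, ‖(z - ζ)⁻¹‖ₑ ^ 2 * ‖1 + τ * ((z - ζ) / (z - ξ))‖ₑ ^ (-(1 / 2) : ℝ) ∂arcLength c r ≤
      ENNReal.ofReal (((d - r) ^ 2)⁻¹) * (C * ENNReal.ofReal r) := by
    refine le_trans ?_ (mul_le_mul_right (h hr hζ hξ τ) _)
    rw [← lintegral_const_mul' _ _ ENNReal.ofReal_ne_top]
    refine lintegral_mono_ae (ae_arcLength_of_forall_mem_sphere hr.le fun z hz => ?_)
    gcongr
    rw [← ofReal_norm_sq, norm_inv, inv_pow]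
    refine ENNReal.ofReal_le_ofReal ?_
    gcongr
    exact hlow z hz
  have h2 : ENNReal.ofReal (((d + r) ^ 2)⁻¹) * ENNReal.ofReal (2 * Real.pi * r) ≤
      ∫⁻ z, ‖(z - ζ)⁻¹‖ₑ ^ 2 ∂arcLength c r := by
    rw [← arcLength_univ c hr.le, ← lintegral_const]
    refine lintegral_mono_ae (ae_arcLength_of_forall_mem_sphere hr.le fun z hz => ?_)
    rw [← ofReal_norm_sq, norm_inv, inv_pow]
    refine ENNReal.ofReal_le_ofReal ?_
    have := hdr.trans_le (hlow z hz)
    gcongr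
    exact hup z hz
  refine h1.trans (le_trans ?_ (mul_le_mul_right h2 _))
  rw [mul_left_comm, mul_assoc]
  refine mul_le_mul_right ?_ C
  rw [← ENNReal.ofReal_mul (by positivity), ← ENNReal.ofReal_mul (by positivity),
    ← ENNReal.ofReal_mul (by positivity)]
  refine ENNReal.ofReal_le_ofReal ?_
  have e : k ^ 2 / (2 * Real.pi) * (((d + r) ^ 2)⁻¹ * (2 * Real.pi * r)) =
      k ^ 2 * ((d + r) ^ 2)⁻¹ * r := by
    field_simp
  rw [e]
  refine mul_le_mul_of_nonneg_right ?_ hr.le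
  rw [← div_eq_mul_inv, inv_eq_one_div, div_le_div_iff₀ (by positivity) (by positivity), one_mul,
    ← mul_pow]
  exact pow_le_pow_left₀ (by positivity) hkd 2

end SingularIntegral

end SchottkyModel

/-! ### Bounding one term of a sum of two kernels by a higher power of the sum. -/

namespace SchottkyModel

/-- If v exceeds p^(−1/2), then v⁴ p² ≥ 1. With a power m in place of 5 the last term would be
p^(−2/(m−1)), which is integrable across a simple zero of p on a curve for m > 3. -/
theorem le_pow_mul_add_rpow (v : ℝ≥0∞) {p : ℝ≥0∞} (hp : p ≠ ∞) :
    v ≤ v ^ 5 * p ^ 2 + p ^ (-(1 / 2) : ℝ) := by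
  by_cases hp0 : p = 0
  · rw [hp0, ENNReal.zero_rpow_of_neg (by norm_num), add_top]
    exact le_top
  by_cases h : v ≤ p ^ (-(1 / 2) : ℝ)
  · exact h.trans le_add_self
  · refine le_trans ?_ le_self_add
    have h1 : 1 ≤ v ^ 4 * p ^ 2 := by
      have h2 : (p ^ (-(1 / 2) : ℝ)) ^ 4 * p ^ 2 = 1 := by
        rw [← ENNReal.rpow_natCast, ← ENNReal.rpow_mul, ← ENNReal.rpow_natCast p 2,
          ← ENNReal.rpow_add _ _ hp0 hp]
        norm_num
      rw [← h2]
      gcongr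
      exact (not_le.1 h).le
    calc v = v * 1 := (mul_one v).symm
      _ ≤ v * (v ^ 4 * p ^ 2) := by gcongr
      _ = v ^ 5 * p ^ 2 := by ring

/-- The previous inequality with v = |A|² and p = |1 + (B/A)⁵ y/x|, as |A⁵x + B⁵y| = |A|⁵ |x| p.
Cancellation between the two terms costs only the weight p^(−1/2), in which A and B enter through
their ratio. -/
theorem enorm_mul_sq_le {A : ℂ} (hA : A ≠ 0) (B x y : ℂ) :
    ‖A * x‖ₑ ^ 2 ≤ ‖A ^ 5 * x + B ^ 5 * y‖ₑ ^ 2 +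
      ‖x‖ₑ ^ 2 * ‖1 + (B / A) ^ 5 * (y / x)‖ₑ ^ (-(1 / 2) : ℝ) := by
  by_cases hx : x = 0
  · simp [hx]
  have h := mul_le_mul_right (le_pow_mul_add_rpow (‖A‖ₑ ^ 2)
    (p := ‖1 + (B / A) ^ 5 * (y / x)‖ₑ) enorm_ne_top) (‖x‖ₑ ^ 2)
  have e : A ^ 5 * x + B ^ 5 * y = x * (A ^ 5 * (1 + (B / A) ^ 5 * (y / x))) := by
    field_simp
  rw [e]
  simp only [enorm_mul, mul_pow, enorm_pow]
  refine le_trans (le_of_eq ?_) (h.trans (le_of_eq ?_))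
  · ring
  · ring

theorem enorm_add_sq_le (x y : ℂ) : ‖x + y‖ₑ ^ 2 ≤ 2 * ‖x‖ₑ ^ 2 + 2 * ‖y‖ₑ ^ 2 := by
  simp only [← ofReal_norm_sq]
  rw [← ENNReal.ofReal_ofNat 2, ← ENNReal.ofReal_mul (by norm_num), ← ENNReal.ofReal_mul (by norm_num),
    ← ENNReal.ofReal_add (by positivity) (by positivity)]
  refine ENNReal.ofReal_le_ofReal ?_
  have := norm_add_le x y
  nlinarith [norm_nonneg (x + y), sq_nonneg (‖x‖ - ‖y‖)]

theorem enorm_sub_sq_le (x y : ℂ) : ‖x - y‖ₑ ^ 2 ≤ 2 * ‖x‖ₑ ^ 2 + 2 * ‖y‖ₑ ^ 2 := by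
  have := enorm_add_sq_le x (-y)
  rwa [enorm_neg, ← sub_eq_add_neg] at this

theorem enorm_mul_sq_le_add (x y : ℂ) : ‖x * y‖ₑ ^ 2 ≤ ‖x ^ 2‖ₑ ^ 2 + ‖y ^ 2‖ₑ ^ 2 := by
  simp only [← ofReal_norm_sq]
  rw [← ENNReal.ofReal_add (by positivity) (by positivity)]
  refine ENNReal.ofReal_le_ofReal ?_
  rw [norm_mul, norm_pow, norm_pow]
  nlinarith [sq_nonneg (‖x‖ ^ 2 - ‖y‖ ^ 2), sq_nonneg (‖x‖ * ‖y‖), sq_nonneg (‖x‖^2), sq_nonneg (‖y‖^2)]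

theorem den_inv_mobius {g : SL(2, ℂ)} {z : ℂ} (h : den g z ≠ 0) :
    den g⁻¹ (mobius g z) = (den g z)⁻¹ := by
  have hdet := det_eq_one' g
  rw [mobius]
  simp only [num, den, Matrix.SpecialLinearGroup.SL2_inv_expl] at *
  simp
  field_simp
  linear_combination hdet

theorem mobius_inv_mobius {g : SL(2, ℂ)} {z : ℂ} (h : den g z ≠ 0) :
    mobius g⁻¹ (mobius g z) = z := by
  have h1 := den_inv_mobius h
  have h2 := num_sub_mul_den (g := g) z (mobius g z)
  have h3 : num g z - mobius g z * den g z = 0 := by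
    rw [mobius]
    field_simp
    ring
  rw [h3, h1] at h2
  rw [mobius, h1]
  field_simp
  field_simp at h2
  linear_combination h2

end SchottkyModel

namespace SchottkyCurve

variable {I : Type*} {X : SchottkyCurve I}

theorem measurable_kernelX {α : Type*} [MeasurableSpace α] (i j : I) {f g : α → ℂ}
    (hf : Measurable f) (hg : Measurable g) : Measurable fun a => kernelX i j (f a) (g a) := by
  by_cases h : j = i
  · subst h
    simp only [kernelX_self]
    exact measurable_const
  · simp only [kernelX_of_ne h]
    exact (hf.sub hg).inv

theorem measurable_kernelY {α : Type*} [MeasurableSpace α] (i j : I) {f g : α → ℂ}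
    (hf : Measurable f) (hg : Measurable g) : Measurable fun a => X.kernelY i j (f a) (g a) := by
  have h2 : Measurable fun a => (den (X.φ i) (f a))⁻¹ :=
    ((continuous_den (X.φ i)).measurable.comp hf).inv
  exact h2.mul (measurable_kernelX _ _ ((measurable_mobius (X.φ i)).comp hf) hg)

/-- Passing from ∂K_i to ∂K_i' by φ_i exchanges the roles of the kernels X and Y. -/
theorem kernelY_mobius {i j : I} {z : ℂ} (hz : z ∈ sphere (X.center i) (X.radius i)) (ζ : ℂ) :
    X.kernelY (X.inv i) j (mobius (X.φ i) z) ζ = den (X.φ i) z * kernelX i j z ζ := by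
  have h0 := (X.isGluing i).den_ne_zero_of_mem_sphere hz
  rw [kernelY, X.φ_inv, X.inv_inv, den_inv_mobius h0, mobius_inv_mobius h0, _root_.inv_inv]

/-- For fixed ζ the ratio Y/X is a constant times (z − ζ)/(z − ξ) with ξ = φ_i⁻¹(ζ) inside K_i, so
the bound for fractional-linear functions applies, with that constant absorbed in t. If Y = 0, the
weight is 1; this is the reason for C + 1. -/
theorem exists_lintegral_kernelX_rpow_le (X : SchottkyCurve I) : ∃ C : ℝ≥0∞, C ≠ ∞ ∧
    ∀ (i j : I), ∀ ζ ∈ closedBall (X.center j) (X.radius j), ∀ t : ℂ,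
      ∫⁻ z, ‖kernelX i j z ζ‖ₑ ^ 2 *
          ‖1 + t * (X.kernelY i j z ζ / kernelX i j z ζ)‖ₑ ^ (-(1 / 2) : ℝ) ∂X.arc i ≤
        C * ∫⁻ z, ‖kernelX i j z ζ‖ₑ ^ 2 ∂X.arc i := by
  obtain ⟨C, hC, h⟩ := exists_lintegral_cauchy_rpow_le X.one_lt_exp
  refine ⟨C + 1, by simpa using hC, fun i j ζ hζ t => ?_⟩
  by_cases hi : j = i
  · subst hi
    simp [kernelX_self]
  by_cases hi' : j = X.inv i
  · subst hi'
    simp only [kernelY_inv, zero_div, mul_zero, add_zero, enorm_one, ENNReal.one_rpow, mul_one]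
    exact le_mul_of_one_le_left' le_add_self
  · refine le_trans ?_ (mul_le_mul_left (le_self_add (a := C)) _)
    simp only [kernelX_of_ne hi]
    refine le_trans (le_of_eq ?_) (h (X.radius_pos i) (X.norm_sub_center_gt hi hζ).le
      (norm_preimage_sub_lt hi' hζ) (t * (den (X.φ i)⁻¹ ζ)⁻¹))
    refine lintegral_congr_ae (ae_arcLength_of_forall_mem_sphere (X.radius_pos i).le fun z hz => ?_)
    simp only
    rw [kernelY_of_ne hi' hz hζ]
    congr 4
    rw [div_inv_eq_mul]
    ring

/-- The change of variables by φ_i turns both sides into those of the estimate for X on ∂K_i'. -/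
theorem exists_lintegral_kernelY_rpow_le (X : SchottkyCurve I) : ∃ C : ℝ≥0∞, C ≠ ∞ ∧
    ∀ (i j : I), ∀ ζ ∈ closedBall (X.center j) (X.radius j), ∀ t : ℂ,
      ∫⁻ z, ‖X.kernelY i j z ζ‖ₑ ^ 2 *
          ‖1 + t * (kernelX i j z ζ / X.kernelY i j z ζ)‖ₑ ^ (-(1 / 2) : ℝ) ∂X.arc i ≤
        C * ∫⁻ z, ‖X.kernelY i j z ζ‖ₑ ^ 2 ∂X.arc i := by
  obtain ⟨C, hC, h⟩ := X.exists_lintegral_kernelX_rpow_le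
  refine ⟨C, hC, fun i j ζ hζ t => ?_⟩
  have mX : Measurable fun z => kernelX (X.inv i) j z ζ :=
    measurable_kernelX _ _ measurable_id measurable_const
  have mY : Measurable fun z => X.kernelY (X.inv i) j z ζ :=
    measurable_kernelY _ _ measurable_id measurable_const
  have e1 := (X.isGluing i).lintegral_mobius (F := fun z => ‖kernelX (X.inv i) j z ζ‖ₑ ^ 2)
    (mX.enorm.pow_const 2)
  have mq : Measurable fun z => 1 + t * (X.kernelY (X.inv i) j z ζ / kernelX (X.inv i) j z ζ) :=
    ((mY.div mX).const_mul t).const_add 1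
  have mF : Measurable fun z => ‖kernelX (X.inv i) j z ζ‖ₑ ^ 2 *
      ‖1 + t * (X.kernelY (X.inv i) j z ζ / kernelX (X.inv i) j z ζ)‖ₑ ^ (-(1 / 2) : ℝ) :=
    (mX.enorm.pow_const 2).mul (mq.enorm.pow_const (-(1 / 2) : ℝ))
  have e2 := (X.isGluing i).lintegral_mobius mF
  have key : ∀ z, ‖X.kernelY i j z ζ‖ₑ ^ 2 = ENNReal.ofReal ((‖den (X.φ i) z‖ ^ 2)⁻¹) *
      ‖kernelX (X.inv i) j (mobius (X.φ i) z) ζ‖ₑ ^ 2 := fun z => by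
    rw [kernelY, enorm_mul, mul_pow, ← ofReal_norm_sq, norm_inv, inv_pow]
  simp only [key]
  rw [e1]
  refine le_trans (le_of_eq ?_) (h (X.inv i) j ζ hζ t)
  rw [← e2]
  refine lintegral_congr_ae (ae_arcLength_of_forall_mem_sphere (X.radius_pos i).le fun z hz => ?_)
  have h0 := (X.isGluing i).den_ne_zero_of_mem_sphere hz
  simp only
  rw [mul_assoc, kernelY_mobius hz, kernelY]
  congr 6
  by_cases hk : kernelX (X.inv i) j (mobius (X.φ i) z) ζ = 0
  · simp [hk]
  · field_simp

end SchottkyCurve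

/-! ### Separate estimates for the two weighted Cauchy kernels. -/

namespace SchottkyCurve

variable {I : Type*} {X : SchottkyCurve I} {i j : I}

theorem aemeasurable_of_continuousOn {k : ℂ → ℂ → ℂ}
    (hk : ContinuousOn (fun p : ℂ × ℂ => k p.1 p.2)
      (sphere (X.center i) (X.radius i) ×ˢ closedBall (X.center j) (X.radius j))) :
    AEMeasurable (fun p : ℂ × ℂ => k p.1 p.2) ((X.arc i).prod (X.arc j)) := by
  have h : ∀ i, (X.arc i).restrict (sphere (X.center i) (X.radius i)) = X.arc i := fun i =>
    Measure.restrict_eq_self_of_ae_mem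
      (ae_arcLength_of_forall_mem_sphere (X.radius_pos i).le fun z hz => hz)
  rw [← h i, ← h j, Measure.prod_restrict]
  exact (hk.mono (prod_mono_right sphere_subset_closedBall)).aemeasurable
    (isClosed_sphere.measurableSet.prod isClosed_sphere.measurableSet)

/-- Measurability of one summand is enough for additivity, so F and G need none. -/
theorem lintegral_lintegral_le_add {F G H : ℂ → ℂ → ℝ≥0∞}
    (hH : AEMeasurable (fun p : ℂ × ℂ => H p.1 p.2) ((X.arc i).prod (X.arc j)))
    (h : ∀ z ∈ sphere (X.center i) (X.radius i), ∀ ζ ∈ sphere (X.center j) (X.radius j),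
      F z ζ ≤ G z ζ + H z ζ) :
    ∫⁻ z, ∫⁻ ζ, F z ζ ∂X.arc j ∂X.arc i ≤
      ∫⁻ z, ∫⁻ ζ, G z ζ ∂X.arc j ∂X.arc i + ∫⁻ z, ∫⁻ ζ, H z ζ ∂X.arc j ∂X.arc i := by
  have hslice : ∀ᵐ z ∂X.arc i, AEMeasurable (H z) (X.arc j) := by
    refine (Measure.ae_ae_of_ae_prod hH.ae_eq_mk).mono fun z hz => ?_
    exact ⟨_, hH.measurable_mk.comp measurable_prodMk_left, hz⟩
  rw [← lintegral_add_right' _ hH.lintegral_prod_right']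
  refine lintegral_mono_ae ?_
  filter_upwards [hslice, ae_arcLength_of_forall_mem_sphere (X.radius_pos i).le
    (p := (· ∈ sphere (X.center i) (X.radius i))) fun z hz => hz] with z h1 h2
  rw [← lintegral_add_right' _ h1]
  exact lintegral_mono_ae (ae_arcLength_of_forall_mem_sphere (X.radius_pos j).le (h z h2))

theorem kernelEnergy_const_mul (a : ℂ) (k : ℂ → ℂ → ℂ) :
    X.kernelEnergy i j (fun z ζ => a * k z ζ) = ‖a‖ₑ ^ 2 * X.kernelEnergy i j k := by
  simp only [kernelEnergy, enorm_mul, mul_pow]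
  rw [← lintegral_const_mul' _ _ (by simp)]
  simp only [lintegral_const_mul' (‖a‖ₑ ^ 2) _ (by simp : ‖a‖ₑ ^ 2 ≠ ∞)]

theorem kernelEnergy_le_add {k k₁ k₂ : ℂ → ℂ → ℂ}
    (hk : ContinuousOn (fun p : ℂ × ℂ => k₂ p.1 p.2)
      (sphere (X.center i) (X.radius i) ×ˢ closedBall (X.center j) (X.radius j)))
    (h : ∀ z ∈ sphere (X.center i) (X.radius i), ∀ ζ ∈ sphere (X.center j) (X.radius j),
      ‖k z ζ‖ₑ ^ 2 ≤ ‖k₁ z ζ‖ₑ ^ 2 + ‖k₂ z ζ‖ₑ ^ 2) :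
    X.kernelEnergy i j k ≤ X.kernelEnergy i j k₁ + X.kernelEnergy i j k₂ :=
  lintegral_lintegral_le_add ((aemeasurable_of_continuousOn hk).enorm.pow_const 2) h

theorem kernelEnergy_le_two_mul_add {k k₁ k₂ : ℂ → ℂ → ℂ}
    (hk : ContinuousOn (fun p : ℂ × ℂ => k₂ p.1 p.2)
      (sphere (X.center i) (X.radius i) ×ˢ closedBall (X.center j) (X.radius j)))
    (h : ∀ z ∈ sphere (X.center i) (X.radius i), ∀ ζ ∈ sphere (X.center j) (X.radius j),
      ‖k z ζ‖ₑ ^ 2 ≤ 2 * ‖k₁ z ζ‖ₑ ^ 2 + 2 * ‖k₂ z ζ‖ₑ ^ 2) :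
    X.kernelEnergy i j k ≤ 2 * X.kernelEnergy i j k₁ + 2 * X.kernelEnergy i j k₂ := by
  have h2 : (2 : ℝ≥0∞) ≠ ∞ := by simp
  refine (lintegral_lintegral_le_add (G := fun z ζ => 2 * ‖k₁ z ζ‖ₑ ^ 2)
    (H := fun z ζ => 2 * ‖k₂ z ζ‖ₑ ^ 2)
    (((aemeasurable_of_continuousOn hk).enorm.pow_const 2).const_mul 2) h).trans (le_of_eq ?_)
  simp only [lintegral_const_mul' 2 _ h2]
  rfl

/-- The estimate of an energy by two other ones, the second of which dominates a weight. -/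
theorem kernelEnergy_le_add_weight {k s x : ℂ → ℂ → ℂ} {w : ℂ → ℂ → ℝ≥0∞} {C : ℝ≥0∞} (hC : C ≠ ∞)
    (hx : AEMeasurable (fun p : ℂ × ℂ => x p.1 p.2) ((X.arc i).prod (X.arc j)))
    (hw : AEMeasurable (fun p : ℂ × ℂ => w p.1 p.2) ((X.arc i).prod (X.arc j)))
    (h : ∀ z ∈ sphere (X.center i) (X.radius i), ∀ ζ ∈ sphere (X.center j) (X.radius j),
      ‖k z ζ‖ₑ ^ 2 ≤ ‖s z ζ‖ₑ ^ 2 + w z ζ)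
    (hwx : ∀ ζ ∈ sphere (X.center j) (X.radius j),
      ∫⁻ z, w z ζ ∂X.arc i ≤ C * ∫⁻ z, ‖x z ζ‖ₑ ^ 2 ∂X.arc i) :
    X.kernelEnergy i j k ≤ X.kernelEnergy i j s + C * X.kernelEnergy i j x := by
  refine (lintegral_lintegral_le_add hw h).trans (add_le_add_right ?_ _)
  rw [kernelEnergy, lintegral_lintegral_swap hw,
    lintegral_lintegral_swap (f := fun z ζ => ‖x z ζ‖ₑ ^ 2) (hx.enorm.pow_const 2),
    ← lintegral_const_mul' _ _ hC]
  exact lintegral_mono_ae (ae_arcLength_of_forall_mem_sphere (X.radius_pos j).le hwx)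

variable (X) in
/-- The first Cauchy kernel with a weight. -/
def weightX (i j : I) (W V : ℂ → ℂ) (n : ℤ) (z ζ : ℂ) : ℂ :=
  (W z * V (X.radius i / (ζ - X.center i))) ^ n * kernelX i j z ζ

variable (X) in
/-- The second Cauchy kernel with a weight. -/
def weightY (i j : I) (W U : ℂ → ℂ) (n : ℤ) (z ζ : ℂ) : ℂ :=
  (W z * (U ((mobius (X.φ i)⁻¹ ζ - X.center i) / X.radius i))⁻¹) ^ n * X.kernelY i j z ζ

variable {U V W : ℂ → ℂ}

theorem continuousOn_weightX (hW : ContinuousOn W (sphere (X.center i) (X.radius i)))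
    (hW0 : ∀ z, W z ≠ 0) (hV : DiffContOnCl ℂ V (ball 0 1)) (hV0 : ∀ s, V s ≠ 0) (n : ℤ) :
    ContinuousOn (fun p : ℂ × ℂ => X.weightX i j W V n p.1 p.2)
      (sphere (X.center i) (X.radius i) ×ˢ closedBall (X.center j) (X.radius j)) := by
  unfold weightX
  by_cases h : j = i
  · subst h
    simp only [kernelX_self, mul_zero]
    exact continuousOn_const
  · refine ContinuousOn.mul (ContinuousOn.zpow₀ (ContinuousOn.mul ?_ ?_) n fun p _ =>
      Or.inl (mul_ne_zero (hW0 _) (hV0 _))) continuousOn_kernelX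
    · exact hW.comp (f := Prod.fst) (by fun_prop) fun p hp => hp.1
    · exact ContinuousOn.comp (g := fun ζ => V (X.radius i / (ζ - X.center i))) (f := Prod.snd)
        (t := closedBall (X.center j) (X.radius j))
        (fun ζ hζ => (differentiableAt_outside hV h hζ).continuousAt.continuousWithinAt)
        (by fun_prop) fun p hp => hp.2

theorem continuousOn_weightY (hW : ContinuousOn W (sphere (X.center i) (X.radius i)))
    (hW0 : ∀ z, W z ≠ 0) (hU : DiffContOnCl ℂ U (ball 0 1)) (hU0 : ∀ s, U s ≠ 0) (n : ℤ) :
    ContinuousOn (fun p : ℂ × ℂ => X.weightY i j W U n p.1 p.2)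
      (sphere (X.center i) (X.radius i) ×ˢ closedBall (X.center j) (X.radius j)) := by
  unfold weightY
  by_cases h : j = X.inv i
  · subst h
    simp only [kernelY_inv, mul_zero]
    exact continuousOn_const
  · refine ContinuousOn.mul (ContinuousOn.zpow₀ (ContinuousOn.mul ?_ ?_) n fun p _ =>
      Or.inl (mul_ne_zero (hW0 _) (inv_ne_zero (hU0 _)))) continuousOn_kernelY
    · exact hW.comp (f := Prod.fst) (by fun_prop) fun p hp => hp.1
    · exact ContinuousOn.comp
        (g := fun ζ => (U ((mobius (X.φ i)⁻¹ ζ - X.center i) / X.radius i))⁻¹) (f := Prod.snd)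
        (t := closedBall (X.center j) (X.radius j))
        (fun ζ hζ => (differentiableAt_inside hU hU0 h hζ).continuousAt.continuousWithinAt)
        (by fun_prop) fun p hp => hp.2

theorem aemeasurable_ratio (hU : DiffContOnCl ℂ U (ball 0 1)) (hU0 : ∀ s, U s ≠ 0)
    (hV : DiffContOnCl ℂ V (ball 0 1)) (hV0 : ∀ s, V s ≠ 0) (h : j ≠ i) (h' : j ≠ X.inv i) (n : ℤ) :
    AEMeasurable (fun ζ => ((U ((mobius (X.φ i)⁻¹ ζ - X.center i) / X.radius i))⁻¹ /
      V (X.radius i / (ζ - X.center i))) ^ n) (X.arc j) := by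
  refine AEStronglyMeasurable.aemeasurable
    (aestronglyMeasurable_arcLength_of_continuousOn (X.radius_pos j).le ?_)
  refine ContinuousOn.zpow₀ ?_ n fun ζ _ => Or.inl (div_ne_zero (inv_ne_zero (hU0 _)) (hV0 _))
  refine ContinuousOn.div (fun ζ hζ => ?_) (fun ζ hζ => ?_) fun ζ _ => hV0 _
  · exact (differentiableAt_inside hU hU0 h'
      (sphere_subset_closedBall hζ)).continuousAt.continuousWithinAt
  · exact (differentiableAt_outside hV h
      (sphere_subset_closedBall hζ)).continuousAt.continuousWithinAt

theorem zpow_pow_five (a : ℂ) (n : ℤ) : (a ^ n) ^ 5 = a ^ (5 * n) := by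
  rw [mul_comm, zpow_mul]
  norm_cast

/-- The factor W(z) cancels in the ratio of the two weights. The ratio is a function t of ζ alone,
so the inner integral over z is bounded uniformly in t, and no size bound on U, V or W enters C. -/
theorem exists_kernelEnergy_weightX_le (X : SchottkyCurve I) : ∃ C : ℝ≥0∞, C ≠ ∞ ∧
    ∀ (i j : I) (U V W : ℂ → ℂ), DiffContOnCl ℂ U (ball 0 1) → (∀ s, U s ≠ 0) →
      DiffContOnCl ℂ V (ball 0 1) → (∀ s, V s ≠ 0) → (∀ z, W z ≠ 0) → ∀ n : ℤ,
      X.kernelEnergy i j (X.weightX i j W V n) ≤ X.kernelEnergy i j (fun z ζ =>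
        X.weightX i j W V (5 * n) z ζ + X.weightY i j W U (5 * n) z ζ) +
        C * X.kernelEnergy i j (kernelX i j) := by
  obtain ⟨C, hC, hle⟩ := X.exists_lintegral_kernelX_rpow_le
  refine ⟨C, hC, fun i j U V W hU hU0 hV hV0 hW0 n => ?_⟩
  by_cases hi : j = i
  · subst hi
    simp [kernelEnergy, weightX, kernelX_self]
  have mX : Measurable fun p : ℂ × ℂ => kernelX i j p.1 p.2 :=
    measurable_kernelX i j measurable_fst measurable_snd
  have mY : Measurable fun p : ℂ × ℂ => X.kernelY i j p.1 p.2 :=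
    measurable_kernelY i j measurable_fst measurable_snd
  -- For j = i' the kernel Y is zero and t is irrelevant; it is set to 0, since ξ need not be in the
  -- disk where U is controlled and the true ratio may fail to be measurable.
  obtain ⟨t, ht, hteq⟩ : ∃ t : ℂ → ℂ, AEMeasurable t (X.arc j) ∧ ∀ z ζ,
      t ζ * (X.kernelY i j z ζ / kernelX i j z ζ) =
        ((U ((mobius (X.φ i)⁻¹ ζ - X.center i) / X.radius i))⁻¹ /
          V (X.radius i / (ζ - X.center i))) ^ (5 * n) *
            (X.kernelY i j z ζ / kernelX i j z ζ) := by
    by_cases hi' : j = X.inv i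
    · subst hi'
      exact ⟨fun _ => 0, aemeasurable_const, by simp [kernelY_inv]⟩
    · exact ⟨_, aemeasurable_ratio hU hU0 hV hV0 hi hi' (5 * n), fun _ _ => rfl⟩
  refine kernelEnergy_le_add_weight (w := fun z ζ => ‖kernelX i j z ζ‖ₑ ^ 2 *
    ‖1 + t ζ * (X.kernelY i j z ζ / kernelX i j z ζ)‖ₑ ^ (-(1 / 2) : ℝ)) hC mX.aemeasurable ?_
    (fun z hz ζ hζ => ?_) fun ζ hζ => hle i j ζ (sphere_subset_closedBall hζ) (t ζ)
  · have ht2 : AEMeasurable (fun p : ℂ × ℂ => t p.2) ((X.arc i).prod (X.arc j)) := ht.comp_snd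
    have hq : AEMeasurable (fun p : ℂ × ℂ =>
        1 + t p.2 * (X.kernelY i j p.1 p.2 / kernelX i j p.1 p.2)) ((X.arc i).prod (X.arc j)) :=
      (ht2.mul (mY.div mX).aemeasurable).const_add 1
    exact (mX.enorm.pow_const 2).aemeasurable.mul (hq.enorm.pow_const (-(1 / 2) : ℝ))
  · rw [hteq]
    have := enorm_mul_sq_le (A := (W z * V (X.radius i / (ζ - X.center i))) ^ n)
      (zpow_ne_zero n (mul_ne_zero (hW0 z) (hV0 _)))
      ((W z * (U ((mobius (X.φ i)⁻¹ ζ - X.center i) / X.radius i))⁻¹) ^ n)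
      (kernelX i j z ζ) (X.kernelY i j z ζ)
    rwa [← div_zpow, mul_div_mul_left _ _ (hW0 z), zpow_pow_five, zpow_pow_five, zpow_pow_five]
      at this

theorem exists_kernelEnergy_weightY_le (X : SchottkyCurve I) : ∃ C : ℝ≥0∞, C ≠ ∞ ∧
    ∀ (i j : I) (U V W : ℂ → ℂ), DiffContOnCl ℂ U (ball 0 1) → (∀ s, U s ≠ 0) →
      DiffContOnCl ℂ V (ball 0 1) → (∀ s, V s ≠ 0) → (∀ z, W z ≠ 0) → ∀ n : ℤ,
      X.kernelEnergy i j (X.weightY i j W U n) ≤ X.kernelEnergy i j (fun z ζ =>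
        X.weightX i j W V (5 * n) z ζ + X.weightY i j W U (5 * n) z ζ) +
        C * X.kernelEnergy i j (X.kernelY i j) := by
  obtain ⟨C, hC, hle⟩ := X.exists_lintegral_kernelY_rpow_le
  refine ⟨C, hC, fun i j U V W hU hU0 hV hV0 hW0 n => ?_⟩
  by_cases hi' : j = X.inv i
  · subst hi'
    simp [kernelEnergy, weightY, kernelY_inv]
  have mX : Measurable fun p : ℂ × ℂ => kernelX i j p.1 p.2 :=
    measurable_kernelX i j measurable_fst measurable_snd
  have mY : Measurable fun p : ℂ × ℂ => X.kernelY i j p.1 p.2 :=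
    measurable_kernelY i j measurable_fst measurable_snd
  obtain ⟨t, ht, hteq⟩ : ∃ t : ℂ → ℂ, AEMeasurable t (X.arc j) ∧ ∀ z ζ,
      t ζ * (kernelX i j z ζ / X.kernelY i j z ζ) =
        ((V (X.radius i / (ζ - X.center i)) /
          (U ((mobius (X.φ i)⁻¹ ζ - X.center i) / X.radius i))⁻¹)) ^ (5 * n) *
            (kernelX i j z ζ / X.kernelY i j z ζ) := by
    by_cases hi : j = i
    · subst hi
      exact ⟨fun _ => 0, aemeasurable_const, by simp [kernelX_self]⟩
    -- Here Y is the leading kernel, so the ratio of the weights is inverted.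
    · refine ⟨_, aemeasurable_ratio hU hU0 hV hV0 hi hi' (-(5 * n)), fun _ _ => ?_⟩
      rw [zpow_neg, ← inv_zpow, inv_div]
  refine kernelEnergy_le_add_weight (w := fun z ζ => ‖X.kernelY i j z ζ‖ₑ ^ 2 *
    ‖1 + t ζ * (kernelX i j z ζ / X.kernelY i j z ζ)‖ₑ ^ (-(1 / 2) : ℝ)) hC mY.aemeasurable ?_
    (fun z hz ζ hζ => ?_) fun ζ hζ => hle i j ζ (sphere_subset_closedBall hζ) (t ζ)
  · have ht2 : AEMeasurable (fun p : ℂ × ℂ => t p.2) ((X.arc i).prod (X.arc j)) := ht.comp_snd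
    have hq : AEMeasurable (fun p : ℂ × ℂ =>
        1 + t p.2 * (kernelX i j p.1 p.2 / X.kernelY i j p.1 p.2)) ((X.arc i).prod (X.arc j)) :=
      (ht2.mul (mX.div mY).aemeasurable).const_add 1
    exact (mY.enorm.pow_const 2).aemeasurable.mul (hq.enorm.pow_const (-(1 / 2) : ℝ))
  · rw [hteq, add_comm (X.weightX i j W V (5 * n) z ζ)]
    have := enorm_mul_sq_le
      (A := (W z * (U ((mobius (X.φ i)⁻¹ ζ - X.center i) / X.radius i))⁻¹) ^ n)
      (zpow_ne_zero n (mul_ne_zero (hW0 z) (inv_ne_zero (hU0 _))))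
      ((W z * V (X.radius i / (ζ - X.center i))) ^ n)
      (X.kernelY i j z ζ) (kernelX i j z ζ)
    rwa [← div_zpow, mul_div_mul_left _ _ (hW0 z), zpow_pow_five, zpow_pow_five, zpow_pow_five]
      at this

end SchottkyCurve

/-! ### Block energies of powers and products. -/

namespace SchottkyCurve

variable {I : Type*} {X : SchottkyCurve I} {i j : I} {U V U' V' W W' : ℂ → ℂ}

variable (X) in
/-- The weight `1 / V (1 / s)` on `∂ K i`. -/
def outerWeight (i : I) (V : ℂ → ℂ) (z : ℂ) : ℂ := (V (X.radius i / (z - X.center i)))⁻¹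

variable (X) in
/-- The weight `U (s)` on `∂ K i`. -/
def innerWeight (i : I) (U : ℂ → ℂ) (z : ℂ) : ℂ := U ((z - X.center i) / X.radius i)

variable (X) in
/-- The total energy between `∂ K i` and `∂ K j` of the weighted Cauchy kernels. -/
def weightEnergy (i : I) (U V : ℂ → ℂ) (n : ℤ) (j : I) : ℝ≥0∞ :=
  (X.kernelEnergy i j (X.weightX i j (X.outerWeight i V) V n) +
    X.kernelEnergy i j (X.weightY i j (X.outerWeight i V) U n)) +
  (X.kernelEnergy i j (X.weightX i j (X.innerWeight i U) V n) +
    X.kernelEnergy i j (X.weightY i j (X.innerWeight i U) U n))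

theorem blockEnergy_zpow (n : ℤ) : X.blockEnergy i (fun s => U s ^ n) (fun s => V s ^ n) j =
    X.kernelEnergy i j (fun z ζ => X.weightX i j (X.outerWeight i V) V n z ζ +
      X.weightY i j (X.outerWeight i V) U n z ζ - kernelX i j z ζ) +
    X.kernelEnergy i j (fun z ζ => X.weightX i j (X.innerWeight i U) V n z ζ +
      X.weightY i j (X.innerWeight i U) U n z ζ - X.kernelY i j z ζ) := by
  rw [blockEnergy]
  congr 2
  · funext z ζ
    simp only [kernelA, weightX, weightY, outerWeight, mul_zpow, inv_zpow]
    ring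
  · funext z ζ
    simp only [kernelA, weightX, weightY, innerWeight, mul_zpow, inv_zpow]
    ring

theorem blockEnergy_zpow_zero :
    X.blockEnergy i (fun s => U s ^ (0 : ℤ)) (fun s => V s ^ (0 : ℤ)) j =
      X.kernelEnergy i j (X.kernelY i j) + X.kernelEnergy i j (kernelX i j) := by
  rw [blockEnergy_zpow]
  simp only [weightX, weightY, zpow_zero, one_mul, add_sub_cancel_left, add_sub_cancel_right]

theorem blockEnergy_const {a : ℂ} (ha : a ≠ 0) : X.blockEnergy i (fun _ => a) (fun _ => 1) j =
    ‖a⁻¹‖ₑ ^ 2 * X.kernelEnergy i j (X.kernelY i j) +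
      ‖a‖ₑ ^ 2 * X.kernelEnergy i j (kernelX i j) := by
  rw [← kernelEnergy_const_mul, ← kernelEnergy_const_mul, blockEnergy]
  congr 2
  · funext z ζ
    rw [kernelA]
    ring
  · funext z ζ
    rw [kernelA]
    field_simp
    ring

theorem kernelEnergy_le_of_sub {s x : ℂ → ℂ → ℂ}
    (hx : ContinuousOn (fun p : ℂ × ℂ => x p.1 p.2)
      (sphere (X.center i) (X.radius i) ×ˢ closedBall (X.center j) (X.radius j))) :
    X.kernelEnergy i j s ≤ 2 * X.kernelEnergy i j (fun z ζ => s z ζ - x z ζ) +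
      2 * X.kernelEnergy i j x :=
  kernelEnergy_le_two_mul_add hx fun z _ ζ _ => by
    have := enorm_add_sq_le (s z ζ - x z ζ) (x z ζ)
    rwa [sub_add_cancel] at this

/-- The block of the power 5n contains the sums of weighted kernels minus X or Y, and the block of
the power 0 has energy E(X) + E(Y). The latter restores the subtracted kernel and also pays for the
weights p^(−1/2). -/
theorem exists_weightEnergy_le (X : SchottkyCurve I) : ∃ C : ℝ≥0∞, C ≠ ∞ ∧
    ∀ (i j : I) (U V : ℂ → ℂ), DiffContOnCl ℂ U (ball 0 1) → (∀ s, U s ≠ 0) →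
      DiffContOnCl ℂ V (ball 0 1) → (∀ s, V s ≠ 0) → ∀ n : ℤ,
      X.weightEnergy i U V n j ≤
        C * (X.blockEnergy i (fun s => U s ^ (5 * n)) (fun s => V s ^ (5 * n)) j +
          X.blockEnergy i (fun s => U s ^ (0 : ℤ)) (fun s => V s ^ (0 : ℤ)) j) := by
  obtain ⟨C₁, hC₁, h₁⟩ := X.exists_kernelEnergy_weightX_le
  obtain ⟨C₂, hC₂, h₂⟩ := X.exists_kernelEnergy_weightY_le
  refine ⟨4 * (2 + (C₁ + C₂)), ENNReal.mul_ne_top (by simp) (by simp [hC₁, hC₂]), ?_⟩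
  intro i j U V hU hU0 hV hV0 n
  rw [blockEnergy_zpow_zero, blockEnergy_zpow]
  set D₁ := X.kernelEnergy i j (fun z ζ => X.weightX i j (X.outerWeight i V) V (5 * n) z ζ +
      X.weightY i j (X.outerWeight i V) U (5 * n) z ζ - kernelX i j z ζ) with hD₁
  set D₂ := X.kernelEnergy i j (fun z ζ => X.weightX i j (X.innerWeight i U) V (5 * n) z ζ +
      X.weightY i j (X.innerWeight i U) U (5 * n) z ζ - X.kernelY i j z ζ) with hD₂
  set EX := X.kernelEnergy i j (kernelX i j) with hEX
  set EY := X.kernelEnergy i j (X.kernelY i j) with hEY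
  set D := D₁ + D₂ + (EY + EX) with hD
  have hW : ∀ z, X.outerWeight i V z ≠ 0 := fun z => inv_ne_zero (hV0 _)
  have hW' : ∀ z, X.innerWeight i U z ≠ 0 := fun z => hU0 _
  have bX : ∀ {a b : ℝ≥0∞}, a ≤ b + C₁ * EX → b ≤ 2 * D → a ≤ (2 + (C₁ + C₂)) * D :=
    fun {a b} ha hb => by
    refine ha.trans ?_
    rw [add_mul]
    refine add_le_add hb (mul_le_mul' le_self_add ?_)
    exact le_add_self.trans le_add_self
  have bY : ∀ {a b : ℝ≥0∞}, a ≤ b + C₂ * EY → b ≤ 2 * D → a ≤ (2 + (C₁ + C₂)) * D :=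
    fun {a b} ha hb => by
    refine ha.trans ?_
    rw [add_mul]
    refine add_le_add hb (mul_le_mul' le_add_self ?_)
    exact le_self_add.trans le_add_self
  have s₁ : X.kernelEnergy i j (fun z ζ => X.weightX i j (X.outerWeight i V) V (5 * n) z ζ +
      X.weightY i j (X.outerWeight i V) U (5 * n) z ζ) ≤ 2 * D := by
    refine (kernelEnergy_le_of_sub continuousOn_kernelX).trans ?_
    rw [← mul_add, hD]
    exact mul_le_mul_right (add_le_add le_self_add le_add_self) 2
  have s₂ : X.kernelEnergy i j (fun z ζ => X.weightX i j (X.innerWeight i U) V (5 * n) z ζ +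
      X.weightY i j (X.innerWeight i U) U (5 * n) z ζ) ≤ 2 * D := by
    refine (kernelEnergy_le_of_sub continuousOn_kernelY).trans ?_
    rw [← mul_add, hD]
    exact mul_le_mul_right (add_le_add le_add_self le_self_add) 2
  have e : (4 : ℝ≥0∞) * (2 + (C₁ + C₂)) * D = ((2 + (C₁ + C₂)) * D + (2 + (C₁ + C₂)) * D) +
      ((2 + (C₁ + C₂)) * D + (2 + (C₁ + C₂)) * D) := by ring
  rw [e, weightEnergy]
  exact add_le_add (add_le_add (bX (h₁ i j U V _ hU hU0 hV hV0 hW n) s₁)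
      (bY (h₂ i j U V _ hU hU0 hV hV0 hW n) s₁))
    (add_le_add (bX (h₁ i j U V _ hU hU0 hV hV0 hW' n) s₂)
      (bY (h₂ i j U V _ hU hU0 hV hV0 hW' n) s₂))

theorem kernelEnergy_mul_le {k x y k₁ k₂ : ℂ → ℂ → ℂ} {κ : ℂ → ℂ → ℂ}
    (hk : ContinuousOn (fun p : ℂ × ℂ => k₂ p.1 p.2)
      (sphere (X.center i) (X.radius i) ×ˢ closedBall (X.center j) (X.radius j)))
    (h : ∀ z ζ, k z ζ = x z ζ * y z ζ * κ z ζ) (h₁ : ∀ z ζ, k₁ z ζ = x z ζ ^ 2 * κ z ζ)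
    (h₂ : ∀ z ζ, k₂ z ζ = y z ζ ^ 2 * κ z ζ) :
    X.kernelEnergy i j k ≤ X.kernelEnergy i j k₁ + X.kernelEnergy i j k₂ :=
  kernelEnergy_le_add hk fun z _ ζ _ => by
    rw [h, h₁, h₂, enorm_mul, mul_pow, enorm_mul (_ ^ 2), mul_pow, enorm_mul (_ ^ 2), mul_pow,
      ← add_mul]
    exact mul_le_mul_left (enorm_mul_sq_le_add _ _) _

theorem zpow_two_mul (a : ℂ) (n : ℤ) : a ^ (2 * n) = (a ^ n) ^ 2 := by
  rw [mul_comm, zpow_mul]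
  norm_cast

/-- The weight of a product is the product of the weights; |xy|² ≤ |x²|² + |y²|² decouples the two
factors and doubles the exponent. -/
theorem weightX_mul_le (hW : ContinuousOn W' (sphere (X.center i) (X.radius i)))
    (hW0 : ∀ z, W' z ≠ 0) (hV : DiffContOnCl ℂ V' (ball 0 1)) (hV0 : ∀ s, V' s ≠ 0) (n : ℤ)
    {Wp : ℂ → ℂ} (hWp : ∀ z, Wp z = W z * W' z) :
    X.kernelEnergy i j (X.weightX i j Wp (fun s => V s * V' s) n) ≤
      X.kernelEnergy i j (X.weightX i j W V (2 * n)) +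
        X.kernelEnergy i j (X.weightX i j W' V' (2 * n)) := by
  refine kernelEnergy_mul_le (continuousOn_weightX hW hW0 hV hV0 _)
    (x := fun z ζ => (W z * V (X.radius i / (ζ - X.center i))) ^ n)
    (y := fun z ζ => (W' z * V' (X.radius i / (ζ - X.center i))) ^ n) (κ := kernelX i j)
    (fun z ζ => ?_) (fun z ζ => ?_) fun z ζ => ?_
  · simp only [weightX, hWp, ← mul_zpow]
    congr 2
    ring
  · rw [weightX, zpow_two_mul]
  · rw [weightX, zpow_two_mul]

theorem weightY_mul_le (hW : ContinuousOn W' (sphere (X.center i) (X.radius i)))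
    (hW0 : ∀ z, W' z ≠ 0) (hU : DiffContOnCl ℂ U' (ball 0 1)) (hU0 : ∀ s, U' s ≠ 0) (n : ℤ)
    {Wp : ℂ → ℂ} (hWp : ∀ z, Wp z = W z * W' z) :
    X.kernelEnergy i j (X.weightY i j Wp (fun s => U s * U' s) n) ≤
      X.kernelEnergy i j (X.weightY i j W U (2 * n)) +
        X.kernelEnergy i j (X.weightY i j W' U' (2 * n)) := by
  refine kernelEnergy_mul_le (continuousOn_weightY hW hW0 hU hU0 _)
    (x := fun z ζ => (W z * (U ((mobius (X.φ i)⁻¹ ζ - X.center i) / X.radius i))⁻¹) ^ n)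
    (y := fun z ζ => (W' z * (U' ((mobius (X.φ i)⁻¹ ζ - X.center i) / X.radius i))⁻¹) ^ n)
    (κ := X.kernelY i j) (fun z ζ => ?_) (fun z ζ => ?_) fun z ζ => ?_
  · simp only [weightY, hWp, ← mul_zpow, mul_inv]
    congr 2
    ring
  · rw [weightY, zpow_two_mul]
  · rw [weightY, zpow_two_mul]

theorem kernelEnergy_add_sub_le {k₁ k₂ k₃ : ℂ → ℂ → ℂ}
    (h₂ : ContinuousOn (fun p : ℂ × ℂ => k₂ p.1 p.2)
      (sphere (X.center i) (X.radius i) ×ˢ closedBall (X.center j) (X.radius j)))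
    (h₃ : ContinuousOn (fun p : ℂ × ℂ => k₃ p.1 p.2)
      (sphere (X.center i) (X.radius i) ×ˢ closedBall (X.center j) (X.radius j))) :
    X.kernelEnergy i j (fun z ζ => k₁ z ζ + k₂ z ζ - k₃ z ζ) ≤
      4 * (X.kernelEnergy i j k₁ + X.kernelEnergy i j k₂) + 4 * X.kernelEnergy i j k₃ := by
  refine (kernelEnergy_le_two_mul_add h₃ (k₁ := fun z ζ => k₁ z ζ + k₂ z ζ)
    fun z _ ζ _ => enorm_sub_sq_le _ _).trans (add_le_add ?_ ?_)
  · have := kernelEnergy_le_two_mul_add (i := i) (j := j) (k := fun z ζ => k₁ z ζ + k₂ z ζ) h₂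
      fun z _ ζ _ => enorm_add_sq_le (k₁ z ζ) (k₂ z ζ)
    refine (mul_le_mul_right this 2).trans (le_of_eq ?_)
    ring
  · exact mul_le_mul_left (by norm_num) _

/-- Possible cancellation inside the block of the product is given up: its two kernels are split by
the triangle inequality into weighted X, weighted Y and the subtracted kernel, and each weighted
kernel is decoupled. This is why the energies of the separate terms are needed. -/
theorem blockEnergy_mul_le (hU : DiffContOnCl ℂ U (ball 0 1)) (hU0 : ∀ s, U s ≠ 0)
    (hV : DiffContOnCl ℂ V (ball 0 1)) (hV0 : ∀ s, V s ≠ 0)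
    (hU' : DiffContOnCl ℂ U' (ball 0 1)) (hU0' : ∀ s, U' s ≠ 0)
    (hV' : DiffContOnCl ℂ V' (ball 0 1)) (hV0' : ∀ s, V' s ≠ 0) (n : ℤ) :
    X.blockEnergy i (fun s => (U s * U' s) ^ n) (fun s => (V s * V' s) ^ n) j ≤
      4 * (X.weightEnergy i U V (2 * n) j + X.weightEnergy i U' V' (2 * n) j +
        X.blockEnergy i (fun s => U s ^ (0 : ℤ)) (fun s => V s ^ (0 : ℤ)) j) := by
  have hr := X.radius_pos i
  have cin : ∀ {U : ℂ → ℂ}, DiffContOnCl ℂ U (ball 0 1) →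
      ContinuousOn (X.innerWeight i U) (sphere (X.center i) (X.radius i)) := fun hU =>
    continuousOn_inside hr hU
  have cout : ∀ {V : ℂ → ℂ}, DiffContOnCl ℂ V (ball 0 1) → (∀ s, V s ≠ 0) →
      ContinuousOn (X.outerWeight i V) (sphere (X.center i) (X.radius i)) := fun hV hV0 =>
    (continuousOn_outside hr hV).inv₀ fun _ _ => hV0 _
  have nout : ∀ {V : ℂ → ℂ}, (∀ s, V s ≠ 0) → ∀ z, X.outerWeight i V z ≠ 0 := fun hV0 _ =>
    inv_ne_zero (hV0 _)
  have nin : ∀ {U : ℂ → ℂ}, (∀ s, U s ≠ 0) → ∀ z, X.innerWeight i U z ≠ 0 := fun hU0 _ => hU0 _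
  have eout : ∀ z, X.outerWeight i (fun s => V s * V' s) z =
      X.outerWeight i V z * X.outerWeight i V' z := fun z => mul_inv _ _
  have ein : ∀ z, X.innerWeight i (fun s => U s * U' s) z =
      X.innerWeight i U z * X.innerWeight i U' z := fun z => rfl
  have hVV : DiffContOnCl ℂ (fun s => V s * V' s) (ball 0 1) := hV.smul hV'
  have hUU : DiffContOnCl ℂ (fun s => U s * U' s) (ball 0 1) := hU.smul hU'
  have nVV : ∀ s, V s * V' s ≠ 0 := fun s => mul_ne_zero (hV0 s) (hV0' s)
  have nUU : ∀ s, U s * U' s ≠ 0 := fun s => mul_ne_zero (hU0 s) (hU0' s)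
  rw [blockEnergy_zpow (U := fun s => U s * U' s) (V := fun s => V s * V' s), blockEnergy_zpow_zero]
  refine (add_le_add
    (kernelEnergy_add_sub_le (continuousOn_weightY (cout hVV nVV) (nout nVV) hUU nUU n)
      continuousOn_kernelX)
    (kernelEnergy_add_sub_le (continuousOn_weightY (cin hUU) (nin nUU) hUU nUU n)
      continuousOn_kernelY)).trans ?_
  refine (add_le_add
    (add_le_add_left (mul_le_mul_right (add_le_add
      (weightX_mul_le (cout hV' hV0') (nout hV0') hV' hV0' n eout)
      (weightY_mul_le (cout hV' hV0') (nout hV0') hU' hU0' n eout)) 4) _)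
    (add_le_add_left (mul_le_mul_right (add_le_add
      (weightX_mul_le (cin hU') (nin hU0') hV' hV0' n ein)
      (weightY_mul_le (cin hU') (nin hU0') hU' hU0' n ein)) 4) _)).trans (le_of_eq ?_)
  simp only [weightEnergy]
  ring

end SchottkyCurve

/-! ### From energies of rows to the Hilbert–Schmidt property. -/

namespace SchottkyCurve

variable {I : Type*} {X : SchottkyCurve I}

theorem tsum_le_tsum_Iplus (X : SchottkyCurve I) (a : I → ℝ≥0∞) :
    ∑' k, a k ≤ ∑' i : X.Iplus, (a i + a (X.inv i)) := by
  classical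
  have h1 : ∑' k, a k ≤ ∑' k, (X.Iplus.indicator a k + X.Iplus.indicator (a ∘ X.inv) (X.inv k)) := by
    refine ENNReal.tsum_le_tsum fun k => ?_
    by_cases hk : k ∈ X.Iplus
    · rw [indicator_of_mem hk]
      exact le_self_add
    · rw [indicator_of_mem ((X.mem_Iplus k).2 hk), Function.comp_apply, X.inv_inv]
      exact le_add_self
  refine h1.trans (le_of_eq ?_)
  have hinv : Function.Involutive X.inv := X.inv_inv
  rw [ENNReal.tsum_add, ENNReal.tsum_add, tsum_subtype X.Iplus a,
    tsum_subtype X.Iplus fun i => a (X.inv i)]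
  congr 1
  exact hinv.toPerm.tsum_eq (X.Iplus.indicator (a ∘ X.inv))

theorem tsum_Iplus_le (X : SchottkyCurve I) (a : I → ℝ≥0∞) :
    ∑' i : X.Iplus, (a i + a (X.inv i)) ≤ ∑' k, a k + ∑' k, a k := by
  have hinv : Function.Involutive X.inv := X.inv_inv
  rw [ENNReal.tsum_add]
  exact add_le_add (ENNReal.tsum_comp_le_tsum_of_injective Subtype.val_injective a)
    (ENNReal.tsum_comp_le_tsum_of_injective (hinv.injective.comp Subtype.val_injective) a)

/-- Every index outside of I₊ is i' for some i in I₊, so data given on the pairs assemble to a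
family over I. The cast appears because i'' = i is a propositional equality. -/
theorem exists_of_Iplus (X : SchottkyCurve I) {β : I → Type*} (A : ∀ i, β i)
    (B : ∀ i, β (X.inv i)) : ∃ S : ∀ k, β k, ∀ i ∈ X.Iplus, S i = A i ∧ S (X.inv i) = B i := by
  classical
  refine ⟨fun k => if k ∈ X.Iplus then A k else cast (congrArg β (X.inv_inv k)) (B (X.inv k)),
    fun i hi => ⟨if_pos hi, ?_⟩⟩
  have h : X.inv i ∉ X.Iplus := fun h => (X.mem_Iplus i).1 h hi
  refine (if_neg h).trans ?_
  have hB : ∀ k, k = i → HEq (B k) (B i) := by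
    rintro _ rfl
    rfl
  exact eq_of_heq ((cast_heq _ _).trans (hB _ (X.inv_inv i)))

/-- The square of the Hilbert–Schmidt norm of a block composed with the Hilbert operator. -/
def rowEnergy (K : X.HMinus →L[ℂ] X.HPlus) (i : I)
    (P : (X.Plus i × X.Plus (X.inv i)) →L[ℂ] (X.Minus i × X.Minus (X.inv i))) : ℝ≥0∞ :=
  ∑' p, (‖(P (K (X.basis p) i, K (X.basis p) (X.inv i))).1‖ₑ ^ 2 +
    ‖(P (K (X.basis p) i, K (X.basis p) (X.inv i))).2‖ₑ ^ 2)

/-- A bounded block composed with two rows of K, which are Hilbert–Schmidt by well-separation. Any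
finite set of indices can therefore be disregarded, whatever the blocks there. -/
theorem rowEnergy_ne_top {K : X.HMinus →L[ℂ] X.HPlus} (hK : X.IsHilbertOperator K) (i : I)
    (P : (X.Plus i × X.Plus (X.inv i)) →L[ℂ] (X.Minus i × X.Minus (X.inv i))) :
    rowEnergy K i P ≠ ∞ := by
  have h1 : ∀ i, ∑' p, ‖K (X.basis p) i‖ₑ ^ 2 ≠ ∞ := fun i => by
    rw [tsum_enorm_hilbert_basis_sq hK]
    exact ENNReal.mul_ne_top ENNReal.ofReal_ne_top (X.tsum_kernelEnergy_kernelX_ne_top i)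
  have h2 : ∀ (x : X.Plus i) (y : X.Plus (X.inv i)), ‖(P (x, y)).1‖ₑ ^ 2 + ‖(P (x, y)).2‖ₑ ^ 2 ≤
      ENNReal.ofReal (2 * ‖P‖ ^ 2) * (‖x‖ₑ ^ 2 + ‖y‖ₑ ^ 2) := fun x y => by
    rw [← ofReal_norm (P (x, y)).1, ← ofReal_norm (P (x, y)).2, ← ofReal_norm x, ← ofReal_norm y]
    rw [← ENNReal.ofReal_pow (norm_nonneg _), ← ENNReal.ofReal_pow (norm_nonneg _),
      ← ENNReal.ofReal_pow (norm_nonneg _), ← ENNReal.ofReal_pow (norm_nonneg _),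
      ← ENNReal.ofReal_add (by positivity) (by positivity),
      ← ENNReal.ofReal_add (by positivity) (by positivity), ← ENNReal.ofReal_mul (by positivity)]
    refine ENNReal.ofReal_le_ofReal ?_
    have a0 := P.le_opNorm (x, y)
    have a1 := (norm_fst_le (P (x, y))).trans a0
    have a2 := (norm_snd_le (P (x, y))).trans a0
    have a3 : ‖(x, y)‖ ^ 2 ≤ ‖x‖ ^ 2 + ‖y‖ ^ 2 := by
      rw [Prod.norm_def]
      rcases max_cases ‖x‖ ‖y‖ with h | h
      · rw [h.1]; nlinarith [sq_nonneg ‖y‖]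
      · rw [h.1]; nlinarith [sq_nonneg ‖x‖]
    have b1 := pow_le_pow_left₀ (norm_nonneg _) a1 2
    have b2 := pow_le_pow_left₀ (norm_nonneg _) a2 2
    rw [mul_pow] at b1 b2
    have b3 := mul_le_mul_of_nonneg_left a3 (sq_nonneg ‖P‖)
    linarith
  refine ne_top_of_le_ne_top ?_ (ENNReal.tsum_le_tsum fun p => h2 _ _)
  rw [ENNReal.tsum_mul_left, ENNReal.tsum_add]
  exact ENNReal.mul_ne_top ENNReal.ofReal_ne_top
    (ENNReal.add_ne_top.2 ⟨h1 i, h1 (X.inv i)⟩)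

namespace Bundle

variable {L : X.Bundle}

theorem GluingCompIsHilbertSchmidt.exists_rowEnergy {K : X.HMinus →L[ℂ] X.HPlus}
    (h : L.GluingCompIsHilbertSchmidt K) :
    ∃ P : ∀ i, (X.Plus i × X.Plus (X.inv i)) →L[ℂ] (X.Minus i × X.Minus (X.inv i)),
      (∀ i ∈ X.Iplus, L.IsGluingBlock i (P i)) ∧ ∑' i : X.Iplus, rowEnergy K i (P i) ≠ ∞ := by
  obtain ⟨P, hP, T, hT, hPT⟩ := h
  refine ⟨P, hP, ?_⟩
  rw [isHilbertSchmidtOperator_iff X.basis] at hT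
  have e : ∑' i : X.Iplus, rowEnergy K i (P i) =
      ∑' i : X.Iplus, (∑' p, ‖T (X.basis p) i‖ₑ ^ 2 + ∑' p, ‖T (X.basis p) (X.inv i)‖ₑ ^ 2) := by
    refine tsum_congr fun i => ?_
    rw [rowEnergy, ← ENNReal.tsum_add]
    refine tsum_congr fun p => ?_
    rw [hPT (X.basis p) i i.2]
  have e2 : ∑' k, ∑' p, ‖T (X.basis p) k‖ₑ ^ 2 = ∑' p, ‖T (X.basis p)‖ₑ ^ 2 := by
    rw [ENNReal.tsum_comm]
    exact tsum_congr fun p => (lp_enorm_sq _).symm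
  rw [e]
  refine ne_top_of_le_ne_top ?_ (X.tsum_Iplus_le fun k => ∑' p, ‖T (X.basis p) k‖ₑ ^ 2)
  rw [e2]
  exact ENNReal.add_ne_top.2 ⟨hT, hT⟩

/-- Finite total energy makes the components of Π K x square-summable for every x, so K maps into
the domain of the possibly unbounded Π without a separate argument. -/
theorem gluingCompIsHilbertSchmidt_of_rowEnergy {K : X.HMinus →L[ℂ] X.HPlus}
    {P : ∀ i, (X.Plus i × X.Plus (X.inv i)) →L[ℂ] (X.Minus i × X.Minus (X.inv i))}
    (hP : ∀ i ∈ X.Iplus, L.IsGluingBlock i (P i))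
    (h : ∑' i : X.Iplus, rowEnergy K i (P i) ≠ ∞) : L.GluingCompIsHilbertSchmidt K := by
  let ev : ∀ i, X.HPlus →L[ℂ] X.Plus i := fun i => lp.evalCLM ℂ (fun i => X.Plus i) 2 i
  let Q : ∀ i, X.HMinus →L[ℂ] (X.Minus i × X.Minus (X.inv i)) := fun i =>
    P i ∘L ((ev i).prod (ev (X.inv i))) ∘L K
  have hQ : ∀ i x, Q i x = P i (K x i, K x (X.inv i)) := fun i x => rfl
  obtain ⟨S, hS⟩ := X.exists_of_Iplus (β := fun k => X.HMinus →L[ℂ] X.Minus k)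
    (fun i => ContinuousLinearMap.fst ℂ _ _ ∘L Q i) (fun i => ContinuousLinearMap.snd ℂ _ _ ∘L Q i)
  obtain ⟨T, hT, hTS⟩ := exists_isHilbertSchmidtOperator_lp X.basis S (by
    refine ne_top_of_le_ne_top h ((X.tsum_le_tsum_Iplus _).trans (le_of_eq ?_))
    refine tsum_congr fun i => ?_
    rw [rowEnergy, ← ENNReal.tsum_add]
    refine tsum_congr fun p => ?_
    rw [(hS i i.2).1, (hS i i.2).2]
    rfl)
  refine ⟨P, hP, T, hT, fun x i hi => ?_⟩
  rw [hTS, hTS, (hS i hi).1, (hS i hi).2]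
  rfl

/-- The gluing function is a product of invertible functions holomorphic inside and outside of the
circle. -/
structure IsFactorization (L : X.Bundle) (i : I) (U V : ℂ → ℂ) : Prop where
  inner : DiffContOnCl ℂ U (ball 0 1)
  inner_ne_zero : ∀ s, U s ≠ 0
  outer : DiffContOnCl ℂ V (ball 0 1)
  outer_ne_zero : ∀ s, V s ≠ 0
  eq : ∀ z ∈ sphere (X.center i) (X.radius i), L.ψ i z =
    U ((z - X.center i) / X.radius i) * V (X.radius i / (z - X.center i))
  index_eq_zero : L.index i = 0

theorem exists_isFactorization {i : I} (h : L.index i = 0) : ∃ U V, L.IsFactorization i U V := by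
  obtain ⟨k, hk, U, V, hU, hV, hU0, hV0, hψ⟩ := L.exists_factorization i
  have hk0 : k = 0 := by
    rw [hk] at h
    exact_mod_cast h
  subst hk0
  refine ⟨U, V, hU, hU0, hV, hV0, fun z hz => ?_, h⟩
  rw [hψ z hz, zpow_zero, one_mul]

theorem IsFactorization.rowEnergy_eq {i : I} {U V : ℂ → ℂ} (h : L.IsFactorization i U V)
    {K : X.HMinus →L[ℂ] X.HPlus} (hK : X.IsHilbertOperator K)
    {P : (X.Plus i × X.Plus (X.inv i)) →L[ℂ] (X.Minus i × X.Minus (X.inv i))}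
    (hP : L.IsGluingBlock i P) : rowEnergy K i P =
      ENNReal.ofReal (4 * Real.pi ^ 2)⁻¹ * ∑' j, X.blockEnergy i U V j :=
  tsum_enorm_block_hilbert_basis_sq hK h.inner h.inner_ne_zero h.outer h.outer_ne_zero h.eq
    ((hP.1 h.index_eq_zero).trans (L.gluingSpace_eq i))

theorem GluingCompIsHilbertSchmidt.tsum_blockEnergy_ne_top {K : X.HMinus →L[ℂ] X.HPlus}
    (hK : X.IsHilbertOperator K) (h : L.GluingCompIsHilbertSchmidt K) {J : Set I}
    (hJ : J ⊆ X.Iplus) {U V : I → ℂ → ℂ} (hUV : ∀ i ∈ J, L.IsFactorization i (U i) (V i)) :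
    ∑' i : J, ∑' j, X.blockEnergy i (U i) (V i) j ≠ ∞ := by
  obtain ⟨P, hP, hsum⟩ := h.exists_rowEnergy
  have h1 : ∑' i : J, rowEnergy K i (P i) ≠ ∞ :=
    ne_top_of_le_ne_top hsum (ENNReal.tsum_mono_subtype (fun i => rowEnergy K i (P i)) hJ)
  have h2 : ∑' i : J, rowEnergy K i (P i) = ENNReal.ofReal (4 * Real.pi ^ 2)⁻¹ *
      ∑' i : J, ∑' j, X.blockEnergy i (U i) (V i) j := by
    rw [← ENNReal.tsum_mul_left]
    exact tsum_congr fun i => (hUV i i.2).rowEnergy_eq hK (hP i (hJ i.2))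
  intro htop
  rw [h2, htop, ENNReal.mul_top] at h1
  · exact h1 rfl
  · rw [Ne, ENNReal.ofReal_eq_zero, not_le]
    positivity

/-- The finite set E collects the indices without a usable factorization; arbitrary blocks are
chosen there and contribute a finite energy. -/
theorem gluingCompIsHilbertSchmidt_of_blockEnergy {K : X.HMinus →L[ℂ] X.HPlus}
    (hK : X.IsHilbertOperator K) {E : Set I} (hE : E.Finite) {U V : I → ℂ → ℂ}
    (hUV : ∀ i ∈ X.Iplus \ E, L.IsFactorization i (U i) (V i))
    (h : ∑' i : ↑(X.Iplus \ E), ∑' j, X.blockEnergy i (U i) (V i) j ≠ ∞) :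
    L.GluingCompIsHilbertSchmidt K := by
  choose P hP using fun i => L.exists_isGluingBlock i
  refine gluingCompIsHilbertSchmidt_of_rowEnergy (P := P) (fun i _ => hP i) ?_
  have hsub : X.Iplus ⊆ (X.Iplus \ E) ∪ E := fun i hi => by
    by_cases h : i ∈ E
    · exact Or.inr h
    · exact Or.inl ⟨hi, h⟩
  refine ne_top_of_le_ne_top ?_ ((ENNReal.tsum_mono_subtype (fun i => rowEnergy K i (P i))
    hsub).trans (ENNReal.tsum_union_le (fun i => rowEnergy K i (P i)) _ _))
  refine ENNReal.add_ne_top.2 ⟨?_, ?_⟩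
  · have h2 : ∑' i : ↑(X.Iplus \ E), rowEnergy K i (P i) = ENNReal.ofReal (4 * Real.pi ^ 2)⁻¹ *
        ∑' i : ↑(X.Iplus \ E), ∑' j, X.blockEnergy i (U i) (V i) j := by
      rw [← ENNReal.tsum_mul_left]
      exact tsum_congr fun i => (hUV i i.2).rowEnergy_eq hK (hP i)
    rw [h2]
    exact ENNReal.mul_ne_top ENNReal.ofReal_ne_top h
  · have := hE.fintype
    rw [tsum_fintype]
    exact ENNReal.sum_ne_top.2 fun i _ => rowEnergy_ne_top hK i (P i)

end Bundle

end SchottkyCurve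

/-! ### Log-convexity and tensor products. -/

namespace SchottkyCurve

variable {I : Type*} {X : SchottkyCurve I}

namespace Bundle

variable {L M N : X.Bundle} {i : I} {U V U' V' : ℂ → ℂ}

theorem dual_pow (L : X.Bundle) (n : ℤ) : (L.pow n).dual = L.pow (-n) := by
  have h : (L.pow n).dual.ψ = (L.pow (-n)).ψ := by
    funext i z
    exact (zpow_neg _ _).symm
  generalize (L.pow n).dual = A at h
  generalize L.pow (-n) = B at h
  cases A
  cases B
  cases h
  rfl

theorem IsFactorization.pow (h : L.IsFactorization i U V) (n : ℤ) :
    (L.pow n).IsFactorization i (fun s => U s ^ n) (fun s => V s ^ n) where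
  inner := ⟨fun s hs => (h.inner.1 s hs).zpow (Or.inl (h.inner_ne_zero s)),
    h.inner.2.zpow₀ n fun s _ => Or.inl (h.inner_ne_zero s)⟩
  inner_ne_zero s := zpow_ne_zero n (h.inner_ne_zero s)
  outer := ⟨fun s hs => (h.outer.1 s hs).zpow (Or.inl (h.outer_ne_zero s)),
    h.outer.2.zpow₀ n fun s _ => Or.inl (h.outer_ne_zero s)⟩
  outer_ne_zero s := zpow_ne_zero n (h.outer_ne_zero s)
  eq z hz := by
    change L.ψ i z ^ n = _
    rw [h.eq z hz, mul_zpow]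
  index_eq_zero := by rw [index_pow, h.index_eq_zero, mul_zero]

theorem IsFactorization.tensor (h : L.IsFactorization i U V) (h' : M.IsFactorization i U' V') :
    (L.tensor M).IsFactorization i (fun s => U s * U' s) (fun s => V s * V' s) where
  inner := ⟨h.inner.1.mul h'.inner.1, h.inner.2.mul h'.inner.2⟩
  inner_ne_zero s := mul_ne_zero (h.inner_ne_zero s) (h'.inner_ne_zero s)
  outer := ⟨h.outer.1.mul h'.outer.1, h.outer.2.mul h'.outer.2⟩
  outer_ne_zero s := mul_ne_zero (h.outer_ne_zero s) (h'.outer_ne_zero s)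
  eq z hz := by
    change L.ψ i z * M.ψ i z = _
    rw [h.eq z hz, h'.eq z hz, mul_mul_mul_comm]
  index_eq_zero := by rw [index_tensor, h.index_eq_zero, h'.index_eq_zero, add_zero]

theorem ne_zero_of_const {a : ℂ} (h : ∀ z ∈ X.annulus i, L.ψ i z = a) : a ≠ 0 := by
  obtain ⟨z, hz⟩ := NormedSpace.sphere_nonempty (x := X.center i).2 (X.radius_pos i).le
  exact h z (X.sphere_subset_annulus i hz) ▸ L.ne_zero_of_mem_sphere hz

theorem isFactorization_const {a : ℂ} (h : ∀ z ∈ X.annulus i, L.ψ i z = a) :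
    L.IsFactorization i (fun _ => a) (fun _ => 1) where
  inner := diffContOnCl_const
  inner_ne_zero _ := ne_zero_of_const h
  outer := diffContOnCl_const
  outer_ne_zero _ := one_ne_zero
  eq z hz := by rw [h z (X.sphere_subset_annulus i hz), mul_one]
  index_eq_zero := L.index_eq_zero_of_const h

theorem IsAlmostConstant.isFiniteDegree (h : L.IsAlmostConstant) : L.IsFiniteDegree :=
  h.subset fun _ hi ⟨_, ha⟩ => hi (L.index_eq_zero_of_const ha)

theorem enorm_sq_le_of_sq_eq_mul {a b c : ℂ} (h : a ^ 2 = b * c) :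
    ‖a‖ₑ ^ 2 ≤ ‖b‖ₑ ^ 2 + ‖c‖ₑ ^ 2 := by
  rw [← enorm_pow, h, enorm_mul]
  rcases le_total ‖b‖ₑ ‖c‖ₑ with h | h
  · exact (mul_le_mul_left h _).trans (by rw [← sq]; exact le_add_self)
  · exact (mul_le_mul_right h _).trans (by rw [← sq]; exact le_self_add)

/-- The energy is |a|⁻² E(Y) + |a|² E(X), and the relation a² = bc holds for the inverses as well;
both coefficients are then dominated by the sums of those for b and c. -/
theorem blockEnergy_const_le {a b c : ℂ} (ha : a ≠ 0) (hb : b ≠ 0) (hc : c ≠ 0)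
    (h : a ^ 2 = b * c) (j : I) : X.blockEnergy i (fun _ => a) (fun _ => 1) j ≤
      X.blockEnergy i (fun _ => b) (fun _ => 1) j +
        X.blockEnergy i (fun _ => c) (fun _ => 1) j := by
  have h' : a⁻¹ ^ 2 = b⁻¹ * c⁻¹ := by rw [inv_pow, h, mul_inv]
  rw [blockEnergy_const ha, blockEnergy_const hb, blockEnergy_const hc, add_add_add_comm, ← add_mul,
    ← add_mul]
  gcongr
  · exact enorm_sq_le_of_sq_eq_mul h'
  · exact enorm_sq_le_of_sq_eq_mul h

theorem GluingCompIsHilbertSchmidt.of_sq_eq_mul {K : X.HMinus →L[ℂ] X.HPlus}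
    (hK : X.IsHilbertOperator K) {N₁ N₂ : X.Bundle} {E : Set I} (hE : E.Finite) {a a₁ a₂ : I → ℂ}
    (ha : ∀ i ∉ E, ∀ z ∈ X.annulus i, N.ψ i z = a i)
    (ha₁ : ∀ i ∉ E, ∀ z ∈ X.annulus i, N₁.ψ i z = a₁ i)
    (ha₂ : ∀ i ∉ E, ∀ z ∈ X.annulus i, N₂.ψ i z = a₂ i)
    (h : ∀ i ∉ E, a i ^ 2 = a₁ i * a₂ i) (h₁ : N₁.GluingCompIsHilbertSchmidt K)
    (h₂ : N₂.GluingCompIsHilbertSchmidt K) : N.GluingCompIsHilbertSchmidt K := by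
  refine gluingCompIsHilbertSchmidt_of_blockEnergy hK hE (U := fun i _ => a i) (V := fun _ _ => 1)
    (fun i hi => isFactorization_const (ha i hi.2)) ?_
  have e₁ := h₁.tsum_blockEnergy_ne_top hK (J := X.Iplus \ E) sdiff_subset
    (U := fun i _ => a₁ i) (V := fun _ _ => 1) fun i hi => isFactorization_const (ha₁ i hi.2)
  have e₂ := h₂.tsum_blockEnergy_ne_top hK (J := X.Iplus \ E) sdiff_subset
    (U := fun i _ => a₂ i) (V := fun _ _ => 1) fun i hi => isFactorization_const (ha₂ i hi.2)
  refine ne_top_of_le_ne_top (ENNReal.add_ne_top.2 ⟨e₁, e₂⟩) ?_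
  rw [← ENNReal.tsum_add]
  refine ENNReal.tsum_le_tsum fun i => ?_
  rw [← ENNReal.tsum_add]
  exact ENNReal.tsum_le_tsum fun j => blockEnergy_const_le (ne_zero_of_const (ha i i.2.2))
    (ne_zero_of_const (ha₁ i i.2.2)) (ne_zero_of_const (ha₂ i i.2.2)) (h i i.2.2) j

/-- Log-convexity of the Hilbert–Schmidt property for almost constant gluing functions. -/
theorem IsAlmostConstant.isHilbertSchmidt (hL : L.IsAlmostConstant) (hM : M.IsAlmostConstant)
    (h₁ : (M.tensor L).IsHilbertSchmidt) (h₂ : (M.tensor L.dual).IsHilbertSchmidt) :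
    M.IsHilbertSchmidt := by
  obtain ⟨-, K, hK, h₁, h₁'⟩ := h₁
  obtain ⟨-, K', hK', h₂, h₂'⟩ := h₂
  -- Each hypothesis comes with its own Hilbert operator.
  obtain rfl := X.isHilbertOperator_unique hK hK'
  have hE := hL.union hM
  set E := {i | ¬ ∃ a : ℂ, ∀ z ∈ X.annulus i, L.ψ i z = a} ∪
    {i | ¬ ∃ a : ℂ, ∀ z ∈ X.annulus i, M.ψ i z = a} with hE'
  have hLE : ∀ i, ∃ a, i ∉ E → ∀ z ∈ X.annulus i, L.ψ i z = a := fun i => by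
    by_cases hi : ∃ a : ℂ, ∀ z ∈ X.annulus i, L.ψ i z = a
    · exact hi.imp fun _ ha _ => ha
    · exact ⟨0, fun h => absurd (Or.inl hi) h⟩
  have hME : ∀ i, ∃ a, i ∉ E → ∀ z ∈ X.annulus i, M.ψ i z = a := fun i => by
    by_cases hi : ∃ a : ℂ, ∀ z ∈ X.annulus i, M.ψ i z = a
    · exact hi.imp fun _ ha _ => ha
    · exact ⟨0, fun h => absurd (Or.inr hi) h⟩
  choose a ha using hLE
  choose b hb using hME
  -- With a the constants of ℒ and b those of ℳ, b² = (ba)(b/a) serves Π_{ψ}, and the inverse of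
  -- this identity serves Π_{ψ⁻¹}.
  refine ⟨hM.isFiniteDegree, K, hK, h₁.of_sq_eq_mul hK hE (a := b) (a₁ := fun i => b i * a i)
    (a₂ := fun i => b i * (a i)⁻¹) hb ?_ ?_ ?_ h₂, h₁'.of_sq_eq_mul hK hE (a := fun i => (b i)⁻¹)
    (a₁ := fun i => (b i * a i)⁻¹) (a₂ := fun i => (b i * (a i)⁻¹)⁻¹) ?_ ?_ ?_ ?_ h₂'⟩ <;>
    intro i hi
  · exact fun z hz => congrArg₂ (· * ·) (hb i hi z hz) (ha i hi z hz)
  · exact fun z hz => congrArg₂ (· * ·) (hb i hi z hz) (congrArg (·⁻¹) (ha i hi z hz))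
  · have := ne_zero_of_const (ha i hi)
    field_simp
  · exact fun z hz => congrArg (·⁻¹) (hb i hi z hz)
  · exact fun z hz => congrArg (·⁻¹) (congrArg₂ (· * ·) (hb i hi z hz) (ha i hi z hz))
  · exact fun z hz => congrArg (·⁻¹) (congrArg₂ (· * ·) (hb i hi z hz) (congrArg (·⁻¹) (ha i hi z hz)))
  · have := ne_zero_of_const (ha i hi)
    have := ne_zero_of_const (hb i hi)
    field_simp

theorem tsum_tsum_ne_top_of_le {α β : Type*} {f g h : α → β → ℝ≥0∞} {C : ℝ≥0∞} (hC : C ≠ ∞)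
    (hle : ∀ a b, f a b ≤ C * (g a b + h a b)) (hg : ∑' a, ∑' b, g a b ≠ ∞)
    (hh : ∑' a, ∑' b, h a b ≠ ∞) : ∑' a, ∑' b, f a b ≠ ∞ := by
  refine ne_top_of_le_ne_top (ENNReal.mul_ne_top hC (ENNReal.add_ne_top.2 ⟨hg, hh⟩)) ?_
  simp only [← ENNReal.tsum_add, ← ENNReal.tsum_mul_left]
  exact ENNReal.tsum_le_tsum fun a => ENNReal.tsum_le_tsum fun b => hle a b

theorem tsum_weightEnergy_ne_top {K : X.HMinus →L[ℂ] X.HPlus}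
    (hK : X.IsHilbertOperator K) (h : ∀ n : ℤ, (L.pow n).GluingCompIsHilbertSchmidt K) {J : Set I}
    (hJ : J ⊆ X.Iplus) {U V : I → ℂ → ℂ} (hUV : ∀ i ∈ J, L.IsFactorization i (U i) (V i)) (n : ℤ) :
    ∑' i : J, ∑' j, X.weightEnergy i (U i) (V i) n j ≠ ∞ := by
  obtain ⟨C, hC, hle⟩ := X.exists_weightEnergy_le
  have e : ∀ m : ℤ, ∑' i : J, ∑' j,
      X.blockEnergy i (fun s => U i s ^ m) (fun s => V i s ^ m) j ≠ ∞ := fun m =>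
    (h m).tsum_blockEnergy_ne_top hK hJ (U := fun i s => U i s ^ m) (V := fun i s => V i s ^ m)
      fun i hi => (hUV i hi).pow m
  have hb : ∀ (i : J) j, X.weightEnergy i (U i) (V i) n j ≤
      C * (X.blockEnergy i (fun s => U i s ^ (5 * n)) (fun s => V i s ^ (5 * n)) j +
        X.blockEnergy i (fun s => U i s ^ (0 : ℤ)) (fun s => V i s ^ (0 : ℤ)) j) := fun i j =>
    hle i j _ _ (hUV i i.2).inner (hUV i i.2).inner_ne_zero (hUV i i.2).outer
      (hUV i i.2).outer_ne_zero n
  exact tsum_tsum_ne_top_of_le hC hb (e (5 * n)) (e 0)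

theorem gluingCompIsHilbertSchmidt_tensor_pow {K : X.HMinus →L[ℂ] X.HPlus}
    (hK : X.IsHilbertOperator K) (hLd : L.IsFiniteDegree) (hMd : M.IsFiniteDegree)
    (hL : ∀ n : ℤ, (L.pow n).GluingCompIsHilbertSchmidt K)
    (hM : ∀ n : ℤ, (M.pow n).GluingCompIsHilbertSchmidt K) (n : ℤ) :
    ((L.tensor M).pow n).GluingCompIsHilbertSchmidt K := by
  have hfac : ∀ (L : X.Bundle) i, ∃ U V, L.index i = 0 → L.IsFactorization i U V := fun L i => by
    by_cases h : L.index i = 0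
    · exact (exists_isFactorization h).imp fun U => Exists.imp fun V hUV _ => hUV
    -- A value without meaning, at an index that is put in the exceptional set E.
    · exact ⟨0, 0, fun h' => absurd h' h⟩
  choose U V hUV using hfac L
  choose U' V' hUV' using hfac M
  set E := {i | L.index i ≠ 0} ∪ {i | M.index i ≠ 0}
  have h : ∀ i ∈ X.Iplus \ E, L.IsFactorization i (U i) (V i) := fun i hi =>
    hUV i (not_not.1 fun h => hi.2 (Or.inl h))
  have h' : ∀ i ∈ X.Iplus \ E, M.IsFactorization i (U' i) (V' i) := fun i hi =>
    hUV' i (not_not.1 fun h => hi.2 (Or.inr h))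
  refine gluingCompIsHilbertSchmidt_of_blockEnergy hK (hLd.union hMd)
    (fun i hi => ((h i hi).tensor (h' i hi)).pow n) ?_
  -- The exponent is doubled by the decoupling of the product. With the fifth power in the separate
  -- estimates, this uses the power 10n of each bundle, together with the power 0.
  have e := tsum_weightEnergy_ne_top hK hL sdiff_subset h (2 * n)
  have e' := tsum_weightEnergy_ne_top hK hM sdiff_subset h' (2 * n)
  have e₀ := (hL 0).tsum_blockEnergy_ne_top hK sdiff_subset fun i hi => (h i hi).pow 0
  refine tsum_tsum_ne_top_of_le (by simp : (4 : ℝ≥0∞) ≠ ∞) (fun i j => blockEnergy_mul_le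
    (h i i.2).inner (h i i.2).inner_ne_zero (h i i.2).outer (h i i.2).outer_ne_zero
    (h' i i.2).inner (h' i i.2).inner_ne_zero (h' i i.2).outer (h' i i.2).outer_ne_zero n) ?_ e₀
  simp only [ENNReal.tsum_add]
  exact ENNReal.add_ne_top.2 ⟨e, e'⟩

theorem IsStronglyHilbertSchmidt.isFiniteDegree (h : L.IsStronglyHilbertSchmidt) :
    L.IsFiniteDegree :=
  (h 1).1.subset fun i hi => by
    change (L.pow 1).index i ≠ 0
    rw [index_pow, Int.cast_one, one_mul]
    exact hi

theorem IsStronglyHilbertSchmidt.gluingCompIsHilbertSchmidt (h : L.IsStronglyHilbertSchmidt)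
    {K : X.HMinus →L[ℂ] X.HPlus} (hK : X.IsHilbertOperator K) (n : ℤ) :
    (L.pow n).GluingCompIsHilbertSchmidt K := by
  obtain ⟨-, K', hK', h, -⟩ := h n
  exact X.isHilbertOperator_unique hK' hK ▸ h

/-- Strongly Hilbert–Schmidt bundles are closed under tensor products. -/
theorem IsStronglyHilbertSchmidt.tensor (hL : L.IsStronglyHilbertSchmidt)
    (hM : M.IsStronglyHilbertSchmidt) : (L.tensor M).IsStronglyHilbertSchmidt := fun n => by
  obtain ⟨-, K, hK, -, -⟩ := hL 0
  have h := gluingCompIsHilbertSchmidt_tensor_pow hK hL.isFiniteDegree hM.isFiniteDegree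
    (hL.gluingCompIsHilbertSchmidt hK) (hM.gluingCompIsHilbertSchmidt hK)
  refine ⟨(hL.isFiniteDegree.union hM.isFiniteDegree).subset fun i hi => ?_, K, hK, h n,
    dual_pow (L.tensor M) n ▸ h (-n)⟩
  by_contra hc
  simp only [mem_union, mem_ofPred_eq, not_or, not_not] at hc
  exact hi (by rw [index_pow, index_tensor, hc.1, hc.2, add_zero, mul_zero])

end Bundle

end SchottkyCurve

end

theorem mainTheorem11 {I : Type*} (X : SchottkyCurve I) :
    (∀ L M : X.Bundle, L.IsAlmostConstant → M.IsAlmostConstant →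
      (M.tensor L).IsHilbertSchmidt → (M.tensor L.dual).IsHilbertSchmidt → M.IsHilbertSchmidt) ∧
    (∀ L M : X.Bundle, L.IsStronglyHilbertSchmidt → M.IsStronglyHilbertSchmidt →
      (L.tensor M).IsStronglyHilbertSchmidt) :=
  ⟨fun _ _ hL hM h₁ h₂ => hL.isHilbertSchmidt hM h₁ h₂, fun _ _ hL hM => hL.tensor hM⟩
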